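/- **Conventions.** A curve in $\mathbb S^2\subset\mathbb R^3$ parametrized by arc length has unit normal $N=\gamma\times\dot\gamma$ and signed geodesic curvature $\kappa=\ddot\gamma\cdot N$. For $\lambda\in\mathbb R$ a *$1/2$-elastica* with multiplier $\lambda$ is an arc-length parametrized $C^4$ curve $\gamma:I\to\mathbb S^2$ on a nonempty open interval $I$ which is stationary for $\int(\sqrt{|\kappa|}+\lambda)\,ds$ with respect to compactly supported variations (with each curve $C^4$, and smooth in the deformation parameter) whose support contains no point with $\kappa=0$. Let $\eta_\lambda$ be the unique positive solution of $t^4+2\lambda t^3-1=0$. For $\lambda<0$ let $u_\lambda$ be the unique positive root of $4\lambda^2t^3+8\lambda^3t^2-t+2\lambda=0$; for $\lambda\ge0$ put $u_\lambda=\infty$. For $\xi>0$ let $Q(t)=t^4+4\lambda t^3+4(\lambda^2-\xi^2)t^2+1$. A *B-curve* with multiplier $\lambda$ is a smooth arc-length parametrized curve $\mathbb R\to\mathbb S^2$ whose geodesic curvature $\kappa$ is positive, non-constant and periodic and such that $\mu=\sqrt\kappa$ satisfies $\dot\mu^2=-\mu^2Q(\mu)$ for some $\xi>0$. **Theorem.**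 Let $\lambda\in\mathbb R$. (1) Let $e_1>\eta_\lambda$ and $\xi=\frac{1}{2e_1}\sqrt{1+(e_1(e_1+2\lambda))^2}$, so that $Q(e_1)=0$. There is exactly one pair $(\omega,\mu)$ such that $\mu:\mathbb R\to\mathbb R$ is a non-constant $C^2$ solution of $\dot\mu^2=-\mu^2Q(\mu)$ with least period $\omega$ and $\mu(\omega/2)=e_1$. It satisfies $\mu>0$. Every non-constant $C^2$ solution of the equation on an open interval that takes the value $e_1$ is positive and is the restriction of a translate of $\mu$; in particular such a solution on $\mathbb R$ is positive and periodic. (2) With $(\omega,\mu)$ as in (1), define $$\theta(s)=2\xi\int_{\omega/2}^s\frac{\mu^2(\mu+2\lambda)}{1-4\xi^2\mu^2}\,dt,\qquad h=\frac1{2\xi\mu},\qquad \rho=\frac{\sigma\sqrt{4\xi^2\mu^2-1}}{2\xi\mu},$$ where $\sigma(s)=-1$ if $e_1=u_\lambda$ and $s\in[(2k+1)\omega,(2k+2)\omega)$ for some $k\in\mathbb Z$, and $\sigma(s)=1$ otherwise. The integrand of $\theta$ is integrable on every bounded interval (where $e_1=u_\lambda$ it is understood off the discrete set $\omega\mathbb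 Z$), and $$\gamma_{\lambda,e_1}=(h,\,-\rho\cos\theta,\,\rho\sin\theta)$$ is the standard B-curve with parameters $(\lambda,e_1)$, that is, the unique B-curve with multiplier $\lambda$ and geodesic curvature $\mu^2$ satisfying $$\gamma\left(\tfrac\omega2\right)=\frac{\left(1,\,-e_1(e_1+2\lambda),\,0\right)}{\sqrt{1+(e_1(e_1+2\lambda))^2}},\qquad \dot\gamma\left(\tfrac\omega2\right)=(0,0,-1).$$ It is a $1/2$-elastica with multiplier $\lambda$. If $e_1\ne u_\lambda$, then $\rho>0$ and the curve does not pass through $(1,0,0)$. If $e_1=u_\lambda$, then $\gamma_{\lambda,e_1}(s)=(1,0,0)$ exactly for $s\in\omega\mathbb Z$, $\rho>0$ on $(0,\omega)$ and $\rho(s+\omega)=-\rho(s)$ for all $s$. (3) Let $\gamma:I\to\mathbb S^2$ be a $1/2$-elastica with multiplier $\lambda$ and non-constant geodesic curvature $\kappa$. Then $\kappa$ vanishes nowhere, and there are $e_1>\eta_\lambda$, $A\in SO(3)$ and $a\in\mathbb R$ such that for all $s\in I$, $\gamma(s)=A\,\gamma_{\lambda,e_1}(s+a)$ if $\kappa>0$,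 and $\gamma(s)=A\,\gamma_{\lambda,e_1}(-s+a)$ if $\kappa<0$. If $I$ is the maximal domain of $\gamma$ as a $1/2$-elastica, then $I=\mathbb R$. -/

import Mathlib

open Set
open scoped Matrix

noncomputable section

namespace SphElastica

/-! ### Spherical curves -/

/-- Euclidean three-space; the unit sphere `S²` is the set of vectors of norm one. -/
abbrev E3 : Type := EuclideanSpace ℝ (Fin 3)

/-- The vector cross product of `ℝ³`. -/
def cross (x y : E3) : E3 := WithLp.toLp 2 (crossProduct x.ofLp y.ofLp)

/-- The action of a `3 × 3` matrix on `ℝ³`. -/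
def act (A : Matrix (Fin 3) (Fin 3) ℝ) (x : E3) : E3 := WithLp.toLp 2 (A *ᵥ x.ofLp)

/-- The signed geodesic curvature of an immersed spherical curve `c` with an arbitrary regular
parameter. The unit normal is `N = c × T`, `T = c' / ‖c'‖`, and
`κ = ⟪dT/ds, N⟫ = ⟪c'', c × c'⟫ / ‖c'‖ ^ 3` where `s` is the arc length. -/
def geodCurv (c : ℝ → E3) (s : ℝ) : ℝ :=
  inner ℝ (deriv (deriv c) s) (cross (c s) (deriv c s)) / ‖deriv c s‖ ^ 3

/-! ### Critical curves of the functional `∫ (√|κ| + lam) ds` -/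

/-- The value of the `1/2`-Bernoulli functional with multiplier `lam` on the part of the immersed
curve `c` parametrized by `K`. -/
def energy (lam : ℝ) (K : Set ℝ) (c : ℝ → E3) : ℝ :=
  ∫ s in K, (√|geodCurv c s| + lam) * ‖deriv c s‖

/-- `Γ` (as the family of curves `s ↦ Γ t s`, `|t| < ε`) is a variation of `γ : I → S²` through
spherical curves, supported in the compact set `K ⊆ I`. The curves are `C⁴`, as `γ` is, and the
dependence on the deformation parameter `t` is smooth. -/
structure IsVariation (I K : Set ℝ) (γ : ℝ → E3) (ε : ℝ) (Γ : ℝ → ℝ → E3) : Prop where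
  pos : 0 < ε
  compact : IsCompact K
  subset : K ⊆ I
  contDiffOn : ContDiffOn ℝ 4 (fun p : ℝ × ℝ => Γ p.1 p.2) (Ioo (-ε) ε ×ˢ I)
  smooth : ∀ s ∈ I, ContDiffOn ℝ (⊤ : ℕ∞) (fun t => Γ t s) (Ioo (-ε) ε)
  sphere : ∀ t ∈ Ioo (-ε) ε, ∀ s ∈ I, ‖Γ t s‖ = 1
  initial : ∀ s ∈ I, Γ 0 s = γ s
  support : ∀ t ∈ Ioo (-ε) ε, ∀ s ∈ I \ K, Γ t s = γ s

/-- `γ : I → S²` is a `1/2`-elastica with multiplier `lam`: an arc-length parametrized spherical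
curve of class `C⁴` on the nonempty open interval `I` that is stationary for the functional with
respect to compactly supported variations whose support contains no inflection point. -/
structure IsElastica (lam : ℝ) (I : Set ℝ) (γ : ℝ → E3) : Prop where
  isOpen : IsOpen I
  ordConnected : I.OrdConnected
  nonempty : I.Nonempty
  contDiffOn : ContDiffOn ℝ 4 γ I
  sphere : ∀ s ∈ I, ‖γ s‖ = 1
  arcLength : ∀ s ∈ I, ‖deriv γ s‖ = 1
  stationary : ∀ (K : Set ℝ) (ε : ℝ) (Γ : ℝ → ℝ → E3), IsVariation I K γ ε Γ →
    (∀ s ∈ K, geodCurv γ s ≠ 0) → HasDerivAt (fun t => energy lam K (Γ t)) 0 0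

/-- The `1/2`-elastica `γ : I → S²` cannot be extended to a `1/2`-elastica on a larger open
interval: `I` is its maximal domain of definition. -/
def IsMaximalDomain (lam : ℝ) (I : Set ℝ) (γ : ℝ → E3) : Prop :=
  ∀ (J : Set ℝ) (c : ℝ → E3), IsElastica lam J c → I ⊆ J → EqOn c γ I → J = I

/-! ### The parameters -/

theorem existsUnique_eta (lam : ℝ) : ∃! t : ℝ, 0 < t ∧ t ^ 4 + 2 * lam * t ^ 3 - 1 = 0 := by
  have hex : ∃ t : ℝ, 0 < t ∧ t ^ 4 + 2 * lam * t ^ 3 - 1 = 0 := by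
    have hM : (0 : ℝ) ≤ 1 + 2 * |lam| := by positivity
    have hc : ContinuousOn (fun t : ℝ => t ^ 4 + 2 * lam * t ^ 3 - 1) (Icc 0 (1 + 2 * |lam|)) := by
      fun_prop
    have h1 : (1 : ℝ) ≤ (1 + 2 * |lam|) ^ 3 := one_le_pow₀ (by linarith [abs_nonneg lam])
    have h2 : (1 : ℝ) ≤ 1 + 2 * |lam| + 2 * lam := by linarith [neg_abs_le lam]
    have h3 : (0 : ℝ) ∈ Icc ((fun t : ℝ => t ^ 4 + 2 * lam * t ^ 3 - 1) 0)
        ((fun t : ℝ => t ^ 4 + 2 * lam * t ^ 3 - 1) (1 + 2 * |lam|)) := by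
      constructor
      · norm_num
      · have := mul_le_mul h1 h2 (by norm_num) (by positivity)
        simp only
        nlinarith
    obtain ⟨t, ht, h⟩ := intermediate_value_Icc hM hc h3
    refine ⟨t, lt_of_le_of_ne ht.1 ?_, h⟩
    rintro rfl
    norm_num at h
  obtain ⟨t, ht, h⟩ := hex
  have key : ∀ a b : ℝ, 0 < a → a < b → a ^ 4 + 2 * lam * a ^ 3 - 1 = 0 →
      b ^ 4 + 2 * lam * b ^ 3 - 1 = 0 → False := by
    intro a b ha hab h1 h2
    have e1 : a ^ 3 * (a + 2 * lam) = 1 := by linarith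
    have e2 : b ^ 3 * (b + 2 * lam) = 1 := by linarith
    have p1 : 0 < a + 2 * lam := by
      by_contra hn
      nlinarith [pow_pos ha 3]
    have p2 : a ^ 3 < b ^ 3 := pow_lt_pow_left₀ hab ha.le (by norm_num)
    have : a ^ 3 * (a + 2 * lam) < b ^ 3 * (b + 2 * lam) :=
      mul_lt_mul'' p2 (by linarith) (by positivity) p1.le
    linarith
  refine ⟨t, ⟨ht, h⟩, ?_⟩
  rintro y ⟨hy, hy'⟩
  rcases lt_trichotomy y t with hlt | heq | hgt
  · exact (key y t hy hlt hy' h).elim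
  · exact heq
  · exact (key t y ht hgt h hy').elim

/-- `η_lam`, the unique positive solution of `t⁴ + 2 lam t³ - 1 = 0`. -/
def eta (lam : ℝ) : ℝ := (existsUnique_eta lam).choose

theorem existsUnique_u (lam : ℝ) (hl : lam < 0) :
    ∃! t : ℝ, 0 < t ∧ 4 * lam ^ 2 * t ^ 3 + 8 * lam ^ 3 * t ^ 2 - t + 2 * lam = 0 := by
  have hex : ∃ t : ℝ, 0 < t ∧ 4 * lam ^ 2 * t ^ 3 + 8 * lam ^ 3 * t ^ 2 - t + 2 * lam = 0 := by
    have hi : lam⁻¹ < 0 := inv_lt_zero.mpr hl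
    have hM : (0 : ℝ) ≤ -2 * lam - lam⁻¹ := by linarith
    have hc : ContinuousOn (fun t : ℝ => 4 * lam ^ 2 * t ^ 3 + 8 * lam ^ 3 * t ^ 2 - t + 2 * lam)
        (Icc 0 (-2 * lam - lam⁻¹)) := by
      fun_prop
    have h3 : (0 : ℝ) ∈ Icc
        ((fun t : ℝ => 4 * lam ^ 2 * t ^ 3 + 8 * lam ^ 3 * t ^ 2 - t + 2 * lam) 0)
        ((fun t : ℝ => 4 * lam ^ 2 * t ^ 3 + 8 * lam ^ 3 * t ^ 2 - t + 2 * lam)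
          (-2 * lam - lam⁻¹)) := by
      constructor
      · simp only
        linarith
      · have e : 4 * lam ^ 2 * (-2 * lam - lam⁻¹) ^ 3 + 8 * lam ^ 3 * (-2 * lam - lam⁻¹) ^ 2
            - (-2 * lam - lam⁻¹) + 2 * lam
            = -lam⁻¹ * (4 * (2 * lam ^ 2 + 1) ^ 2 - 1 - 4 * lam ^ 2) := by
          have : lam ≠ 0 := hl.ne
          field_simp
          ring
        simp only
        rw [e]
        apply mul_nonneg (by linarith)
        nlinarith [sq_nonneg lam, sq_nonneg (lam ^ 2)]
    obtain ⟨t, ht, h⟩ := intermediate_value_Icc hM hc h3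
    refine ⟨t, lt_of_le_of_ne ht.1 ?_, h⟩
    rintro rfl
    norm_num at h
    linarith
  obtain ⟨t, ht, h⟩ := hex
  have key : ∀ a b : ℝ, 0 < a → a < b →
      4 * lam ^ 2 * a ^ 3 + 8 * lam ^ 3 * a ^ 2 - a + 2 * lam = 0 →
      4 * lam ^ 2 * b ^ 3 + 8 * lam ^ 3 * b ^ 2 - b + 2 * lam = 0 → False := by
    intro a b ha hab h1 h2
    have hl2 : 0 < lam ^ 2 := by nlinarith
    have p1 : 0 < a + 2 * lam := by
      by_contra hn
      have : 4 * lam ^ 2 * a ^ 2 * (a + 2 * lam) ≤ 0 :=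
        mul_nonpos_of_nonneg_of_nonpos (by positivity) (by linarith)
      nlinarith
    have e : 4 * lam ^ 2 * (a * b) * ((b - a) * (b + (a + 2 * lam))) = 2 * lam * (b - a) := by
      linear_combination a * h2 - b * h1
    have q1 : 0 < 4 * lam ^ 2 * (a * b) * ((b - a) * (b + (a + 2 * lam))) := by
      have : 0 < b := ha.trans hab
      have : 0 < b - a := by linarith
      positivity
    nlinarith
  refine ⟨t, ⟨ht, h⟩, ?_⟩
  rintro y ⟨hy, hy'⟩
  rcases lt_trichotomy y t with hlt | heq | hgt
  · exact (key y t hy hlt hy' h).elim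
  · exact heq
  · exact (key t y ht hgt h hy').elim

/-- `u_lam`: for `lam < 0` the unique positive root of
`4 lam² t³ + 8 lam³ t² - t + 2 lam = 0`, and `∞` for `lam ≥ 0`. -/
def uRoot (lam : ℝ) : WithTop ℝ :=
  if hl : lam < 0 then ((existsUnique_u lam hl).choose : ℝ) else ⊤

/-- The constant `ξ` with `Q(e₁) = 0`. -/
def xi (lam e₁ : ℝ) : ℝ := √(1 + (e₁ * (e₁ + 2 * lam)) ^ 2) / (2 * e₁)

/-- The quartic polynomial `Q`. -/
def quartic (lam ξ t : ℝ) : ℝ := t ^ 4 + 4 * lam * t ^ 3 + 4 * (lam ^ 2 - ξ ^ 2) * t ^ 2 + 1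

/-! ### The invariant `μ` -/

/-- `μ` is a non-constant solution of class `C²` of `μ̇² = -μ² Q(μ)` on `J`. -/
structure IsSolution (lam ξ : ℝ) (J : Set ℝ) (μ : ℝ → ℝ) : Prop where
  contDiffOn : ContDiffOn ℝ 2 μ J
  nonconst : ∃ s ∈ J, ∃ t ∈ J, μ s ≠ μ t
  ode : ∀ s ∈ J, deriv μ s ^ 2 = -(μ s) ^ 2 * quartic lam ξ (μ s)

/-- `ω` is the least (positive) period of `f`. -/
def IsLeastPeriod (f : ℝ → ℝ) (ω : ℝ) : Prop := IsLeast {T : ℝ | 0 < T ∧ Function.Periodic f T} ω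

/-- `μ` solves the Cauchy problem `μ̇² = -μ² Q(μ)`, `μ(ω/2) = e₁`, with `ω` the least period
of `μ`. -/
structure IsCauchySolution (lam e₁ ω : ℝ) (μ : ℝ → ℝ) : Prop where
  solution : IsSolution lam (xi lam e₁) univ μ
  leastPeriod : IsLeastPeriod μ ω
  initial : μ (ω / 2) = e₁

/-! ### B-curves -/

/-- `γ : ℝ → S²` is a B-curve with multiplier `lam`. -/
structure IsBCurve (lam : ℝ) (γ : ℝ → E3) : Prop where
  contDiff : ContDiff ℝ (⊤ : ℕ∞) γ
  sphere : ∀ s, ‖γ s‖ = 1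
  arcLength : ∀ s, ‖deriv γ s‖ = 1
  convex : ∀ s, 0 < geodCurv γ s
  periodic : ∃ T, 0 < T ∧ Function.Periodic (geodCurv γ) T
  solution : ∃ ξ, 0 < ξ ∧ IsSolution lam ξ univ (fun s => √(geodCurv γ s))

/-- `γ` is the standard B-curve with parameters `lam, e₁`, where `μ` with least period `ω` is the
solution of the Cauchy problem: its curvature is `μ²` and it has the prescribed position and
velocity at `ω / 2`. -/
structure IsStandardBCurve (lam e₁ ω : ℝ) (μ : ℝ → ℝ) (γ : ℝ → E3) : Prop where
  isBCurve : IsBCurve lam γ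
  curvature : ∀ s, geodCurv γ s = μ s ^ 2
  position : γ (ω / 2) = !₂[1 / √(1 + (e₁ * (e₁ + 2 * lam)) ^ 2),
    -(e₁ * (e₁ + 2 * lam)) / √(1 + (e₁ * (e₁ + 2 * lam)) ^ 2), 0]
  velocity : deriv γ (ω / 2) = !₂[0, 0, -1]

/-! ### The explicit parametrization -/

open Classical in
/-- The sign `σ`: it is `-1` exactly on the intervals `[(2k+1)ω, 2(k+1)ω)` in the exceptional case
`e₁ = u_lam`, and `1` otherwise. -/
def sigma (lam e₁ ω s : ℝ) : ℝ :=
  if (e₁ : WithTop ℝ) = uRoot lam ∧ ∃ k : ℤ, s ∈ Ico ((2 * k + 1) * ω) (2 * (k + 1) * ω)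
  then -1 else 1

/-- The integrand of the angular function. -/
def angularIntegrand (lam e₁ : ℝ) (μ : ℝ → ℝ) (t : ℝ) : ℝ :=
  μ t ^ 2 * (μ t + 2 * lam) / (1 - 4 * xi lam e₁ ^ 2 * μ t ^ 2)

/-- The angular function `θ`. -/
def theta (lam e₁ ω : ℝ) (μ : ℝ → ℝ) (s : ℝ) : ℝ :=
  2 * xi lam e₁ * ∫ t in (ω / 2)..s, angularIntegrand lam e₁ μ t

/-- The radial function `ρ`. -/
def radial (lam e₁ ω : ℝ) (μ : ℝ → ℝ) (s : ℝ) : ℝ :=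
  sigma lam e₁ ω s * √(4 * xi lam e₁ ^ 2 * μ s ^ 2 - 1) / (2 * xi lam e₁ * μ s)

/-- The height function `h`. -/
def height (lam e₁ : ℝ) (μ : ℝ → ℝ) (s : ℝ) : ℝ := 1 / (2 * xi lam e₁ * μ s)

/-- The curve `(h, -ρ cos θ, ρ sin θ)`. -/
def explicitCurve (lam e₁ ω : ℝ) (μ : ℝ → ℝ) (s : ℝ) : E3 :=
  !₂[height lam e₁ μ s,
    -radial lam e₁ ω μ s * Real.cos (theta lam e₁ ω μ s),
    radial lam e₁ ω μ s * Real.sin (theta lam e₁ ω μ s)]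

end SphElastica

end

/-! Write F(κ) = √|κ|, p = F'(κ) and N = γ × γ̇. Away from inflections, integration by parts turns
the first variation into ∫ ⟨W, N⟩ E ds, where W is the variation field and E = p̈ + (κ² + 1) p − κ
(F + λ). Hence a 1/2-elastica is a curve with E = 0 wherever κ ≠ 0 (`IsVariation.hasDerivAt_energy`,
`IsElastica.eulerLagrange_eq_zero`, and conversely `ArcCurve.isElastica`).

Where κ > 0, put μ = √κ, so that p = 1/(2μ). The quantity 4ṗ² + (μ + 2λ)² + 1/μ² is conserved,
because its derivative is 8ṗE. Its last summand is 1/κ, so κ stays above a positive constant and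
cannot reach zero (`ArcCurve.geodCurv_pos_of_eulerLagrange`). With the constant named 4ξ²,
conservation reads μ̇² = −μ²Q(μ): motion in the potential well V(t) = (t + 2λ)² + 1/t², whose
minimum on t > 0 is at η. A non-constant μ has energy above V(η) and oscillates between two turning
points b < η < a = e₁.

The substitution μ = (a+b)/2 + (a−b)/2 · cos φ removes the singularity at the turning points and
yields the periodic solution (`exists_phase`). Since a and b are simple roots of Q, a non-constant
C² solution cannot rest there; it satisfies a regular second-order equation, so it is a translate of
the periodic one (`IsSolution.deriv_deriv_eq`, `IsSolution.eq_translate`).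

For the curve, (h, ḣ, (μ + 2λ)/(2ξ)) solves the Frenet system and has length one by the conservation
law. These are the components, in the frame (γ, γ̇, N), of a fixed unit vector, which is taken as
the first axis. Thus h is the first coordinate, ρ² = 1 − h², and the first coordinate of N gives
ρ²θ̇ = −(μ + 2λ)/(2ξ). The curve meets the axis exactly when b = −2λ, that is e₁ = u_λ. In that case
ρ is a smooth positive factor times the cosine of half the phase, σ is the sign of that cosine, and
the factor μ − b cancels in θ̇.

A spherical curve is determined up to rotation by its curvature (`ArcCurve.eqOn_of_geodCurv_eq`),
which gives the classification; reversing the parameter exchanges κ > 0 and κ < 0. As the explicit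
curves are defined on all of ℝ, so is every maximal elastica. -/

namespace SphElastica

/-! ### Vector algebra in three-space -/

theorem inner_eq (x y : E3) : inner ℝ x y = x 0 * y 0 + x 1 * y 1 + x 2 * y 2 := by
  simp [PiLp.inner_apply, Fin.sum_univ_three, mul_comm]

theorem cross_zero (x y : E3) : cross x y 0 = x 1 * y 2 - x 2 * y 1 := by
  simp [cross, crossProduct]

theorem cross_one (x y : E3) : cross x y 1 = x 2 * y 0 - x 0 * y 2 := by
  simp [cross, crossProduct]

theorem cross_two (x y : E3) : cross x y 2 = x 0 * y 1 - x 1 * y 0 := by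
  simp [cross, crossProduct]

theorem ext_three {x y : E3} (h0 : x 0 = y 0) (h1 : x 1 = y 1) (h2 : x 2 = y 2) : x = y := by
  ext i
  fin_cases i <;> assumption

/-- The cross product as a continuous bilinear map. -/
noncomputable def crossL : E3 →L[ℝ] E3 →L[ℝ] E3 :=
  LinearMap.toContinuousBilinearMap <| LinearMap.mk₂ ℝ cross
    (fun x y z => by apply ext_three <;> simp [cross_zero, cross_one, cross_two] <;> ring)
    (fun c x y => by apply ext_three <;> simp [cross_zero, cross_one, cross_two] <;> ring)
    (fun x y z => by apply ext_three <;> simp [cross_zero, cross_one, cross_two] <;> ring)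
    (fun c x y => by apply ext_three <;> simp [cross_zero, cross_one, cross_two] <;> ring)

theorem crossL_apply (x y : E3) : crossL x y = cross x y := rfl

theorem _root_.HasDerivAt.cross {f g : ℝ → E3} {f' g' : E3} {s : ℝ} (hf : HasDerivAt f f' s)
    (hg : HasDerivAt g g' s) :
    HasDerivAt (fun t => SphElastica.cross (f t) (g t))
      (SphElastica.cross (f s) g' + SphElastica.cross f' (g s)) s := by
  simpa [crossL_apply] using crossL.hasDerivAt_of_bilinear (fun _ => hf) (fun _ => hg)

theorem _root_.ContDiffOn.cross {E : Type*} [NormedAddCommGroup E] [NormedSpace ℝ E] {f g : E → E3}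
    {n : WithTop ℕ∞} {S : Set E} (hf : ContDiffOn ℝ n f S) (hg : ContDiffOn ℝ n g S) :
    ContDiffOn ℝ n (fun t => SphElastica.cross (f t) (g t)) S :=
  crossL.isBoundedBilinearMap.contDiff.comp_contDiffOn (hf.prodMk hg)

theorem inner_self_of_norm {x : E3} (hx : ‖x‖ = 1) : inner ℝ x x = (1 : ℝ) := by
  rw [real_inner_self_eq_norm_sq, hx, one_pow]

theorem norm_of_inner_self {x : E3} (hx : inner ℝ x x = (1 : ℝ)) : ‖x‖ = 1 := by
  rw [real_inner_self_eq_norm_sq] at hx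
  exact (pow_eq_one_iff_of_nonneg (norm_nonneg x) two_ne_zero).1 hx

theorem inner_cross_left (x y : E3) : inner ℝ x (cross x y) = (0 : ℝ) := by
  simp only [inner_eq, cross_zero, cross_one, cross_two]; ring

theorem inner_cross_right (x y : E3) : inner ℝ y (cross x y) = (0 : ℝ) := by
  simp only [inner_eq, cross_zero, cross_one, cross_two]; ring

theorem inner_cross_cross (x y : E3) : inner ℝ (cross x y) (cross x y) =
    (inner ℝ x x * inner ℝ y y - inner ℝ x y ^ 2 : ℝ) := by
  simp only [inner_eq, cross_zero, cross_one, cross_two]; ring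

/-- The triple product is invariant under cyclic permutations. -/
theorem inner_cross_rotate (x y z : E3) : inner ℝ x (cross y z) = (inner ℝ z (cross x y) : ℝ) := by
  simp only [inner_eq, cross_zero, cross_one, cross_two]; ring

theorem cross_cross (x y z : E3) :
    cross x (cross y z) = (inner ℝ x z : ℝ) • y - (inner ℝ x y : ℝ) • z := by
  apply ext_three <;>
    simp only [inner_eq, cross_zero, cross_one, cross_two, PiLp.sub_apply, PiLp.smul_apply,
      smul_eq_mul] <;> ring

theorem cross_self (x : E3) : cross x x = 0 := by
  apply ext_three <;> simp [cross_zero, cross_one, cross_two] <;> ring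

theorem cross_neg (x y : E3) : cross x (-y) = -cross x y := by
  rw [← crossL_apply, map_neg, crossL_apply]

theorem cross_add (x y z : E3) : cross x (y + z) = cross x y + cross x z := by
  rw [← crossL_apply, map_add, crossL_apply, crossL_apply]

theorem cross_smul (c : ℝ) (x y : E3) : cross x (c • y) = c • cross x y := by
  rw [← crossL_apply, map_smul, crossL_apply]

/-- The matrix with rows `x`, `y` and `x × y`. -/
noncomputable def frame (x y : E3) : Matrix (Fin 3) (Fin 3) ℝ :=
  !![x 0, x 1, x 2; y 0, y 1, y 2; cross x y 0, cross x y 1, cross x y 2]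

theorem frame_mul_transpose {x y : E3} (hx : ‖x‖ = 1) (hy : ‖y‖ = 1)
    (hxy : inner ℝ x y = (0 : ℝ)) : frame x y * (frame x y)ᵀ = 1 := by
  have h1 := inner_self_of_norm hx
  have h2 := inner_self_of_norm hy
  have h3 := inner_cross_left x y
  have h4 := inner_cross_right x y
  have h5 := inner_cross_cross x y
  rw [h1, h2, hxy] at h5
  simp only [inner_eq] at h1 h2 h3 h4 h5 hxy
  ext i j
  fin_cases i <;> fin_cases j <;>
    simp [frame, Matrix.mul_apply, Fin.sum_univ_three] <;> linarith

theorem frame_mem {x y : E3} (hx : ‖x‖ = 1) (hy : ‖y‖ = 1)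
    (hxy : inner ℝ x y = (0 : ℝ)) : frame x y ∈ Matrix.specialOrthogonalGroup (Fin 3) ℝ := by
  rw [Matrix.mem_specialOrthogonalGroup_iff, Matrix.mem_orthogonalGroup_iff]
  refine ⟨by simpa [Matrix.star_eq_conjTranspose] using frame_mul_transpose hx hy hxy, ?_⟩
  have h5 := inner_cross_cross x y
  rw [inner_self_of_norm hx, inner_self_of_norm hy, hxy] at h5
  simp only [inner_eq, cross_zero, cross_one, cross_two] at h5
  simp [frame, Matrix.det_fin_three, cross_zero, cross_one, cross_two]
  linarith

theorem frame_mulVec (x y z : E3) :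
    act (frame x y) z = !₂[inner ℝ x z, inner ℝ y z, inner ℝ (cross x y) z] := by
  apply ext_three <;>
    simp [act, frame, dotProduct, Fin.sum_univ_three, inner_eq]

theorem act_mul (A B : Matrix (Fin 3) (Fin 3) ℝ) (x : E3) : act (A * B) x = act A (act B x) := by
  simp [act, Matrix.mulVec_mulVec]

theorem act_one (x : E3) : act 1 x = x := by simp [act]

theorem expand_frame {x y : E3} (hx : ‖x‖ = 1) (hy : ‖y‖ = 1) (hxy : inner ℝ x y = (0 : ℝ))
    (z : E3) : z = (inner ℝ x z : ℝ) • x + (inner ℝ y z : ℝ) • y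
      + (inner ℝ (cross x y) z : ℝ) • cross x y := by
  have h : (frame x y)ᵀ * frame x y = 1 := mul_eq_one_comm.1 (frame_mul_transpose hx hy hxy)
  have h1 : act (frame x y)ᵀ (act (frame x y) z) = z := by rw [← act_mul, h, act_one]
  rw [frame_mulVec] at h1
  conv_lhs => rw [← h1]
  apply ext_three <;>
    simp [act, frame, Matrix.mulVec, dotProduct, Fin.sum_univ_three] <;> ring

/-! ### Rotations -/

/-- The action of a matrix as a continuous linear map. -/
noncomputable def actL (A : Matrix (Fin 3) (Fin 3) ℝ) : E3 →L[ℝ] E3 :=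
  LinearMap.toContinuousLinearMap
    { toFun := act A
      map_add' := fun x y => by simp [act, Matrix.mulVec_add]
      map_smul' := fun c x => by simp [act, Matrix.mulVec_smul] }

theorem act_apply (A : Matrix (Fin 3) (Fin 3) ℝ) (x : E3) (i : Fin 3) :
    act A x i = A i 0 * x 0 + A i 1 * x 1 + A i 2 * x 2 := by
  simp [act, Matrix.mulVec, dotProduct, Fin.sum_univ_three]

variable {A : Matrix (Fin 3) (Fin 3) ℝ}

theorem inner_act (hA : A ∈ Matrix.specialOrthogonalGroup (Fin 3) ℝ) (x y : E3) :
    inner ℝ (act A x) (act A y) = (inner ℝ x y : ℝ) := by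
  rw [Matrix.mem_specialOrthogonalGroup_iff, Matrix.mem_orthogonalGroup_iff'] at hA
  have h := hA.1
  have e : ∀ u v : E3, (inner ℝ u v : ℝ) = u.ofLp ⬝ᵥ v.ofLp := fun u v => by
    simp [inner_eq, dotProduct, Fin.sum_univ_three]
  rw [e, e]
  simp only [act]
  rw [Matrix.dotProduct_mulVec, Matrix.vecMul_mulVec, ← Matrix.mulVec_transpose]
  have h' : Aᵀ * A = 1 := by simpa [Matrix.star_eq_conjTranspose] using h
  rw [Matrix.transpose_mul, Matrix.transpose_transpose, h', Matrix.one_mulVec]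

theorem norm_act (hA : A ∈ Matrix.specialOrthogonalGroup (Fin 3) ℝ) (x : E3) :
    ‖act A x‖ = ‖x‖ := by
  have := inner_act hA x x
  rw [real_inner_self_eq_norm_sq, real_inner_self_eq_norm_sq] at this
  exact (sq_eq_sq₀ (norm_nonneg _) (norm_nonneg _)).1 this

/-- For a rotation the adjugate equals the transpose, so every entry of A is its own cofactor; the
coordinates of Ax × Ay are combinations of these cofactors. -/
theorem cross_act (hA : A ∈ Matrix.specialOrthogonalGroup (Fin 3) ℝ) (x y : E3) :
    cross (act A x) (act A y) = act A (cross x y) := by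
  have hA' := hA
  rw [Matrix.mem_specialOrthogonalGroup_iff, Matrix.mem_orthogonalGroup_iff'] at hA
  have h' : Aᵀ * A = 1 := by simpa [Matrix.star_eq_conjTranspose] using hA.1
  have h2 : A.adjugate = Aᵀ := by
    have := Matrix.mul_adjugate A
    rw [hA.2, one_smul] at this
    calc A.adjugate = (Aᵀ * A) * A.adjugate := by rw [h', one_mul]
      _ = Aᵀ := by rw [mul_assoc, this, mul_one]
  rw [Matrix.adjugate_fin_three] at h2
  have e : ∀ i j, _ := fun i j => congrFun (congrFun h2 i) j
  have a00 := e 0 0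
  have a01 := e 0 1
  have a02 := e 0 2
  have a10 := e 1 0
  have a11 := e 1 1
  have a12 := e 1 2
  have a20 := e 2 0
  have a21 := e 2 1
  have a22 := e 2 2
  simp at a00 a01 a02 a10 a11 a12 a20 a21 a22
  apply ext_three <;> simp only [cross_zero, cross_one, cross_two, act_apply]
  · rw [← a00, ← a10, ← a20]; ring
  · rw [← a01, ← a11, ← a21]; ring
  · rw [← a02, ← a12, ← a22]; ring

/-- The rotation sends the first orthonormal frame to the standard basis and the standard basis to
the second frame. -/
theorem exists_rotation {x y x' y' : E3} (hx : ‖x‖ = 1) (hy : ‖y‖ = 1)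
    (hxy : inner ℝ x y = (0 : ℝ)) (hx' : ‖x'‖ = 1) (hy' : ‖y'‖ = 1)
    (hxy' : inner ℝ x' y' = (0 : ℝ)) :
    ∃ B ∈ Matrix.specialOrthogonalGroup (Fin 3) ℝ, act B x = x' ∧ act B y = y' := by
  have h2 := frame_mem hx' hy' hxy'
  have h : (frame x' y')ᵀ * frame x' y' = 1 :=
    mul_eq_one_comm.1 (frame_mul_transpose hx' hy' hxy')
  have h3 : (frame x' y')ᵀ ∈ Matrix.specialOrthogonalGroup (Fin 3) ℝ := by
    rw [Matrix.mem_specialOrthogonalGroup_iff, Matrix.mem_orthogonalGroup_iff'] at h2 ⊢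
    refine ⟨?_, by rw [Matrix.det_transpose]; exact h2.2⟩
    simpa [Matrix.star_eq_conjTranspose] using frame_mul_transpose hx' hy' hxy'
  refine ⟨_, mul_mem h3 (frame_mem hx hy hxy), ?_, ?_⟩
  · rw [act_mul, frame_mulVec, inner_self_of_norm hx, real_inner_comm, hxy, real_inner_comm,
      inner_cross_left]
    have : act (frame x' y') x' = !₂[1, 0, 0] := by
      rw [frame_mulVec, inner_self_of_norm hx', real_inner_comm, hxy', real_inner_comm,
        inner_cross_left]
    rw [← this, ← act_mul, h, act_one]
  · rw [act_mul, frame_mulVec, inner_self_of_norm hy, hxy, real_inner_comm, inner_cross_right]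
    have : act (frame x' y') y' = !₂[0, 1, 0] := by
      rw [frame_mulVec, inner_self_of_norm hy', hxy', real_inner_comm, inner_cross_right]
    rw [← this, ← act_mul, h, act_one]

/-! ### Arc-length parametrized spherical curves -/

/-- A spherical curve of class `C⁴`, parametrized by arc length on the open set `I`. -/
structure ArcCurve (I : Set ℝ) (γ : ℝ → E3) : Prop where
  isOpen : IsOpen I
  contDiffOn : ContDiffOn ℝ 4 γ I
  sphere : ∀ s ∈ I, ‖γ s‖ = 1
  arcLength : ∀ s ∈ I, ‖deriv γ s‖ = 1

/-- The normal `γ × γ'` of a spherical curve. -/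
noncomputable def normal (γ : ℝ → E3) (s : ℝ) : E3 := cross (γ s) (deriv γ s)

theorem _root_.ContDiffOn.deriv_right {E : Type*} [NormedAddCommGroup E] [NormedSpace ℝ E]
    {f : ℝ → E} {I : Set ℝ} {m n : WithTop ℕ∞} (hf : ContDiffOn ℝ n f I) (hI : IsOpen I)
    (h : m + 1 ≤ n) : ContDiffOn ℝ m (deriv f) I :=
  hf.deriv_of_isOpen hI h

theorem _root_.ContDiffOn.hasDerivAt_of_isOpen {E : Type*} [NormedAddCommGroup E]
    [NormedSpace ℝ E] {f : ℝ → E} {I : Set ℝ} {n : WithTop ℕ∞} (hf : ContDiffOn ℝ n f I)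
    (hI : IsOpen I) (hn : n ≠ 0) {s : ℝ} (hs : s ∈ I) : HasDerivAt f (deriv f s) s :=
  ((hf.differentiableOn hn).differentiableAt (hI.mem_nhds hs)).hasDerivAt

/-- A function that is constant on an open set has derivative zero there. -/
theorem eq_zero_of_hasDerivAt_of_eqOn_const {E : Type*} [NormedAddCommGroup E] [NormedSpace ℝ E]
    {f : ℝ → E} {f' c : E} {I : Set ℝ} (hI : IsOpen I) {s : ℝ} (hs : s ∈ I)
    (h : ∀ t ∈ I, f t = c) (hf : HasDerivAt f f' s) : f' = 0 :=
  hf.unique ((hasDerivAt_const s c).congr_of_eventuallyEq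
    (Filter.eventuallyEq_of_mem (hI.mem_nhds hs) h))

namespace ArcCurve

variable {I : Set ℝ} {γ : ℝ → E3} {s : ℝ}

theorem contDiffOn_deriv (h : ArcCurve I γ) : ContDiffOn ℝ 3 (deriv γ) I :=
  h.contDiffOn.deriv_right h.isOpen (by norm_num)

theorem contDiffOn_deriv_deriv (h : ArcCurve I γ) : ContDiffOn ℝ 2 (deriv (deriv γ)) I :=
  h.contDiffOn_deriv.deriv_right h.isOpen (by norm_num)

theorem contDiffOn_normal (h : ArcCurve I γ) : ContDiffOn ℝ 3 (normal γ) I :=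
  (h.contDiffOn.of_le (by norm_num)).cross h.contDiffOn_deriv

theorem hasDerivAt (h : ArcCurve I γ) (hs : s ∈ I) : HasDerivAt γ (deriv γ s) s :=
  h.contDiffOn.hasDerivAt_of_isOpen h.isOpen (by norm_num) hs

theorem hasDerivAt_deriv (h : ArcCurve I γ) (hs : s ∈ I) :
    HasDerivAt (deriv γ) (deriv (deriv γ) s) s :=
  h.contDiffOn_deriv.hasDerivAt_of_isOpen h.isOpen (by norm_num) hs

theorem inner_self (h : ArcCurve I γ) (hs : s ∈ I) : inner ℝ (γ s) (γ s) = (1 : ℝ) :=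
  inner_self_of_norm (h.sphere s hs)

theorem inner_deriv_self (h : ArcCurve I γ) (hs : s ∈ I) :
    inner ℝ (deriv γ s) (deriv γ s) = (1 : ℝ) :=
  inner_self_of_norm (h.arcLength s hs)

theorem inner_deriv (h : ArcCurve I γ) (hs : s ∈ I) : inner ℝ (γ s) (deriv γ s) = (0 : ℝ) := by
  have := eq_zero_of_hasDerivAt_of_eqOn_const h.isOpen hs (fun t ht => h.inner_self ht)
    ((h.hasDerivAt hs).inner ℝ (h.hasDerivAt hs))
  rw [real_inner_comm (γ s) (deriv γ s)] at this
  linarith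

theorem inner_deriv_deriv (h : ArcCurve I γ) (hs : s ∈ I) :
    inner ℝ (γ s) (deriv (deriv γ) s) = (-1 : ℝ) := by
  have := eq_zero_of_hasDerivAt_of_eqOn_const h.isOpen hs (fun t ht => h.inner_deriv ht)
    ((h.hasDerivAt hs).inner ℝ (h.hasDerivAt_deriv hs))
  rw [h.inner_deriv_self hs] at this
  linarith

theorem inner_deriv_deriv' (h : ArcCurve I γ) (hs : s ∈ I) :
    inner ℝ (deriv γ s) (deriv (deriv γ) s) = (0 : ℝ) := by
  have := eq_zero_of_hasDerivAt_of_eqOn_const h.isOpen hs (fun t ht => h.inner_deriv_self ht)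
    ((h.hasDerivAt_deriv hs).inner ℝ (h.hasDerivAt_deriv hs))
  rw [real_inner_comm (deriv γ s) (deriv (deriv γ) s)] at this
  linarith

theorem geodCurv_eq (h : ArcCurve I γ) (hs : s ∈ I) :
    geodCurv γ s = inner ℝ (deriv (deriv γ) s) (normal γ s) := by
  rw [geodCurv, h.arcLength s hs, one_pow, div_one, normal]

theorem contDiffOn_geodCurv (h : ArcCurve I γ) : ContDiffOn ℝ 2 (geodCurv γ) I :=
  (h.contDiffOn_deriv_deriv.inner ℝ (h.contDiffOn_normal.of_le (by norm_num))).congr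
    fun _ hs => h.geodCurv_eq hs

/-- Frenet equation for the tangent. -/
theorem deriv_deriv_eq (h : ArcCurve I γ) (hs : s ∈ I) :
    deriv (deriv γ) s = -γ s + geodCurv γ s • normal γ s := by
  have e := expand_frame (h.sphere s hs) (h.arcLength s hs) (h.inner_deriv hs) (deriv (deriv γ) s)
  rw [h.inner_deriv_deriv hs, h.inner_deriv_deriv' hs, ← normal,
    real_inner_comm, ← h.geodCurv_eq hs] at e
  rw [e]
  simp

theorem hasDerivAt_tangent (h : ArcCurve I γ) (hs : s ∈ I) :
    HasDerivAt (deriv γ) (-γ s + geodCurv γ s • normal γ s) s :=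
  h.deriv_deriv_eq hs ▸ h.hasDerivAt_deriv hs

theorem cross_normal (h : ArcCurve I γ) (hs : s ∈ I) :
    cross (γ s) (normal γ s) = -deriv γ s := by
  rw [normal, cross_cross, h.inner_deriv hs, h.inner_self hs]
  simp

theorem inner_normal_self (h : ArcCurve I γ) (hs : s ∈ I) :
    inner ℝ (normal γ s) (normal γ s) = (1 : ℝ) := by
  rw [normal, inner_cross_cross, h.inner_self hs, h.inner_deriv_self hs, h.inner_deriv hs]
  norm_num

/-- Frenet equation for the normal. -/
theorem hasDerivAt_normal (h : ArcCurve I γ) (hs : s ∈ I) :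
    HasDerivAt (normal γ) (-(geodCurv γ s • deriv γ s)) s := by
  have := (h.hasDerivAt hs).cross (h.hasDerivAt_tangent hs)
  rwa [cross_add, cross_neg, cross_smul, cross_self, cross_self, h.cross_normal hs, neg_zero,
    zero_add, add_zero, smul_neg] at this

/-- An arc-length parametrized spherical curve is determined by its curvature, its position and its
velocity at one point. -/
theorem eqOn_of_geodCurv_eq {c : ℝ → E3} (h : ArcCurve I γ) (hc : ArcCurve I c)
    (hI : I.OrdConnected) (hk : ∀ s ∈ I, geodCurv γ s = geodCurv c s) {s₀ : ℝ} (hs₀ : s₀ ∈ I)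
    (h0 : γ s₀ = c s₀) (h1 : deriv γ s₀ = deriv c s₀) : EqOn γ c I := by
  -- With equal curvatures both frames obey the same skew-symmetric Frenet system, so the sum of the
  -- three inner products of corresponding frame vectors is constant. It is 3 at `s₀`, and each
  -- summand is at most 1, so each equals 1 throughout.
  have hd : ∀ s ∈ I, HasDerivAt (fun s => (inner ℝ (γ s) (c s) + inner ℝ (deriv γ s) (deriv c s)
      + inner ℝ (normal γ s) (normal c s) : ℝ)) 0 s := by
    intro s hs
    have e := (((h.hasDerivAt hs).inner ℝ (hc.hasDerivAt hs)).add
      ((h.hasDerivAt_tangent hs).inner ℝ (hc.hasDerivAt_tangent hs))).add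
      ((h.hasDerivAt_normal hs).inner ℝ (hc.hasDerivAt_normal hs))
    refine e.congr_deriv ?_
    simp only [inner_add_left, inner_add_right, inner_neg_left, inner_neg_right,
      real_inner_smul_left, real_inner_smul_right, hk s hs]
    ring
  have hconst : ∀ s ∈ I, (inner ℝ (γ s) (c s) + inner ℝ (deriv γ s) (deriv c s)
      + inner ℝ (normal γ s) (normal c s) : ℝ) = 3 := by
    intro s hs
    have := (hI.convex).is_const_of_fderivWithin_eq_zero (𝕜 := ℝ)
      (fun t ht => (hd t ht).differentiableAt.differentiableWithinAt)
      (fun t ht => ?_) hs hs₀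
    · rw [this, h0, h1, hc.inner_self hs₀, hc.inner_deriv_self hs₀]
      have : normal γ s₀ = normal c s₀ := by rw [normal, normal, h0, h1]
      rw [this, hc.inner_normal_self hs₀]
      norm_num
    · rw [fderivWithin_of_isOpen h.isOpen ht]
      ext
      simp [(hd t ht).deriv]
  intro s hs
  have n1 := real_inner_le_norm (deriv γ s) (deriv c s)
  have n2 := real_inner_le_norm (normal γ s) (normal c s)
  have n3 := real_inner_le_norm (γ s) (c s)
  rw [h.arcLength s hs, hc.arcLength s hs] at n1
  rw [norm_of_inner_self (h.inner_normal_self hs), norm_of_inner_self (hc.inner_normal_self hs)]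
    at n2
  rw [h.sphere s hs, hc.sphere s hs] at n3
  have := hconst s hs
  exact (inner_eq_one_iff_of_norm_eq_one (𝕜 := ℝ) (h.sphere s hs) (hc.sphere s hs)).1 (by linarith)

theorem mono {J : Set ℝ} (h : ArcCurve I γ) (hJ : IsOpen J) (hJI : J ⊆ I) : ArcCurve J γ :=
  ⟨hJ, h.contDiffOn.mono hJI, fun s hs => h.sphere s (hJI hs), fun s hs => h.arcLength s (hJI hs)⟩

theorem deriv_act (h : ArcCurve I γ) (A : Matrix (Fin 3) (Fin 3) ℝ) (hs : s ∈ I) :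
    deriv (fun t => act A (γ t)) s = act A (deriv γ s) :=
  ((actL A).hasFDerivAt.comp_hasDerivAt s (h.hasDerivAt hs)).deriv

theorem act {A : Matrix (Fin 3) (Fin 3) ℝ} (hA : A ∈ Matrix.specialOrthogonalGroup (Fin 3) ℝ)
    (h : ArcCurve I γ) : ArcCurve I (fun t => SphElastica.act A (γ t)) :=
  ⟨h.isOpen, (actL A).contDiff.comp_contDiffOn h.contDiffOn,
    fun s hs => by rw [norm_act hA, h.sphere s hs],
    fun s hs => by rw [h.deriv_act A hs, norm_act hA, h.arcLength s hs]⟩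

theorem geodCurv_act {A : Matrix (Fin 3) (Fin 3) ℝ}
    (hA : A ∈ Matrix.specialOrthogonalGroup (Fin 3) ℝ) (h : ArcCurve I γ) (hs : s ∈ I) :
    geodCurv (fun t => SphElastica.act A (γ t)) s = geodCurv γ s := by
  have e : deriv (deriv (fun t => SphElastica.act A (γ t))) s
      = SphElastica.act A (deriv (deriv γ) s) := by
    have : deriv (fun t => SphElastica.act A (γ t)) =ᶠ[nhds s]
        fun t => SphElastica.act A (deriv γ t) :=
      Filter.eventuallyEq_of_mem (h.isOpen.mem_nhds hs) fun t ht => h.deriv_act A ht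
    rw [this.deriv_eq]
    exact ((actL A).hasFDerivAt.comp_hasDerivAt s (h.hasDerivAt_deriv hs)).deriv
  rw [geodCurv, geodCurv, e, h.deriv_act A hs, cross_act hA, inner_act hA, norm_act hA]

end ArcCurve

theorem geodCurv_congr {γ c : ℝ → E3} {I : Set ℝ} (hI : IsOpen I) (h : EqOn γ c I) {s : ℝ}
    (hs : s ∈ I) : geodCurv γ s = geodCurv c s := by
  have e : γ =ᶠ[nhds s] c := Filter.eventuallyEq_of_mem (hI.mem_nhds hs) h
  rw [geodCurv, geodCurv, e.deriv.deriv_eq, e.deriv_eq, e.eq_of_nhds]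

/-! ### Translation and reversal of the parameter -/

theorem deriv_comp_affine {E : Type*} [NormedAddCommGroup E] [NormedSpace ℝ E] (γ : ℝ → E)
    (ε a : ℝ) :
    deriv (fun s => γ (ε * s + a)) = fun s => ε • deriv γ (ε * s + a) := by
  funext s
  rw [deriv_comp_mul_left ε (fun t => γ (t + a)), deriv_comp_add_const]

theorem deriv_deriv_comp_affine (γ : ℝ → E3) {ε : ℝ} (hε : ε = 1 ∨ ε = -1) (a s : ℝ) :
    deriv (deriv (fun s => γ (ε * s + a))) s = deriv (deriv γ) (ε * s + a) := by
  rw [deriv_comp_affine γ ε a, deriv_fun_const_smul_field, deriv_comp_affine (deriv γ) ε a]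
  rcases hε with rfl | rfl <;> simp

/-- Reversal keeps γ̈ and flips γ̇, hence flips N and κ. This reduces negative curvature to positive
curvature. -/
theorem geodCurv_comp_affine (γ : ℝ → E3) {ε : ℝ} (hε : ε = 1 ∨ ε = -1) (a s : ℝ) :
    geodCurv (fun s => γ (ε * s + a)) s = ε * geodCurv γ (ε * s + a) := by
  rw [geodCurv, geodCurv, deriv_deriv_comp_affine γ hε, deriv_comp_affine γ]
  simp only [cross_smul, norm_smul, real_inner_smul_right]
  rcases hε with rfl | rfl <;> simp [neg_div]

theorem ArcCurve.comp_affine {I : Set ℝ} {γ : ℝ → E3} (h : ArcCurve I γ) {ε : ℝ}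
    (hε : ε = 1 ∨ ε = -1) (a : ℝ) :
    ArcCurve ((fun s => ε * s + a) ⁻¹' I) (fun s => γ (ε * s + a)) := by
  have hc : ContDiff ℝ 4 fun s : ℝ => ε * s + a := by fun_prop
  refine ⟨h.isOpen.preimage hc.continuous, h.contDiffOn.comp hc.contDiffOn fun s hs => hs,
    fun s hs => h.sphere _ hs, fun s hs => ?_⟩
  rw [deriv_comp_affine γ, norm_smul, h.arcLength _ hs]
  rcases hε with rfl | rfl <;> simp

/-! ### The turning points of the profile equation -/

theorem eta_pos (lam : ℝ) : 0 < eta lam := (existsUnique_eta lam).choose_spec.1.1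

theorem eta_eq (lam : ℝ) : eta lam ^ 4 + 2 * lam * eta lam ^ 3 - 1 = 0 :=
  (existsUnique_eta lam).choose_spec.1.2

/-- Used to eliminate `lam` in favour of `eta lam`. -/
theorem two_mul_eq_eta (lam : ℝ) : 2 * lam = (eta lam ^ 3)⁻¹ - eta lam := by
  have h := eta_eq lam
  have hp := eta_pos lam
  field_simp
  linarith

theorem add_two_mul_pos {lam e : ℝ} (h : eta lam < e) : 0 < e + 2 * lam := by
  have := two_mul_eq_eta lam
  have : 0 < (eta lam ^ 3)⁻¹ := by have := eta_pos lam; positivity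
  linarith

theorem xi_pos {lam e : ℝ} (he : 0 < e) : 0 < xi lam e := by
  unfold xi
  positivity

theorem xi_sq {lam e : ℝ} (he : 0 < e) :
    4 * xi lam e ^ 2 = (e + 2 * lam) ^ 2 + 1 / e ^ 2 := by
  rw [xi, div_pow, Real.sq_sqrt (by positivity)]
  field_simp
  ring

/-- The positive roots of Q are the points where the potential V(t) = (t + 2 lam)² + 1/t² takes the
value 4ξ²; by `xi_sq` this value is V(e) when ξ = `xi lam e`. -/
theorem quartic_eq {lam t : ℝ} (ξ : ℝ) (ht : t ≠ 0) :
    quartic lam ξ t = t ^ 2 * ((t + 2 * lam) ^ 2 + 1 / t ^ 2 - 4 * ξ ^ 2) := by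
  unfold quartic
  field_simp
  ring

/-- `eta` is the strict minimum of `t ↦ (t + 2 lam)² + 1 / t²` on the positive half-line. -/
theorem potential_eta_lt {lam t : ℝ} (ht : 0 < t) (hne : t ≠ eta lam) :
    (eta lam + 2 * lam) ^ 2 + 1 / eta lam ^ 2 < (t + 2 * lam) ^ 2 + 1 / t ^ 2 := by
  have hp := eta_pos lam
  rw [two_mul_eq_eta lam]
  set η := eta lam
  -- Since η is a critical point of the potential, the difference of values contains the factor (t −
  -- η)², and the remaining factor is visibly positive.
  have key : (t + ((η ^ 3)⁻¹ - η)) ^ 2 + 1 / t ^ 2 - ((η + ((η ^ 3)⁻¹ - η)) ^ 2 + 1 / η ^ 2)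
      = (t - η) ^ 2 * (1 + (2 * t + η) / (t ^ 2 * η ^ 3)) := by
    field_simp
    ring
  have : 0 < (t - η) ^ 2 * (1 + (2 * t + η) / (t ^ 2 * η ^ 3)) := by
    have : t - η ≠ 0 := sub_ne_zero.2 hne
    positivity
  linarith

/-- `b < a` are the positive roots of `Q` for the parameter `ξ = xi lam a`. -/
structure Turning (lam a b : ℝ) : Prop where
  pos : 0 < b
  lt : b < a
  -- V(a) = V(b), cleared of denominators and of the factor a − b.
  rel : 4 * lam * (a * b) ^ 2 = (a + b) * (1 - (a * b) ^ 2)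
  above : eta lam < a

/-- The cofactor of the two positive roots in `Q`. -/
noncomputable def cofactor (a b t : ℝ) : ℝ := t ^ 2 + (a * t + b * t + a * b) / (a * b) ^ 2

/-- Q(0) = 1 > 0, while Q(η) < 0 because V(η) < V(a) = 4ξ²; the second root lies between 0 and η. -/
theorem exists_turning {lam a : ℝ} (ha : eta lam < a) : ∃ b, Turning lam a b := by
  have hη := eta_pos lam
  have ha0 : 0 < a := hη.trans ha
  have hc : ContinuousOn (quartic lam (xi lam a)) (Icc 0 (eta lam)) := by
    unfold quartic; fun_prop
  have h1 : quartic lam (xi lam a) (eta lam) < 0 := by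
    rw [quartic_eq _ hη.ne', xi_sq ha0]
    have := potential_eta_lt ha0 ha.ne'
    apply mul_neg_of_pos_of_neg (by positivity)
    linarith
  obtain ⟨b, hb, hb0⟩ := intermediate_value_Icc' hη.le hc
    (show (0 : ℝ) ∈ Icc _ _ from ⟨h1.le, by simp [quartic]⟩)
  have hbp : 0 < b := by
    refine lt_of_le_of_ne hb.1 ?_
    rintro rfl
    simp [quartic] at hb0
  have hbη : b < eta lam := by
    refine lt_of_le_of_ne hb.2 ?_
    rintro rfl
    exact h1.ne hb0
  have hba : b < a := hbη.trans ha
  refine ⟨b, hbp, hba, ?_, ha⟩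
  rw [quartic_eq _ hbp.ne', xi_sq ha0] at hb0
  have h2 : (b + 2 * lam) ^ 2 + 1 / b ^ 2 - ((a + 2 * lam) ^ 2 + 1 / a ^ 2) = 0 := by
    rcases mul_eq_zero.1 hb0 with h | h
    · exact absurd h (by positivity)
    · exact h
  have h3 : (a - b) * (4 * lam * (a * b) ^ 2 - (a + b) * (1 - (a * b) ^ 2)) = 0 := by
    field_simp at h2
    linear_combination -h2
  rcases mul_eq_zero.1 h3 with h | h <;> linarith

namespace Turning

variable {lam a b : ℝ}

theorem pos' (h : Turning lam a b) : 0 < a := h.pos.trans h.lt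

theorem lam_eq (h : Turning lam a b) : 4 * lam = (a + b) * (1 - (a * b) ^ 2) / (a * b) ^ 2 := by
  have h1 := h.pos
  have h2 := h.pos'
  rw [eq_div_iff (by positivity)]
  exact h.rel

theorem quartic_eq_mul (h : Turning lam a b) (t : ℝ) :
    quartic lam (xi lam a) t = (t - a) * (t - b) * cofactor a b t := by
  have h1 := h.pos
  have h2 := h.pos'
  have e1 : quartic lam (xi lam a) t = t ^ 4 + 4 * lam * t ^ 3 + 4 * lam ^ 2 * t ^ 2
      - (4 * xi lam a ^ 2) * t ^ 2 + 1 := by unfold quartic; ring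
  have e2 : lam = (a + b) * (1 - (a * b) ^ 2) / (4 * (a * b) ^ 2) := by
    have := h.lam_eq
    field_simp at this ⊢
    linarith
  rw [e1, xi_sq h2, e2, cofactor]
  field_simp
  ring

theorem cofactor_pos (h : Turning lam a b) {t : ℝ} (ht : 0 < t) : 0 < cofactor a b t := by
  have h1 := h.pos
  have h2 := h.pos'
  unfold cofactor
  positivity

theorem mem_Icc_of_quartic_nonpos (h : Turning lam a b) {t : ℝ} (ht : 0 < t)
    (hQ : quartic lam (xi lam a) t ≤ 0) : t ∈ Icc b a := by
  rw [h.quartic_eq_mul] at hQ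
  have := h.cofactor_pos ht
  have hlt := h.lt
  have h2 : (t - a) * (t - b) ≤ 0 := by
    by_contra hn
    have := mul_pos (not_le.1 hn) this
    linarith
  constructor <;> nlinarith

end Turning

/-! ### The phase function -/

/-- The profile `μ` as a function of the phase. -/
noncomputable def prof (a b x : ℝ) : ℝ := (a + b) / 2 + (a - b) / 2 * Real.cos x

/-- The speed of the phase. -/
noncomputable def speed (a b x : ℝ) : ℝ := prof a b x * √(cofactor a b (prof a b x))

theorem prof_mem {a b : ℝ} (h : b ≤ a) (x : ℝ) : prof a b x ∈ Icc b a := by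
  have h1 := Real.neg_one_le_cos x
  have h2 := Real.cos_le_one x
  unfold prof
  constructor <;> nlinarith

/-- The factor of −Q that vanishes at the turning points becomes a perfect square in the phase
variable. The phase can therefore move with the positive smooth velocity `speed`, although μ̇
changes sign. -/
theorem prof_sub (a b x : ℝ) :
    (a - prof a b x) * (prof a b x - b) = ((a - b) / 2 * Real.sin x) ^ 2 := by
  have := Real.sin_sq_add_cos_sq x
  unfold prof
  linear_combination -((a - b) / 2) ^ 2 * this

theorem contDiff_prof (a b : ℝ) {n : WithTop ℕ∞} : ContDiff ℝ n (prof a b) := by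
  unfold prof
  exact contDiff_const.add (contDiff_const.mul Real.contDiff_cos)

theorem Turning.prof_pos {lam a b : ℝ} (h : Turning lam a b) (x : ℝ) : 0 < prof a b x :=
  h.pos.trans_le (prof_mem h.lt.le x).1

theorem Turning.speed_pos {lam a b : ℝ} (h : Turning lam a b) (x : ℝ) : 0 < speed a b x :=
  mul_pos (h.prof_pos x) (Real.sqrt_pos.2 (h.cofactor_pos (h.prof_pos x)))

theorem Turning.contDiff_speed {lam a b : ℝ} (h : Turning lam a b) {n : WithTop ℕ∞} :
    ContDiff ℝ n (speed a b) := by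
  refine (contDiff_prof a b).mul (ContDiff.sqrt ?_ fun x => (h.cofactor_pos (h.prof_pos x)).ne')
  unfold cofactor
  have := contDiff_prof a b (n := n)
  fun_prop

/-- A phase function: `μ = prof a b ∘ φ` is the even solution of the profile equation. -/
structure IsPhase (lam a b ω : ℝ) (φ : ℝ → ℝ) : Prop where
  turning : Turning lam a b
  period_pos : 0 < ω
  contDiff : ContDiff ℝ (⊤ : ℕ∞) φ
  strictMono : StrictMono φ
  surjective : Function.Surjective φ
  odd : ∀ s, φ (-s) = -φ s
  add_period : ∀ s, φ (s + ω) = φ s + 2 * Real.pi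
  hasDerivAt : ∀ s, HasDerivAt φ (speed a b (φ s)) s

/-- Separation of variables: φ is the inverse of S(x) = ∫₀ˣ dt / `speed`. The integrand is positive,
even and 2π-periodic, which makes S an odd increasing bijection, and ω = S(2π) is the time in which
the phase advances by 2π. -/
theorem exists_phase {lam a b : ℝ} (h : Turning lam a b) : ∃ ω φ, IsPhase lam a b ω φ := by
  set g : ℝ → ℝ := fun x => (speed a b x)⁻¹ with hg
  have gpos : ∀ x, 0 < g x := fun x => inv_pos.2 (h.speed_pos x)
  have gsm : ∀ n : WithTop ℕ∞, ContDiff ℝ n g := fun n =>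
    h.contDiff_speed.inv fun x => (h.speed_pos x).ne'
  have gc : Continuous g := (gsm 0).continuous
  have gper : Function.Periodic g (2 * Real.pi) := fun x => by simp [hg, speed, prof]
  have geven : ∀ x, g (-x) = g x := fun x => by simp [hg, speed, prof]
  set S : ℝ → ℝ := fun x => ∫ t in (0 : ℝ)..x, g t with hS
  have Sd : ∀ x, HasDerivAt S (g x) x := fun x =>
    intervalIntegral.integral_hasDerivAt_right (gc.intervalIntegrable _ _)
      (gc.stronglyMeasurableAtFilter _ _) gc.continuousAt
  have Smono : StrictMono S := strictMono_of_deriv_pos fun x => by rw [(Sd x).deriv]; exact gpos x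
  have Ssurj : Function.Surjective S :=
    (continuous_iff_continuousAt.2 fun x => (Sd x).continuousAt).surjective
      (gper.tendsto_atTop_intervalIntegral_of_pos' (gc.intervalIntegrable _ _) gpos
        Real.two_pi_pos)
      (gper.tendsto_atBot_intervalIntegral_of_pos' (gc.intervalIntegrable _ _) gpos
        Real.two_pi_pos)
  have Ssm : ContDiff ℝ (⊤ : ℕ∞) S := by
    have hdS : deriv S = g := funext fun x => (Sd x).deriv
    rw [contDiff_infty_iff_deriv, hdS]
    exact ⟨fun x => (Sd x).differentiableAt, gsm _⟩
  have Sodd : ∀ x, S (-x) = -S x := fun x => by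
    have := intervalIntegral.integral_comp_neg (f := g) (a := 0) (b := x)
    simp only [geven, neg_zero] at this
    simp only [hS]
    rw [this, intervalIntegral.integral_symm]
  have Sper : ∀ x, S (x + 2 * Real.pi) = S x + S (2 * Real.pi) := fun x => by
    have := gper.intervalIntegral_add_eq_add 0 x (fun _ _ => gc.intervalIntegrable _ _)
    simpa [hS] using this
  let e : ℝ ≃ₜ ℝ := (Smono.orderIsoOfSurjective S Ssurj).toHomeomorph
  have he : ∀ x, e x = S x := fun x => rfl
  have hes : ∀ s, S (e.symm s) = s := fun s => e.apply_symm_apply s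
  refine ⟨S (2 * Real.pi), e.symm, h, ?_, ?_, ?_, e.symm.surjective, fun s => ?_, fun s => ?_,
    fun s => ?_⟩
  · have : S 0 = 0 := by simp [hS]
    rw [← this]
    exact Smono Real.two_pi_pos
  · exact e.contDiff_symm_deriv (fun x => (gpos x).ne') Sd Ssm
  · exact (Smono.orderIsoOfSurjective S Ssurj).symm.strictMono
  · apply Smono.injective
    rw [hes, Sodd, hes]
  · apply Smono.injective
    rw [hes, Sper, hes]
  · have := HasDerivAt.of_local_left_inverse (f := S) (f' := g (e.symm s)) (g := e.symm) (a := s)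
      e.symm.continuous.continuousAt (Sd _) (gpos _).ne' (Filter.Eventually.of_forall hes)
    simpa [hg] using this

/-! ### Solutions of the profile equation -/

/-- Half the derivative of `-t² Q(t)`: solutions of the profile equation satisfy `μ̈ = G(μ)`. -/
noncomputable def force (lam ξ t : ℝ) : ℝ :=
  -3 * t ^ 5 - 10 * lam * t ^ 4 - 8 * (lam ^ 2 - ξ ^ 2) * t ^ 3 - t

theorem hasDerivAt_quartic (lam ξ t : ℝ) :
    HasDerivAt (fun t => -t ^ 2 * quartic lam ξ t) (2 * force lam ξ t) t := by
  have e : (fun t => -t ^ 2 * quartic lam ξ t) = fun t => -t ^ 6 + -4 * lam * t ^ 5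
      + -4 * (lam ^ 2 - ξ ^ 2) * t ^ 4 + -1 * t ^ 2 := by
    funext t; unfold quartic; ring
  rw [e]
  have h := (((hasDerivAt_pow 6 t).neg.add ((hasDerivAt_pow 5 t).const_mul (-4 * lam))).add
    ((hasDerivAt_pow 4 t).const_mul (-4 * (lam ^ 2 - ξ ^ 2)))).add
    ((hasDerivAt_pow 2 t).const_mul (-1))
  refine h.congr_deriv ?_
  unfold force
  push_cast
  ring

namespace IsPhase

variable {lam a b ω : ℝ} {φ : ℝ → ℝ}

theorem zero (h : IsPhase lam a b ω φ) : φ 0 = 0 := by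
  have := h.odd 0
  rw [neg_zero] at this
  linarith

theorem half_period (h : IsPhase lam a b ω φ) : φ (ω / 2) = Real.pi := by
  have h1 := h.add_period (-(ω / 2))
  rw [h.odd, show -(ω / 2) + ω = ω / 2 by ring] at h1
  linarith

theorem int_mul_period (h : IsPhase lam a b ω φ) (k : ℤ) (s : ℝ) :
    φ (s + k * ω) = φ s + k * (2 * Real.pi) := by
  induction k using Int.induction_on with
  | zero => simp
  | succ n ih =>
    push_cast at ih ⊢
    rw [show s + ((n : ℝ) + 1) * ω = (s + n * ω) + ω by ring, h.add_period, ih]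
    ring
  | pred n ih =>
    push_cast at ih ⊢
    have := h.add_period (s + (-(n : ℝ) - 1) * ω)
    rw [show s + (-(n : ℝ) - 1) * ω + ω = s + -(n : ℝ) * ω by ring, ih] at this
    linarith

theorem prof_eq_iff (h : IsPhase lam a b ω φ) (s : ℝ) :
    prof a b (φ s) = a ↔ ∃ k : ℤ, s = k * ω := by
  have hlt := h.turning.lt
  constructor
  · intro e
    have hc : Real.cos (φ s) = 1 := by
      unfold prof at e
      have : (a - b) / 2 * (Real.cos (φ s) - 1) = 0 := by linarith
      rcases mul_eq_zero.1 this with h | h <;> linarith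
    obtain ⟨k, hk⟩ := (Real.cos_eq_one_iff _).1 hc
    refine ⟨k, h.strictMono.injective ?_⟩
    have := h.int_mul_period k 0
    rw [zero_add, h.zero, zero_add] at this
    rw [this, hk]
  · rintro ⟨k, rfl⟩
    have := h.int_mul_period k 0
    rw [zero_add, h.zero, zero_add] at this
    rw [this, prof, Real.cos_int_mul_two_pi]
    ring

theorem prof_periodic (h : IsPhase lam a b ω φ) :
    Function.Periodic (fun s => prof a b (φ s)) ω := fun s => by
  simp [h.add_period, prof]

theorem contDiff_prof (h : IsPhase lam a b ω φ) :
    ContDiff ℝ (⊤ : ℕ∞) (fun s => prof a b (φ s)) :=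
  (SphElastica.contDiff_prof a b).comp h.contDiff

theorem hasDerivAt_prof (h : IsPhase lam a b ω φ) (s : ℝ) :
    HasDerivAt (fun s => prof a b (φ s))
      (-((a - b) / 2 * Real.sin (φ s)) * speed a b (φ s)) s := by
  have := (((h.hasDerivAt s).cos).const_mul ((a - b) / 2)).const_add ((a + b) / 2)
  refine this.congr_deriv ?_
  ring

theorem ode (h : IsPhase lam a b ω φ) (s : ℝ) : deriv (fun s => prof a b (φ s)) s ^ 2
    = -prof a b (φ s) ^ 2 * quartic lam (xi lam a) (prof a b (φ s)) := by
  rw [(h.hasDerivAt_prof s).deriv, h.turning.quartic_eq_mul, mul_pow, neg_pow_two, ← prof_sub,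
    speed, mul_pow, Real.sq_sqrt (h.turning.cofactor_pos (h.turning.prof_pos _)).le]
  ring

theorem isSolution (h : IsPhase lam a b ω φ) :
    IsSolution lam (xi lam a) univ (fun s => prof a b (φ s)) := by
  refine ⟨(h.contDiff_prof.of_le (WithTop.coe_le_coe.2 (le_top : (2 : ℕ∞) ≤ ⊤))).contDiffOn, ?_, fun s _ => h.ode s⟩
  refine ⟨0, mem_univ _, ω / 2, mem_univ _, fun e => ?_⟩
  have := h.turning.lt
  simp only [h.zero, h.half_period, prof, Real.cos_zero, Real.cos_pi] at e
  linarith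

/-- The maximum a is attained exactly at the integer multiples of ω, so every period is such a
multiple. -/
theorem isLeastPeriod (h : IsPhase lam a b ω φ) :
    IsLeastPeriod (fun s => prof a b (φ s)) ω := by
  refine ⟨⟨h.period_pos, h.prof_periodic⟩, fun T hT => ?_⟩
  obtain ⟨hT0, hT⟩ := hT
  have h1 := hT 0
  simp only [zero_add] at h1
  rw [(h.prof_eq_iff 0).2 ⟨0, by simp⟩] at h1
  obtain ⟨k, hk⟩ := (h.prof_eq_iff T).1 h1
  have hω := h.period_pos
  have : (0 : ℝ) < k := by
    by_contra hn
    rw [hk] at hT0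
    nlinarith
  have : (1 : ℝ) ≤ k := by exact_mod_cast this
  rw [hk]
  nlinarith

end IsPhase

theorem isLeastPeriod_comp_add {f : ℝ → ℝ} {ω : ℝ} (c : ℝ) (h : IsLeastPeriod f ω) :
    IsLeastPeriod (fun s => f (s + c)) ω := by
  refine ⟨⟨h.1.1, fun s => ?_⟩, fun T hT => h.2 ⟨hT.1, fun s => ?_⟩⟩
  · have := h.1.2 (s + c)
    simp only
    rw [← this]
    congr 1
    ring
  · have := hT.2 (s - c)
    simp only [sub_add_cancel] at this
    rw [← this]
    congr 1
    ring

namespace IsSolution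

variable {lam a b ω : ℝ} {φ : ℝ → ℝ} {J : Set ℝ} {ν : ℝ → ℝ}

theorem hasDerivAt {ξ : ℝ} (hν : IsSolution lam ξ J ν) (hJ : IsOpen J) {s : ℝ} (hs : s ∈ J) :
    HasDerivAt ν (deriv ν s) s :=
  hν.contDiffOn.hasDerivAt_of_isOpen hJ (by norm_num) hs

theorem contDiffOn_deriv {ξ : ℝ} (hν : IsSolution lam ξ J ν) (hJ : IsOpen J) :
    ContDiffOn ℝ 1 (deriv ν) J :=
  hν.contDiffOn.deriv_right hJ (by norm_num)

theorem hasDerivAt_deriv {ξ : ℝ} (hν : IsSolution lam ξ J ν) (hJ : IsOpen J) {s : ℝ}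
    (hs : s ∈ J) : HasDerivAt (deriv ν) (deriv (deriv ν) s) s :=
  (hν.contDiffOn_deriv hJ).hasDerivAt_of_isOpen hJ (by norm_num) hs

theorem mem_Icc (hν : IsSolution lam (xi lam a) J ν) (hJ' : J.OrdConnected)
    (h : Turning lam a b) {s₀ : ℝ} (hs₀ : s₀ ∈ J) (hpos : 0 < ν s₀) :
    ∀ s ∈ J, ν s ∈ Icc b a := by
  have hQ : ∀ s ∈ J, 0 < ν s → ν s ∈ Icc b a := by
    intro s hs hp
    refine h.mem_Icc_of_quartic_nonpos hp ?_
    have := hν.ode s hs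
    by_contra hn
    have : 0 < ν s ^ 2 * quartic lam (xi lam a) (ν s) := mul_pos (by positivity) (not_le.1 hn)
    nlinarith [sq_nonneg (deriv ν s)]
  intro s hs
  refine hQ s hs ?_
  by_contra hn
  have hb := h.pos
  have himg : OrdConnected (ν '' J) :=
    (hJ'.isPreconnected.image ν (hν.contDiffOn.continuousOn)).ordConnected
  -- Positive values lie in [b, a], so the image of the interval cannot jump over the gap (0, b);
  -- the value b/2 witnesses the contradiction.
  have : b / 2 ∈ ν '' J := by
    have := (hQ s₀ hs₀ hpos).1
    exact himg.out (mem_image_of_mem ν hs) (mem_image_of_mem ν hs₀)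
      ⟨by linarith, by linarith⟩
  obtain ⟨t, ht, e⟩ := this
  have := (hQ t ht (by linarith)).1
  linarith

/-- Both a and b are simple roots of −t²Q(t), and `force` is half its derivative. -/
theorem force_ne_zero (h : Turning lam a b) {t : ℝ} (ht : t = a ∨ t = b) :
    force lam (xi lam a) t ≠ 0 := by
  have ha := h.pos'
  have hb := h.pos
  have hlt := h.lt
  have hd := hasDerivAt_quartic lam (xi lam a) t
  have e : (fun t => -t ^ 2 * quartic lam (xi lam a) t)
      = fun t => (t - a) * ((t - b) * (-t ^ 2 * cofactor a b t)) := by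
    funext t
    rw [h.quartic_eq_mul]
    ring
  have e' : (fun t => -t ^ 2 * quartic lam (xi lam a) t)
      = fun t => (t - b) * ((t - a) * (-t ^ 2 * cofactor a b t)) := by
    funext t
    rw [h.quartic_eq_mul]
    ring
  have hq : DifferentiableAt ℝ (fun t => -t ^ 2 * cofactor a b t) t := by
    unfold cofactor
    fun_prop
  intro h0
  rw [h0, mul_zero] at hd
  have hc : 0 < cofactor a b t := by
    rcases ht with rfl | rfl <;> exact h.cofactor_pos (by assumption)
  rcases ht with rfl | rfl
  · have h2 := ((hasDerivAt_id t).sub_const t).mul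
      (((hasDerivAt_id t).sub_const b).mul hq.hasDerivAt)
    rw [e] at hd
    have := hd.unique h2
    simp at this
    rcases this with h | h | h <;> [linarith; linarith; linarith]
  · have h2 := ((hasDerivAt_id t).sub_const t).mul
      (((hasDerivAt_id t).sub_const a).mul hq.hasDerivAt)
    rw [e'] at hd
    have := hd.unique h2
    simp at this
    rcases this with h | h | h <;> [linarith; linarith; linarith]

/-- A non-constant solution of class `C²` satisfies the second-order equation; in particular it
cannot rest at a turning point. -/
theorem deriv_deriv_eq (hν : IsSolution lam (xi lam a) J ν) (hJ : IsOpen J)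
    (hJ' : J.OrdConnected) (h : Turning lam a b) {s₀ : ℝ} (hs₀ : s₀ ∈ J) (hpos : 0 < ν s₀) :
    ∀ s ∈ J, deriv (deriv ν) s = force lam (xi lam a) (ν s) := by
  have hmem := hν.mem_Icc hJ' h hs₀ hpos
  -- Differentiating the first-order equation gives the second-order one only up to the factor ν̇,
  -- which has to be cancelled.
  have hd : ∀ s ∈ J, deriv ν s * (deriv (deriv ν) s - force lam (xi lam a) (ν s)) = 0 := by
    intro s hs
    have h1 := (hν.hasDerivAt_deriv hJ hs).pow 2
    have h2 := (hasDerivAt_quartic lam (xi lam a) (ν s)).comp s (hν.hasDerivAt hJ hs)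
    have h3 : deriv ν ^ 2 =ᶠ[nhds s] (fun t => -t ^ 2 * quartic lam (xi lam a) t) ∘ ν :=
      Filter.eventuallyEq_of_mem (hJ.mem_nhds hs) fun t ht => hν.ode t ht
    have := h1.unique (h2.congr_of_eventuallyEq h3)
    simp at this
    linarith
  have hc1 : ContinuousOn ν J := hν.contDiffOn.continuousOn
  have hc2 : ContinuousOn (deriv (deriv ν)) J :=
    ((hν.contDiffOn_deriv hJ).deriv_right (m := 0) hJ (by norm_num)).continuousOn
  have hc3 : ContinuousOn (fun s => deriv (deriv ν) s - force lam (xi lam a) (ν s)) J := by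
    unfold force; fun_prop
  -- U is where the second-order equation fails, so ν̇ = 0 there; V excludes the points where ν̈ = 0
  -- and ν is a turning value. Both are open. They cover J because the force does not vanish at
  -- turning values, and they are disjoint because ν̇ = 0 on the open set U forces ν̈ = 0 and Q(ν) =
  -- 0. By connectedness J lies in one of them; J ⊆ U would make ν constant, so U is empty.
  have hU : IsOpen (J ∩ (fun s => deriv (deriv ν) s - force lam (xi lam a) (ν s)) ⁻¹' {0}ᶜ) :=
    hc3.isOpen_inter_preimage hJ isOpen_compl_singleton
  set U := J ∩ (fun s => deriv (deriv ν) s - force lam (xi lam a) (ν s)) ⁻¹' {0}ᶜ with hUdef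
  have hc4 : ContinuousOn
      (fun s => (deriv (deriv ν) s) ^ 2 + ((ν s - a) * (ν s - b)) ^ 2) J := by fun_prop
  have hV : IsOpen (J ∩ (fun s => (deriv (deriv ν) s) ^ 2 + ((ν s - a) * (ν s - b)) ^ 2)
      ⁻¹' {0}ᶜ) := hc4.isOpen_inter_preimage hJ isOpen_compl_singleton
  set V := J ∩ (fun s => (deriv (deriv ν) s) ^ 2 + ((ν s - a) * (ν s - b)) ^ 2) ⁻¹' {0}ᶜ
    with hVdef
  have hU1 : ∀ s ∈ U, deriv ν s = 0 := fun s hs =>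
    (mul_eq_zero.1 (hd s hs.1)).resolve_right hs.2
  have hcov : J ⊆ U ∪ V := by
    intro s hs
    by_contra hn
    rw [mem_union, not_or] at hn
    have hnV : (deriv (deriv ν) s) ^ 2 + ((ν s - a) * (ν s - b)) ^ 2 = 0 := by
      by_contra hne
      exact hn.2 ⟨hs, hne⟩
    have hnU : deriv (deriv ν) s - force lam (xi lam a) (ν s) = 0 := by
      by_contra hne
      exact hn.1 ⟨hs, hne⟩
    have q1 : deriv (deriv ν) s = 0 := by
      have := sq_nonneg ((ν s - a) * (ν s - b))
      exact pow_eq_zero_iff two_ne_zero |>.1 (le_antisymm (by linarith) (sq_nonneg _))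
    have q2 : (ν s - a) * (ν s - b) = 0 := by
      have := sq_nonneg (deriv (deriv ν) s)
      exact pow_eq_zero_iff two_ne_zero |>.1 (le_antisymm (by linarith) (sq_nonneg _))
    refine force_ne_zero h (t := ν s) ?_ (by linarith)
    rcases mul_eq_zero.1 q2 with q | q
    · exact Or.inl (by linarith)
    · exact Or.inr (by linarith)
  have hdisj : J ∩ (U ∩ V) = ∅ := by
    rw [eq_empty_iff_forall_notMem]
    rintro s ⟨hs, hsU, hsV⟩
    have q1 : deriv (deriv ν) s = 0 :=
      eq_zero_of_hasDerivAt_of_eqOn_const hU hsU hU1 (hν.hasDerivAt_deriv hJ hs)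
    have q2 := hν.ode s hs
    rw [hU1 s hsU, h.quartic_eq_mul] at q2
    have hp : 0 < ν s := h.pos.trans_le (hmem s hs).1
    have hcp := h.cofactor_pos hp
    have q3 : (ν s - a) * (ν s - b) = 0 := by
      have : ν s ^ 2 * cofactor a b (ν s) * ((ν s - a) * (ν s - b)) = 0 := by linarith
      exact (mul_eq_zero.1 this).resolve_left (by positivity)
    exact hsV.2 (by simp [q1, q3])
  rcases isPreconnected_iff_subset_of_disjoint.1 hJ'.isPreconnected U V hU hV hcov hdisj with
    hJU | hJV
  · exfalso
    obtain ⟨s, hs, t, ht, hne⟩ := hν.nonconst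
    refine hne (hJ'.convex.is_const_of_fderivWithin_eq_zero (𝕜 := ℝ)
      (fun t ht => (hν.hasDerivAt hJ ht).differentiableAt.differentiableWithinAt)
      (fun t ht => ?_) hs ht)
    rw [fderivWithin_of_isOpen hJ ht]
    ext
    simp [hU1 t (hJU ht)]
  · intro s hs
    by_contra hne
    have : s ∈ J ∩ (U ∩ V) := ⟨hs, ⟨hs, sub_ne_zero.2 hne⟩, hJV hs⟩
    rw [hdisj] at this
    exact this

/-- Every solution with a positive value is a translate of the periodic profile. -/
theorem eq_translate (hν : IsSolution lam (xi lam a) J ν) (hJ : IsOpen J)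
    (hJ' : J.OrdConnected) (h : IsPhase lam a b ω φ) {s₀ : ℝ} (hs₀ : s₀ ∈ J)
    (hpos : 0 < ν s₀) : ∃ t₀, ∀ s ∈ J, ν s = prof a b (φ (s - s₀ + t₀)) := by
  have hT := h.turning
  have hlt := hT.lt
  have hmem := hν.mem_Icc hJ' hT hs₀ hpos
  have hode := hν.deriv_deriv_eq hJ hJ' hT hs₀ hpos
  set M : ℝ → ℝ := fun s => prof a b (φ s) with hM
  have hMode := h.isSolution.deriv_deriv_eq isOpen_univ ordConnected_univ hT (mem_univ 0)
    (hT.prof_pos _)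
  -- The arccosine gives a phase with the right value of μ; the first-order equation fixes the
  -- velocity up to sign, and the even symmetry of the profile corrects the sign.
  have hstart : ∃ t₀, M t₀ = ν s₀ ∧ deriv M t₀ = deriv ν s₀ := by
    have hm := hmem s₀ hs₀
    set c := (ν s₀ - (a + b) / 2) / ((a - b) / 2) with hc
    have hr : 0 < (a - b) / 2 := by linarith
    have hc1 : -1 ≤ c := by rw [hc, le_div_iff₀ hr]; linarith [hm.1]
    have hc2 : c ≤ 1 := by rw [hc, div_le_iff₀ hr]; linarith [hm.2]
    obtain ⟨t, ht⟩ := h.surjective (Real.arccos c)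
    have e1 : M t = ν s₀ := by
      simp only [hM, ht, prof]
      rw [Real.cos_arccos hc1 hc2, hc, mul_div_cancel₀ _ hr.ne']
      ring
    have e2 : M (-t) = ν s₀ := by
      rw [← e1]
      simp only [hM, h.odd, prof, Real.cos_neg]
    have e3 : deriv M (-t) = -deriv M t := by
      rw [(h.hasDerivAt_prof t).deriv, (h.hasDerivAt_prof (-t)).deriv]
      simp only [h.odd, speed, prof, Real.cos_neg, Real.sin_neg]
      ring
    have e4 : deriv M t ^ 2 = deriv ν s₀ ^ 2 := by
      rw [hν.ode s₀ hs₀, ← e1]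
      exact h.ode t
    rcases sq_eq_sq_iff_eq_or_eq_neg.1 e4 with q | q
    · exact ⟨t, e1, q⟩
    · exact ⟨-t, e2, by rw [e3, q, neg_neg]⟩
  obtain ⟨t₀, hst, hst'⟩ := hstart
  refine ⟨t₀, fun s hs => ?_⟩
  -- The first-order equation is not Lipschitz at the turning points; the planar system for (μ, μ̇)
  -- is, on the strip [b, a] × ℝ where both solutions live.
  obtain ⟨K, hK⟩ := ContDiffOn.exists_lipschitzOnWith (n := 1) (s := Icc b a)
    (f := force lam (xi lam a)) (by unfold force; fun_prop) one_ne_zero (convex_Icc b a)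
    isCompact_Icc
  have hLip : LipschitzOnWith (max 1 K) (fun p : ℝ × ℝ => (p.2, force lam (xi lam a) p.1))
      (Icc b a ×ˢ univ) := by
    have h1 : LipschitzOnWith 1 (fun p : ℝ × ℝ => p.2) (Icc b a ×ˢ univ) :=
      LipschitzWith.prod_snd.lipschitzOnWith
    have h2 : LipschitzOnWith (K * 1) (force lam (xi lam a) ∘ fun p : ℝ × ℝ => p.1)
        (Icc b a ×ˢ univ) :=
      hK.comp LipschitzWith.prod_fst.lipschitzOnWith fun p hp => hp.1
    rw [mul_one] at h2
    exact h1.prodMk h2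
  obtain ⟨l, r, hlr, hsub⟩ : ∃ l r, s ∈ Ioo l r ∧ s₀ ∈ Ioo l r ∧ Ioo l r ⊆ J := by
    have hmn : min s s₀ ∈ J := by rcases min_choice s s₀ with e | e <;> rw [e] <;> assumption
    have hmx : max s s₀ ∈ J := by rcases max_choice s s₀ with e | e <;> rw [e] <;> assumption
    obtain ⟨δ, hδ, hl⟩ := Metric.isOpen_iff.1 hJ _ hmn
    obtain ⟨δ', hδ', hr⟩ := Metric.isOpen_iff.1 hJ _ hmx
    have m1 : min s s₀ - δ / 2 ∈ J := hl (by simp [abs_of_pos hδ]; linarith)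
    have m2 : max s s₀ + δ' / 2 ∈ J := hr (by simp [abs_of_pos hδ']; linarith)
    refine ⟨min s s₀ - δ / 2, max s s₀ + δ' / 2, ⟨?_, ?_⟩, ⟨?_, ?_⟩,
      Ioo_subset_Icc_self.trans (hJ'.out m1 m2)⟩
    · linarith [min_le_left s s₀]
    · linarith [le_max_left s s₀]
    · linarith [min_le_right s s₀]
    · linarith [le_max_right s s₀]
  have hMd : ∀ s, HasDerivAt M (deriv M s) s := fun s =>
    h.isSolution.hasDerivAt isOpen_univ (mem_univ s)
  have hMdd : ∀ s, HasDerivAt (deriv M) (force lam (xi lam a) (M s)) s := fun s => by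
    have := h.isSolution.hasDerivAt_deriv isOpen_univ (mem_univ s)
    rwa [hMode s (mem_univ s)] at this
  have huniq := ODE_solution_unique_of_mem_Ioo
    (v := fun _ p => (p.2, force lam (xi lam a) p.1)) (s := fun _ => Icc b a ×ˢ univ)
    (f := fun t => (ν t, deriv ν t))
    (g := fun t => (M (t - s₀ + t₀), deriv M (t - s₀ + t₀)))
    (fun _ _ => hLip) hsub.1
    (fun t ht => by
      have htJ := hsub.2 ht
      refine ⟨(hν.hasDerivAt hJ htJ).prodMk ?_, hmem t htJ, mem_univ _⟩
      have := hν.hasDerivAt_deriv hJ htJ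
      rwa [hode t htJ] at this)
    (fun t ht => by
      have hsh : HasDerivAt (fun t => t - s₀ + t₀) 1 t :=
        ((hasDerivAt_id t).sub_const s₀).add_const t₀
      refine ⟨?_, prof_mem hlt.le _, mem_univ _⟩
      refine HasDerivAt.prodMk ?_ ?_
      · exact ((hMd (t - s₀ + t₀)).comp t hsh).congr_deriv (mul_one _)
      · exact ((hMdd (t - s₀ + t₀)).comp t hsh).congr_deriv (mul_one _))
    (by simp [hst, hst'])
  have := huniq hlr
  simp only [Prod.mk.injEq] at this
  exact this.1

theorem eq_translate_of_eq (hν : IsSolution lam (xi lam a) J ν) (hJ : IsOpen J)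
    (hJ' : J.OrdConnected) (h : IsPhase lam a b ω φ) {s₀ : ℝ} (hs₀ : s₀ ∈ J)
    (h0 : ν s₀ = a) : ∀ s ∈ J, ν s = prof a b (φ (s - s₀)) := by
  obtain ⟨t₀, ht⟩ := hν.eq_translate hJ hJ' h hs₀ (h0 ▸ h.turning.pos')
  have h1 := ht s₀ hs₀
  rw [h0, sub_self, zero_add] at h1
  -- At the maximum the time shift is a whole number of periods and drops out.
  obtain ⟨k, hk⟩ := (h.prof_eq_iff t₀).1 h1.symm
  intro s hs
  rw [ht s hs, hk, h.int_mul_period, prof, prof, Real.cos_add_int_mul_two_pi]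

end IsSolution

theorem IsPhase.isCauchySolution {lam a b ω : ℝ} {φ : ℝ → ℝ} (h : IsPhase lam a b ω φ) :
    IsCauchySolution lam a ω (fun s => prof a b (φ (s - ω / 2))) := by
  have hs : ContDiff ℝ (⊤ : ℕ∞) (fun s => prof a b (φ (s - ω / 2))) :=
    h.contDiff_prof.comp (contDiff_id.sub contDiff_const)
  refine ⟨⟨(hs.of_le (WithTop.coe_le_coe.2 (le_top : (2 : ℕ∞) ≤ ⊤))).contDiffOn, ?_, fun s _ => ?_⟩, ?_, ?_⟩
  · obtain ⟨s, _, t, _, hne⟩ := h.isSolution.nonconst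
    exact ⟨s + ω / 2, mem_univ _, t + ω / 2, mem_univ _, by simpa using hne⟩
  · rw [deriv_comp_sub_const (f := fun s => prof a b (φ s))]
    exact h.ode _
  · simpa [sub_eq_add_neg] using isLeastPeriod_comp_add (-(ω / 2)) h.isLeastPeriod
  · simp [h.zero, prof]
    ring

/-- The Cauchy problem has no other solution than the translated profile. -/
theorem IsPhase.eq_of_isCauchySolution {lam a b ω ω' : ℝ} {φ μ : ℝ → ℝ}
    (h : IsPhase lam a b ω φ) (hμ : IsCauchySolution lam a ω' μ) :
    ω' = ω ∧ μ = fun s => prof a b (φ (s - ω / 2)) := by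
  have e := hμ.solution.eq_translate_of_eq isOpen_univ ordConnected_univ h (mem_univ _) hμ.initial
  have e' : μ = fun s => prof a b (φ (s + -(ω' / 2))) := funext fun s => e s (mem_univ s)
  have hp := isLeastPeriod_comp_add (-(ω' / 2)) h.isLeastPeriod
  rw [← e'] at hp
  have hω := hμ.leastPeriod.unique hp
  subst hω
  exact ⟨rfl, e'⟩

/-! ### The exceptional parameter -/

/-- This is (t(t + 2 lam))² − Q(t). It shows that the radicand of ρ is nonnegative on [b, a] and
vanishes only if t = −2 lam is a root of Q. -/
theorem Turning.four_xi_sq_mul_sq {lam a b : ℝ} (h : Turning lam a b) (t : ℝ) :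
    4 * xi lam a ^ 2 * t ^ 2 - 1
      = (t * (t + 2 * lam)) ^ 2 + (a - t) * (t - b) * cofactor a b t := by
  have := h.quartic_eq_mul t
  unfold quartic at this
  linear_combination -this

/-- The parameter is exceptional iff the smaller root of `Q` is `-2 lam`. -/
theorem Turning.eq_uRoot_iff {lam a b : ℝ} (h : Turning lam a b) :
    (a : WithTop ℝ) = uRoot lam ↔ b + 2 * lam = 0 := by
  have ha := h.pos'
  have hb := h.pos
  have hal := add_two_mul_pos h.above
  constructor
  · intro e
    unfold uRoot at e
    split_ifs at e with hl
    · have hu := (existsUnique_u lam hl).choose_spec.1.2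
      rw [← WithTop.coe_inj.1 e] at hu
      have e1 := h.four_xi_sq_mul_sq (-2 * lam)
      -- After multiplication by a² the left side is a + 2 lam times the cubic defining u, up to
      -- sign, so the cubic says Q(−2 lam) = 0. Since a + 2 lam > 0, this root must be b.
      have e2 : 4 * xi lam a ^ 2 * (-2 * lam) ^ 2 - 1 = 0 := by
        rw [xi_sq ha]
        field_simp
        linear_combination (a + 2 * lam) * hu
      have hc := h.cofactor_pos (t := -2 * lam) (by linarith)
      have e3 : (a + 2 * lam) * (b + 2 * lam) * cofactor a b (-2 * lam) = 0 := by
        linear_combination e1 - e2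
      rcases mul_eq_zero.1 e3 with q | q
      · exact (mul_eq_zero.1 q).resolve_left hal.ne'
      · exact absurd q hc.ne'
    · exact absurd e WithTop.coe_ne_top
  · intro e
    have hl : lam < 0 := by linarith
    have hbl : b = -2 * lam := by linarith
    unfold uRoot
    rw [dif_pos hl, WithTop.coe_inj]
    refine (existsUnique_u lam hl).unique ⟨ha, ?_⟩ (existsUnique_u lam hl).choose_spec.1
    have := h.rel
    rw [hbl] at this
    linear_combination this

/-- In the exceptional case h = 1 where μ attains its minimum b: the curve reaches the pole there.
-/
theorem Turning.two_xi_mul {lam a b : ℝ} (h : Turning lam a b) (hex : b + 2 * lam = 0) :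
    2 * xi lam a * b = 1 := by
  have e := h.four_xi_sq_mul_sq b
  rw [hex] at e
  have : (2 * xi lam a * b) ^ 2 = 1 := by linear_combination e
  exact (pow_eq_one_iff_of_nonneg
    (by have := xi_pos (lam := lam) h.pos'; have := h.pos; positivity) two_ne_zero).1 this

theorem Turning.one_lt {lam a b : ℝ} (h : Turning lam a b) {t : ℝ} (ht : t ∈ Icc b a)
    (hne : t = b → b + 2 * lam ≠ 0) : 1 < 4 * xi lam a ^ 2 * t ^ 2 := by
  have hal := add_two_mul_pos h.above
  have hb := h.pos
  have ht0 : 0 < t := hb.trans_le ht.1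
  have hc := h.cofactor_pos ht0
  have e := h.four_xi_sq_mul_sq t
  have e1 : 0 ≤ (a - t) * (t - b) := mul_nonneg (by linarith [ht.2]) (by linarith [ht.1])
  rcases e1.lt_or_eq with q | q
  · nlinarith [mul_pos q hc, sq_nonneg (t * (t + 2 * lam))]
  · have : t + 2 * lam ≠ 0 := by
      rcases mul_eq_zero.1 q.symm with r | r
      · have : t = a := by linarith
        rw [this]
        exact hal.ne'
      · have : t = b := by linarith
        rw [this]
        exact hne this
    have : 0 < (t * (t + 2 * lam)) ^ 2 := by positivity
    rw [← q] at e
    linarith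

/-! ### The polar coordinates of the explicit curve -/

/-- The profile with its maximum at `ω / 2`. -/
noncomputable def profile (a b ω : ℝ) (φ : ℝ → ℝ) (s : ℝ) : ℝ := prof a b (φ (s - ω / 2))

namespace IsPhase

variable {lam a b ω : ℝ} {φ : ℝ → ℝ}

theorem profile_mem (h : IsPhase lam a b ω φ) (s : ℝ) : profile a b ω φ s ∈ Icc b a :=
  prof_mem h.turning.lt.le _

theorem profile_pos (h : IsPhase lam a b ω φ) (s : ℝ) : 0 < profile a b ω φ s :=
  h.turning.prof_pos _

theorem contDiff_shift (h : IsPhase lam a b ω φ) :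
    ContDiff ℝ (⊤ : ℕ∞) (fun s => φ (s - ω / 2)) :=
  h.contDiff.comp (contDiff_id.sub contDiff_const)

theorem contDiff_profile (h : IsPhase lam a b ω φ) : ContDiff ℝ (⊤ : ℕ∞) (profile a b ω φ) :=
  (SphElastica.contDiff_prof a b).comp h.contDiff_shift

theorem profile_isCauchySolution (h : IsPhase lam a b ω φ) :
    IsCauchySolution lam a ω (profile a b ω φ) :=
  h.isCauchySolution

theorem profile_hasDerivAt (h : IsPhase lam a b ω φ) (s : ℝ) :
    HasDerivAt (profile a b ω φ) (deriv (profile a b ω φ) s) s :=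
  h.profile_isCauchySolution.solution.hasDerivAt isOpen_univ (mem_univ s)

theorem profile_ode (h : IsPhase lam a b ω φ) (s : ℝ) : deriv (profile a b ω φ) s ^ 2
    = -profile a b ω φ s ^ 2 * quartic lam (xi lam a) (profile a b ω φ s) :=
  h.profile_isCauchySolution.solution.ode s (mem_univ s)

theorem profile_hasDerivAt_deriv (h : IsPhase lam a b ω φ) (s : ℝ) :
    HasDerivAt (deriv (profile a b ω φ)) (force lam (xi lam a) (profile a b ω φ s)) s := by
  have := h.profile_isCauchySolution.solution.hasDerivAt_deriv isOpen_univ (mem_univ s)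
  rwa [h.profile_isCauchySolution.solution.deriv_deriv_eq isOpen_univ ordConnected_univ h.turning
    (mem_univ s) (h.profile_pos s) s (mem_univ s)] at this

/-- If the profile were constant on an open set, its first two derivatives would vanish there, so it
would rest at a turning point with zero force. The density lets identities be divided by factors
with isolated zeros and then extended by continuity. -/
theorem dense_profile_ne (h : IsPhase lam a b ω φ) (c : ℝ) :
    Dense {s | profile a b ω φ s ≠ c} := by
  change Dense {s | profile a b ω φ s = c}ᶜ
  rw [← interior_eq_empty_iff_dense_compl]
  by_contra hne
  obtain ⟨s, hs⟩ := nonempty_iff_ne_empty.2 hne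
  have hc : ∀ t ∈ interior {s | profile a b ω φ s = c}, profile a b ω φ t = c :=
    (interior_subset : interior {s | profile a b ω φ s = c} ⊆ _)
  have h1 : ∀ t ∈ interior {s | profile a b ω φ s = c}, deriv (profile a b ω φ) t = 0 :=
    fun t ht => eq_zero_of_hasDerivAt_of_eqOn_const isOpen_interior ht hc
      (h.profile_hasDerivAt t)
  have h2 := eq_zero_of_hasDerivAt_of_eqOn_const isOpen_interior hs h1
    (h.profile_hasDerivAt_deriv s)
  have h3 := h.profile_ode s
  rw [h1 s hs, h.turning.quartic_eq_mul] at h3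
  have hp := h.profile_pos s
  have hcp := h.turning.cofactor_pos hp
  refine IsSolution.force_ne_zero h.turning ?_ h2
  have : profile a b ω φ s ^ 2 * cofactor a b (profile a b ω φ s)
      * ((profile a b ω φ s - a) * (profile a b ω φ s - b)) = 0 := by linarith
  rcases mul_eq_zero.1 ((mul_eq_zero.1 this).resolve_left (by positivity)) with q | q
  · exact Or.inl (by linarith)
  · exact Or.inr (by linarith)

theorem profile_eq_iff (h : IsPhase lam a b ω φ) (s : ℝ) :
    profile a b ω φ s = b ↔ ∃ k : ℤ, s = k * ω := by
  have hlt := h.turning.lt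
  have key : ∀ k : ℤ, φ (k * ω - ω / 2) = -Real.pi + k * (2 * Real.pi) := fun k => by
    have := h.int_mul_period k (-(ω / 2))
    rw [h.odd, h.half_period] at this
    rw [← this]
    congr 1
    ring
  constructor
  · intro e
    have hc : Real.cos (φ (s - ω / 2)) = -1 := by
      unfold profile prof at e
      have : (a - b) / 2 * (Real.cos (φ (s - ω / 2)) + 1) = 0 := by linarith
      rcases mul_eq_zero.1 this with h | h <;> linarith
    obtain ⟨k, hk⟩ := Real.cos_eq_neg_one_iff.1 hc
    refine ⟨k + 1, ?_⟩
    have := key (k + 1)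
    push_cast at this
    have e : φ (s - ω / 2) = φ ((k + 1) * ω - ω / 2) := by rw [this, ← hk]; ring
    have := h.strictMono.injective e
    push_cast
    linarith
  · rintro ⟨k, rfl⟩
    rw [profile, key, prof, Real.cos_add_int_mul_two_pi, Real.cos_neg, Real.cos_pi]
    ring

/-- Over the j-th period the shifted phase runs from (2j − 1)π to (2j + 1)π, so half of it stays
within π/2 of jπ. -/
theorem floor_bounds (h : IsPhase lam a b ω φ) (s : ℝ) :
    ∃ j : ℤ, s ∈ Ico (j * ω) ((j + 1) * ω) ∧
      φ (s - ω / 2) / 2 - j * Real.pi ∈ Icc (-(Real.pi / 2)) (Real.pi / 2) := by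
  have hω := h.period_pos
  refine ⟨⌊s / ω⌋, ⟨?_, ?_⟩, ?_⟩
  · exact (le_div_iff₀ hω).1 (Int.floor_le _)
  · exact (div_lt_iff₀ hω).1 (Int.lt_floor_add_one _)
  · have h1 : ⌊s / ω⌋ * ω ≤ s := (le_div_iff₀ hω).1 (Int.floor_le _)
    have h2 : s < (⌊s / ω⌋ + 1) * ω := (div_lt_iff₀ hω).1 (Int.lt_floor_add_one _)
    have e1 := h.int_mul_period ⌊s / ω⌋ (-(ω / 2))
    have e2 := h.int_mul_period ⌊s / ω⌋ (ω / 2)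
    rw [h.odd, h.half_period] at e1
    rw [h.half_period] at e2
    have m1 := h.strictMono.monotone (show -(ω / 2) + ⌊s / ω⌋ * ω ≤ s - ω / 2 by linarith)
    have m2 := h.strictMono.monotone (show s - ω / 2 ≤ ω / 2 + ⌊s / ω⌋ * ω by linarith)
    constructor <;> linarith

/-- On the j-th period the cosine of the half phase has the sign (−1)ʲ, and σ is −1 exactly when j
is odd. At the endpoints the cosine vanishes, so the choice of half-open intervals is harmless. -/
theorem sigma_mul_abs_cos (h : IsPhase lam a b ω φ) (hex : b + 2 * lam = 0) (s : ℝ) :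
    sigma lam a ω s * |Real.cos (φ (s - ω / 2) / 2)| = Real.cos (φ (s - ω / 2) / 2) := by
  have hω := h.period_pos
  obtain ⟨j, hj, hφ⟩ := h.floor_bounds s
  have hcos := Real.cos_nonneg_of_mem_Icc hφ
  rw [Real.cos_sub_int_mul_pi] at hcos
  have hu := h.turning.eq_uRoot_iff.2 hex
  unfold sigma
  split_ifs with hs
  · obtain ⟨-, k, hk⟩ := hs
    have e : j = 2 * k + 1 := by
      have l1 : (j : ℝ) < 2 * (k + 1) := by
        by_contra hn
        nlinarith [hj.1, hk.2]
      have l2 : (2 * k + 1 : ℝ) < j + 1 := by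
        by_contra hn
        nlinarith [hj.2, hk.1]
      have l1' : j < 2 * (k + 1) := by exact_mod_cast l1
      have l2' : 2 * k + 1 < j + 1 := by exact_mod_cast l2
      omega
    rw [e, zpow_add₀ (by norm_num), zpow_mul] at hcos
    simp at hcos
    rw [abs_of_nonpos hcos]
    ring
  · have e : Even j := by
      by_contra hodd
      obtain ⟨k, hk⟩ := Int.not_even_iff_odd.1 hodd
      refine hs ⟨hu, k, ?_⟩
      rw [hk] at hj
      push_cast at hj
      exact ⟨hj.1, by linarith [hj.2]⟩
    rw [e.neg_one_zpow, one_mul] at hcos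
    rw [abs_of_nonneg hcos, one_mul]

theorem radial_of_ne (h : IsPhase lam a b ω φ) (hex : b + 2 * lam ≠ 0) (s : ℝ) :
    radial lam a ω (profile a b ω φ) s = √(4 * xi lam a ^ 2 * profile a b ω φ s ^ 2 - 1)
      / (2 * xi lam a * profile a b ω φ s) := by
  have : sigma lam a ω s = 1 := by
    unfold sigma
    rw [if_neg]
    rintro ⟨hu, -⟩
    exact hex (h.turning.eq_uRoot_iff.1 hu)
  rw [radial, this, one_mul]

/-- The half-angle formula μ − b = (a − b) cos²(φ/2) extracts |cos(φ/2)| from the square root, and σ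
replaces it by the smooth function cos(φ/2); here φ is taken at s − ω/2. -/
theorem radial_of_eq (h : IsPhase lam a b ω φ) (hex : b + 2 * lam = 0) (s : ℝ) :
    radial lam a ω (profile a b ω φ) s = Real.cos (φ (s - ω / 2) / 2)
      * √((a - b) * (profile a b ω φ s + b)) / profile a b ω φ s := by
  have hb := h.turning.pos
  have hlt := h.turning.lt
  have hμ := h.profile_pos s
  have hxi : 2 * xi lam a = 1 / b := by
    rw [eq_div_iff hb.ne']
    exact h.turning.two_xi_mul hex
  have e4 := h.sigma_mul_abs_cos hex s
  have e3 : profile a b ω φ s - b = (a - b) * Real.cos (φ (s - ω / 2) / 2) ^ 2 := by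
    rw [Real.cos_sq, profile, prof, mul_div_cancel₀ _ (two_ne_zero)]
    ring
  generalize Real.cos (φ (s - ω / 2) / 2) = C at e3 e4 ⊢
  have e1 : 4 * xi lam a ^ 2 * profile a b ω φ s ^ 2 - 1
      = (C / b) ^ 2 * ((a - b) * (profile a b ω φ s + b)) := by
    have e2 : 4 * xi lam a ^ 2 = 1 / b ^ 2 := by
      calc 4 * xi lam a ^ 2 = (2 * xi lam a) ^ 2 := by ring
        _ = _ := by rw [hxi]; ring
    rw [e2]
    field_simp
    linear_combination (profile a b ω φ s + b) * e3
  rw [radial, e1, Real.sqrt_mul (sq_nonneg _), Real.sqrt_sq_eq_abs, abs_div, abs_of_pos hb, hxi,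
    ← mul_assoc, ← mul_div_assoc, e4]
  field_simp

theorem contDiff_radial (h : IsPhase lam a b ω φ) :
    ContDiff ℝ (⊤ : ℕ∞) (radial lam a ω (profile a b ω φ)) := by
  have hμ := h.contDiff_profile
  have hxi := xi_pos (lam := lam) h.turning.pos'
  by_cases hex : b + 2 * lam = 0
  · rw [funext (h.radial_of_eq hex)]
    refine ContDiff.div (ContDiff.mul ?_ (ContDiff.sqrt ?_ fun s => ?_)) hμ
      fun s => (h.profile_pos s).ne'
    · exact Real.contDiff_cos.comp (h.contDiff_shift.div_const 2)
    · fun_prop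
    · have := h.profile_pos s
      have := h.turning.pos
      have := h.turning.lt
      have : 0 < a - b := by linarith
      positivity
  · rw [funext (h.radial_of_ne hex)]
    refine ContDiff.div (ContDiff.sqrt (by fun_prop) fun s => ?_) (by fun_prop) fun s => ?_
    · have := h.turning.one_lt (h.profile_mem s) fun _ => hex
      linarith
    · have := h.profile_pos s
      positivity

theorem radial_sq (h : IsPhase lam a b ω φ) (s : ℝ) :
    radial lam a ω (profile a b ω φ) s ^ 2 = 1 - height lam a (profile a b ω φ) s ^ 2 := by
  have hμ := h.profile_pos s
  have hxi := xi_pos (lam := lam) h.turning.pos'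
  have hσ : sigma lam a ω s ^ 2 = 1 := by
    unfold sigma
    split_ifs <;> norm_num
  have h0 : 0 ≤ 4 * xi lam a ^ 2 * profile a b ω φ s ^ 2 - 1 := by
    have hm := h.profile_mem s
    rw [h.turning.four_xi_sq_mul_sq]
    have := h.turning.cofactor_pos hμ
    have : 0 ≤ (a - profile a b ω φ s) * (profile a b ω φ s - b) :=
      mul_nonneg (by linarith [hm.2]) (by linarith [hm.1])
    positivity
  rw [radial, div_pow, mul_pow, hσ, Real.sq_sqrt h0, height]
  field_simp
  ring

/-- The integrand of the angular function is almost everywhere equal to a smooth function. -/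
theorem exists_smooth_integrand (h : IsPhase lam a b ω φ) : ∃ k : ℝ → ℝ,
    ContDiff ℝ (⊤ : ℕ∞) k ∧
    (∀ s, k s * (1 - 4 * xi lam a ^ 2 * profile a b ω φ s ^ 2)
      = profile a b ω φ s ^ 2 * (profile a b ω φ s + 2 * lam)) ∧
    angularIntegrand lam a (profile a b ω φ) =ᵐ[MeasureTheory.volume] k := by
  have hμ := h.contDiff_profile
  by_cases hex : b + 2 * lam = 0
  · have hb := h.turning.pos
    have e2 : 4 * xi lam a ^ 2 = 1 / b ^ 2 := by
      rw [eq_div_iff (by positivity)]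
      calc _ = (2 * xi lam a * b) ^ 2 := by ring
        _ = 1 := by rw [h.turning.two_xi_mul hex, one_pow]
    -- The numerator contains μ + 2 lam = μ − b and the denominator is −(μ − b)(μ + b)/b², so the
    -- common factor μ − b cancels.
    have hk : ∀ s, -(profile a b ω φ s ^ 2 * b ^ 2) / (profile a b ω φ s + b)
        * (1 - 4 * xi lam a ^ 2 * profile a b ω φ s ^ 2)
        = profile a b ω φ s ^ 2 * (profile a b ω φ s + 2 * lam) := fun s => by
      have := h.profile_pos s
      have hl : 2 * lam = -b := by linarith
      rw [e2, hl]
      field_simp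
      ring
    refine ⟨_, ?_, hk, ?_⟩
    · refine ContDiff.div (by fun_prop) (by fun_prop) fun s => ?_
      have := h.profile_pos s
      positivity
    -- At multiples of ω the original quotient is 0/0, with default value 0, and differs from the
    -- smooth integrand; this set is countable, hence null.
    · have hcount : (range fun k : ℤ => (k : ℝ) * ω).Countable := countable_range _
      filter_upwards [hcount.ae_notMem MeasureTheory.volume] with s hs
      have hne : profile a b ω φ s ≠ b := fun e => by
        obtain ⟨k, hk⟩ := (h.profile_eq_iff s).1 e
        exact hs ⟨k, hk.symm⟩
      have h1 := h.turning.one_lt (h.profile_mem s) fun e => absurd e hne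
      rw [angularIntegrand, div_eq_iff (by linarith), hk s]
  · have hne : ∀ s, 1 - 4 * xi lam a ^ 2 * profile a b ω φ s ^ 2 ≠ 0 := fun s => by
      have := h.turning.one_lt (h.profile_mem s) fun _ => hex
      linarith
    refine ⟨angularIntegrand lam a (profile a b ω φ), ?_, fun s => ?_, Filter.EventuallyEq.rfl⟩
    · exact ContDiff.div (by fun_prop) (by fun_prop) hne
    · exact div_mul_cancel₀ _ (hne s)

end IsPhase

/-! ### The explicit curve -/

theorem hasDerivAt_vec3 {f g k : ℝ → ℝ} {f' g' k' s : ℝ} (hf : HasDerivAt f f' s)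
    (hg : HasDerivAt g g' s) (hk : HasDerivAt k k' s) :
    HasDerivAt (fun s => (!₂[f s, g s, k s] : E3)) !₂[f', g', k'] s := by
  have h : HasDerivAt (fun s => (![f s, g s, k s] : Fin 3 → ℝ)) ![f', g', k'] s := by
    rw [hasDerivAt_pi]
    intro i
    fin_cases i <;> assumption
  exact (PiLp.continuousLinearEquiv 2 ℝ (fun _ : Fin 3 => ℝ)).symm.hasFDerivAt.comp_hasDerivAt s h

theorem contDiff_vec3 {n : WithTop ℕ∞} {f g k : ℝ → ℝ} (hf : ContDiff ℝ n f)
    (hg : ContDiff ℝ n g) (hk : ContDiff ℝ n k) :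
    ContDiff ℝ n (fun s => (!₂[f s, g s, k s] : E3)) := by
  rw [contDiff_euclidean]
  intro i
  fin_cases i <;> assumption

theorem hasDerivAt_apply {c : ℝ → E3} {c' : E3} {s : ℝ} (h : HasDerivAt c c' s) (i : Fin 3) :
    HasDerivAt (fun s => c s i) (c' i) s :=
  (EuclideanSpace.proj (𝕜 := ℝ) i).hasFDerivAt.comp_hasDerivAt s h

namespace IsPhase

variable {lam a b ω : ℝ} {φ : ℝ → ℝ}

/-- The derivative of the height function. -/
noncomputable def slope (lam a : ℝ) (μ : ℝ → ℝ) (s : ℝ) : ℝ :=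
  -deriv μ s / (2 * xi lam a * μ s ^ 2)

theorem hasDerivAt_height (h : IsPhase lam a b ω φ) (s : ℝ) :
    HasDerivAt (height lam a (profile a b ω φ)) (slope lam a (profile a b ω φ) s) s := by
  have hxi := xi_pos (lam := lam) h.turning.pos'
  have hμ := h.profile_pos s
  have := ((h.profile_hasDerivAt s).const_mul (2 * xi lam a)).inv (by positivity)
  have e : height lam a (profile a b ω φ) = (fun s => 2 * xi lam a * profile a b ω φ s)⁻¹ := by
    funext s
    simp [height]
  rw [e]
  refine this.congr_deriv ?_
  unfold slope
  field_simp

/-- The first coordinates of position, velocity and normal form a unit vector. -/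
theorem slope_sq (h : IsPhase lam a b ω φ) (s : ℝ) :
    height lam a (profile a b ω φ) s ^ 2 + slope lam a (profile a b ω φ) s ^ 2
      + ((profile a b ω φ s + 2 * lam) / (2 * xi lam a)) ^ 2 = 1 := by
  have hxi := xi_pos (lam := lam) h.turning.pos'
  have hμ := h.profile_pos s
  have e := h.profile_ode s
  rw [quartic] at e
  rw [height, slope]
  field_simp
  rw [e]
  ring

/-- This is the first coordinate of the Frenet equation γ̈ = −γ + κN, with (μ + 2 lam)/(2ξ) in the
role of the first coordinate of N. -/
theorem hasDerivAt_slope (h : IsPhase lam a b ω φ) (s : ℝ) :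
    HasDerivAt (slope lam a (profile a b ω φ)) (-height lam a (profile a b ω φ) s
      + profile a b ω φ s ^ 2 * ((profile a b ω φ s + 2 * lam) / (2 * xi lam a))) s := by
  have hxi := xi_pos (lam := lam) h.turning.pos'
  have hμ := h.profile_pos s
  have e := h.profile_ode s
  have := (h.profile_hasDerivAt_deriv s).neg.div
    (((h.profile_hasDerivAt s).pow 2).const_mul (2 * xi lam a))
    (show 2 * xi lam a * profile a b ω φ s ^ 2 ≠ 0 by positivity)
  refine this.congr_deriv ?_
  rw [quartic] at e
  rw [height, force]
  simp only [Pi.neg_apply, Pi.pow_apply]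
  field_simp
  push_cast
  ring_nf at e ⊢
  rw [e]
  ring

theorem intervalIntegrable (h : IsPhase lam a b ω φ) (x y : ℝ) :
    IntervalIntegrable (angularIntegrand lam a (profile a b ω φ)) MeasureTheory.volume x y := by
  obtain ⟨k, hk, -, he⟩ := h.exists_smooth_integrand
  rw [intervalIntegrable_iff]
  exact (intervalIntegrable_iff.1 (hk.continuous.intervalIntegrable x y)).congr
    (MeasureTheory.ae_restrict_of_ae he.symm)

/-- For a curve (h, −ρ cos θ, ρ sin θ) the first coordinate of γ × γ̇ is −ρ²θ̇. The second part
prescribes this coordinate and stays meaningful where ρ = 0. -/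
theorem theta_facts (h : IsPhase lam a b ω φ) :
    ContDiff ℝ (⊤ : ℕ∞) (theta lam a ω (profile a b ω φ)) ∧
    ∀ s, radial lam a ω (profile a b ω φ) s ^ 2 * deriv (theta lam a ω (profile a b ω φ)) s
      = -((profile a b ω φ s + 2 * lam) / (2 * xi lam a)) := by
  have hxi := xi_pos (lam := lam) h.turning.pos'
  obtain ⟨k, hk, hk', he⟩ := h.exists_smooth_integrand
  have e : theta lam a ω (profile a b ω φ)
      = fun s => 2 * xi lam a * ∫ t in (ω / 2)..s, k t := by
    funext s
    rw [theta, intervalIntegral.integral_congr_ae_restrict (MeasureTheory.ae_restrict_of_ae he)]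
  have hd : ∀ s, HasDerivAt (theta lam a ω (profile a b ω φ)) (2 * xi lam a * k s) s := by
    intro s
    rw [e]
    exact (intervalIntegral.integral_hasDerivAt_right (hk.continuous.intervalIntegrable _ _)
      (hk.continuous.stronglyMeasurableAtFilter _ _) hk.continuous.continuousAt).const_mul _
  refine ⟨?_, fun s => ?_⟩
  · rw [contDiff_infty_iff_deriv, funext fun s => (hd s).deriv]
    exact ⟨fun s => (hd s).differentiableAt, contDiff_const.mul hk⟩
  · have hμ := h.profile_pos s
    rw [(hd s).deriv, h.radial_sq, height]
    have := hk' s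
    field_simp
    linear_combination -this

theorem contDiff_explicitCurve (h : IsPhase lam a b ω φ) :
    ContDiff ℝ (⊤ : ℕ∞) (explicitCurve lam a ω (profile a b ω φ)) := by
  have hR := h.contDiff_radial
  have hΘ := h.theta_facts.1
  have hμ := h.contDiff_profile
  refine contDiff_vec3 ?_ (hR.neg.mul (Real.contDiff_cos.comp hΘ))
    (hR.mul (Real.contDiff_sin.comp hΘ))
  have hxi := xi_pos (lam := lam) h.turning.pos'
  refine ContDiff.div (by fun_prop) (by fun_prop) fun s => ?_
  have := h.profile_pos s
  positivity

theorem hasDerivAt_explicitCurve (h : IsPhase lam a b ω φ) (s : ℝ) :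
    HasDerivAt (explicitCurve lam a ω (profile a b ω φ))
      !₂[slope lam a (profile a b ω φ) s,
        -deriv (radial lam a ω (profile a b ω φ)) s * Real.cos (theta lam a ω (profile a b ω φ) s)
          + radial lam a ω (profile a b ω φ) s * Real.sin (theta lam a ω (profile a b ω φ) s)
            * deriv (theta lam a ω (profile a b ω φ)) s,
        deriv (radial lam a ω (profile a b ω φ)) s * Real.sin (theta lam a ω (profile a b ω φ) s)
          + radial lam a ω (profile a b ω φ) s * Real.cos (theta lam a ω (profile a b ω φ) s)
            * deriv (theta lam a ω (profile a b ω φ)) s] s := by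
  have hR := (h.contDiff_radial.differentiable (by simp) s).hasDerivAt
  have hΘ := (h.theta_facts.1.differentiable (by simp) s).hasDerivAt
  refine hasDerivAt_vec3 (h.hasDerivAt_height s) ((hR.neg.mul hΘ.cos).congr_deriv ?_)
    ((hR.mul hΘ.sin).congr_deriv ?_)
  · simp only [Pi.neg_apply]
    ring
  · ring

theorem norm_explicitCurve (h : IsPhase lam a b ω φ) (s : ℝ) :
    ‖explicitCurve lam a ω (profile a b ω φ) s‖ = 1 := by
  apply norm_of_inner_self
  have e := h.radial_sq s
  have e2 := Real.sin_sq_add_cos_sq (theta lam a ω (profile a b ω φ) s)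
  simp only [inner_eq, explicitCurve, Matrix.cons_val]
  linear_combination e + radial lam a ω (profile a b ω φ) s ^ 2 * e2

theorem radial_mul_deriv (h : IsPhase lam a b ω φ) (s : ℝ) :
    radial lam a ω (profile a b ω φ) s * deriv (radial lam a ω (profile a b ω φ)) s
      = -(height lam a (profile a b ω φ) s * slope lam a (profile a b ω φ) s) := by
  have hR := (h.contDiff_radial.differentiable (by simp) s).hasDerivAt
  have h1 := hR.pow 2
  have h2 := ((h.hasDerivAt_height s).pow 2).const_sub 1
  have := h1.unique (h2.congr_of_eventuallyEq (Filter.Eventually.of_forall h.radial_sq))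
  push_cast at this
  linear_combination this / 2

theorem dense_radial_ne (h : IsPhase lam a b ω φ) :
    Dense {s | radial lam a ω (profile a b ω φ) s ≠ 0} := by
  refine (h.dense_profile_ne b).mono fun s hs hR => ?_
  have := h.turning.one_lt (h.profile_mem s) fun e => absurd e hs
  have e := h.radial_sq s
  rw [hR, height] at e
  have hxi := xi_pos (lam := lam) h.turning.pos'
  have hμ := h.profile_pos s
  field_simp at e
  nlinarith

theorem norm_deriv_explicitCurve (h : IsPhase lam a b ω φ) (s : ℝ) :
    ‖deriv (explicitCurve lam a ω (profile a b ω φ)) s‖ = 1 := by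
  have hc : Continuous fun s => ‖deriv (explicitCurve lam a ω (profile a b ω φ)) s‖ :=
    (h.contDiff_explicitCurve.continuous_deriv (by simp)).norm
  refine congrFun (hc.ext_on h.dense_radial_ne continuous_const fun s hs => ?_) s
  apply norm_of_inner_self
  have e := h.radial_sq s
  have e2 := Real.sin_sq_add_cos_sq (theta lam a ω (profile a b ω φ) s)
  have e3 := h.radial_mul_deriv s
  have e4 := h.theta_facts.2 s
  have e5 := h.slope_sq s
  rw [(h.hasDerivAt_explicitCurve s).deriv]
  simp only [inner_eq, Matrix.cons_val]
  -- The squared speed is ḣ² + ρ̇² + ρ²θ̇². Multiplied by ρ² it involves only ρρ̇ = −hḣ and ρ²θ̇,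
  -- and `slope_sq` finishes; the zeros of ρ are covered by density and continuity.
  have hR : radial lam a ω (profile a b ω φ) s ^ 2 ≠ 0 := pow_ne_zero 2 hs
  apply mul_left_cancel₀ hR
  generalize radial lam a ω (profile a b ω φ) s = R at *
  generalize deriv (radial lam a ω (profile a b ω φ)) s = R' at *
  generalize deriv (theta lam a ω (profile a b ω φ)) s = T' at *
  generalize theta lam a ω (profile a b ω φ) s = T at *
  generalize slope lam a (profile a b ω φ) s = τ at *
  generalize height lam a (profile a b ω φ) s = y at *
  generalize (profile a b ω φ s + 2 * lam) / (2 * xi lam a) = n at *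
  linear_combination (R ^ 2 * R' ^ 2 + R ^ 4 * T' ^ 2) * e2 + (R * R' - y * τ) * e3
    + (R ^ 2 * T' - n) * e4 + (τ ^ 2 - 1) * e + e5

theorem arcCurve (h : IsPhase lam a b ω φ) :
    ArcCurve univ (explicitCurve lam a ω (profile a b ω φ)) :=
  ⟨isOpen_univ, (contDiff_infty.1 h.contDiff_explicitCurve 4).contDiffOn,
    fun s _ => h.norm_explicitCurve s, fun s _ => h.norm_deriv_explicitCurve s⟩

/-- The first coordinate of the Frenet equation suffices: it reads κn = μ²n, where n = (μ + 2
lam)/(2ξ) is the first coordinate of the normal. Division by n is possible on the dense set μ ≠ −2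
lam. -/
theorem geodCurv_explicitCurve (h : IsPhase lam a b ω φ) (s : ℝ) :
    geodCurv (explicitCurve lam a ω (profile a b ω φ)) s = profile a b ω φ s ^ 2 := by
  have hA := h.arcCurve
  have hc : Continuous (geodCurv (explicitCurve lam a ω (profile a b ω φ))) :=
    continuousOn_univ.1 hA.contDiffOn_geodCurv.continuousOn
  refine congrFun (hc.ext_on (h.dense_profile_ne (-2 * lam)) (h.contDiff_profile.continuous.pow 2)
    fun s hs => ?_) s
  have hxi := xi_pos (lam := lam) h.turning.pos'
  have e1 : deriv (deriv (explicitCurve lam a ω (profile a b ω φ))) s 0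
      = -height lam a (profile a b ω φ) s
        + profile a b ω φ s ^ 2 * ((profile a b ω φ s + 2 * lam) / (2 * xi lam a)) := by
    have h1 := hasDerivAt_apply (hA.hasDerivAt_deriv (mem_univ s)) 0
    have h2 : (fun s => deriv (explicitCurve lam a ω (profile a b ω φ)) s 0)
        = slope lam a (profile a b ω φ) := by
      funext t
      rw [(h.hasDerivAt_explicitCurve t).deriv]
      simp
    rw [h2] at h1
    exact h1.unique (h.hasDerivAt_slope s)
  rw [hA.deriv_deriv_eq (mem_univ s)] at e1
  have e2 : normal (explicitCurve lam a ω (profile a b ω φ)) s 0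
      = (profile a b ω φ s + 2 * lam) / (2 * xi lam a) := by
    rw [normal, (h.hasDerivAt_explicitCurve s).deriv, cross_zero, ← neg_neg (_ / _),
      ← h.theta_facts.2 s]
    simp only [explicitCurve, Matrix.cons_val]
    linear_combination -radial lam a ω (profile a b ω φ) s ^ 2
      * deriv (theta lam a ω (profile a b ω φ)) s
      * Real.sin_sq_add_cos_sq (theta lam a ω (profile a b ω φ) s)
  simp only [PiLp.add_apply, PiLp.neg_apply, PiLp.smul_apply, smul_eq_mul, e2] at e1
  have e3 : explicitCurve lam a ω (profile a b ω φ) s 0 = height lam a (profile a b ω φ) s := by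
    simp [explicitCurve]
  rw [e3] at e1
  have hn : (profile a b ω φ s + 2 * lam) / (2 * xi lam a) ≠ 0 := by
    refine div_ne_zero (fun e => hs ?_) (by positivity)
    linarith
  exact mul_right_cancel₀ hn (add_left_cancel e1)

theorem isBCurve (h : IsPhase lam a b ω φ) :
    IsBCurve lam (explicitCurve lam a ω (profile a b ω φ)) := by
  have hk := funext h.geodCurv_explicitCurve
  refine ⟨h.contDiff_explicitCurve, h.norm_explicitCurve, h.norm_deriv_explicitCurve,
    fun s => ?_, ⟨ω, h.period_pos, ?_⟩, xi lam a, xi_pos h.turning.pos', ?_⟩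
  · rw [hk]
    have := h.profile_pos s
    positivity
  · rw [hk]
    intro s
    simp only [h.profile_isCauchySolution.leastPeriod.1.2 s]
  · have : (fun s => √(geodCurv (explicitCurve lam a ω (profile a b ω φ)) s))
        = profile a b ω φ := by
      funext s
      rw [hk, Real.sqrt_sq (h.profile_pos s).le]
    rw [this]
    exact h.profile_isCauchySolution.solution

theorem two_xi_mul_self (h : IsPhase lam a b ω φ) :
    2 * xi lam a * a = √(1 + (a * (a + 2 * lam)) ^ 2) := by
  have := h.turning.pos'
  rw [xi]
  field_simp

theorem isStandardBCurve (h : IsPhase lam a b ω φ) :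
    IsStandardBCurve lam a ω (profile a b ω φ) (explicitCurve lam a ω (profile a b ω φ)) := by
  have ha := h.turning.pos'
  have hω := h.period_pos
  have hal := add_two_mul_pos h.turning.above
  have hxi := xi_pos (lam := lam) ha
  have hμ : profile a b ω φ (ω / 2) = a := h.profile_isCauchySolution.initial
  have hμ' : deriv (profile a b ω φ) (ω / 2) = 0 := by
    have := h.profile_ode (ω / 2)
    rw [hμ, h.turning.quartic_eq_mul] at this
    simpa using this
  have hθ : theta lam a ω (profile a b ω φ) (ω / 2) = 0 := by simp [theta]
  have hσ : sigma lam a ω (ω / 2) = 1 := by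
    unfold sigma
    rw [if_neg]
    rintro ⟨-, k, hk⟩
    have l1 : (2 * k + 1 : ℝ) < 1 := by
      by_contra hn
      nlinarith [hk.1]
    have l2 : (0 : ℝ) < 2 * (k + 1) := by
      by_contra hn
      nlinarith [hk.2]
    have l1' : 2 * k + 1 < 1 := by exact_mod_cast l1
    have l2' : 0 < 2 * (k + 1) := by exact_mod_cast l2
    omega
  have hρ : radial lam a ω (profile a b ω φ) (ω / 2)
      = a * (a + 2 * lam) / √(1 + (a * (a + 2 * lam)) ^ 2) := by
    rw [radial, hσ, hμ, h.turning.four_xi_sq_mul_sq, sub_self, zero_mul, zero_mul, add_zero,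
      Real.sqrt_sq (by positivity), one_mul, h.two_xi_mul_self]
  have hy : height lam a (profile a b ω φ) (ω / 2) = 1 / √(1 + (a * (a + 2 * lam)) ^ 2) := by
    rw [height, hμ, h.two_xi_mul_self]
  have hτ : slope lam a (profile a b ω φ) (ω / 2) = 0 := by simp [slope, hμ']
  have hρ0 : 0 < radial lam a ω (profile a b ω φ) (ω / 2) := by
    rw [hρ]
    positivity
  have hρ' : deriv (radial lam a ω (profile a b ω φ)) (ω / 2) = 0 := by
    have := h.radial_mul_deriv (ω / 2)
    rw [hτ, mul_zero, neg_zero] at this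
    exact (mul_eq_zero.1 this).resolve_left hρ0.ne'
  have hθ' : radial lam a ω (profile a b ω φ) (ω / 2)
      * deriv (theta lam a ω (profile a b ω φ)) (ω / 2) = -1 := by
    have e := h.theta_facts.2 (ω / 2)
    have : (profile a b ω φ (ω / 2) + 2 * lam) / (2 * xi lam a)
        = radial lam a ω (profile a b ω φ) (ω / 2) := by
      rw [hρ, ← h.two_xi_mul_self, hμ]
      field_simp
    rw [this] at e
    apply mul_left_cancel₀ hρ0.ne'
    linarith
  refine ⟨h.isBCurve, h.geodCurv_explicitCurve, ?_, ?_⟩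
  · rw [explicitCurve, hθ, hy, hρ]
    simp [neg_div]
  · rw [(h.hasDerivAt_explicitCurve _).deriv, hθ, hτ, hρ']
    simp [hθ']

theorem isStandardBCurve_iff (h : IsPhase lam a b ω φ) (γ : ℝ → E3) :
    IsStandardBCurve lam a ω (profile a b ω φ) γ
      ↔ γ = explicitCurve lam a ω (profile a b ω φ) := by
  refine ⟨fun hγ => ?_, fun e => e ▸ h.isStandardBCurve⟩
  have hs := h.isStandardBCurve
  have hA : ArcCurve univ γ := ⟨isOpen_univ, (contDiff_infty.1 hγ.isBCurve.contDiff 4).contDiffOn,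
    fun s _ => hγ.isBCurve.sphere s, fun s _ => hγ.isBCurve.arcLength s⟩
  funext s
  refine hA.eqOn_of_geodCurv_eq h.arcCurve ordConnected_univ (fun s _ => ?_) (mem_univ (ω / 2))
    ?_ ?_ (mem_univ s)
  · rw [hγ.curvature, hs.curvature]
  · rw [hγ.position, hs.position]
  · rw [hγ.velocity, hs.velocity]

/-! ### The pole -/

theorem explicitCurve_eq_pole_iff (h : IsPhase lam a b ω φ) (s : ℝ) :
    explicitCurve lam a ω (profile a b ω φ) s = !₂[1, 0, 0]
      ↔ radial lam a ω (profile a b ω φ) s = 0 := by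
  have hxi := xi_pos (lam := lam) h.turning.pos'
  have hμ := h.profile_pos s
  have e := h.radial_sq s
  constructor
  · intro hp
    have : explicitCurve lam a ω (profile a b ω φ) s 0 = 1 := by rw [hp]; simp
    have h1 : height lam a (profile a b ω φ) s = 1 := by rw [← this]; simp [explicitCurve]
    rw [h1] at e
    exact pow_eq_zero_iff two_ne_zero |>.1 (by linarith)
  · intro hR
    have h0 : 0 < height lam a (profile a b ω φ) s := by rw [height]; positivity
    rw [hR] at e
    have h1 : height lam a (profile a b ω φ) s = 1 :=
      (pow_eq_one_iff_of_nonneg h0.le two_ne_zero).1 (by linarith)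
    rw [explicitCurve, hR, h1]
    simp

theorem radial_pos_of_ne (h : IsPhase lam a b ω φ) (hex : b + 2 * lam ≠ 0) (s : ℝ) :
    0 < radial lam a ω (profile a b ω φ) s := by
  have hxi := xi_pos (lam := lam) h.turning.pos'
  have hμ := h.profile_pos s
  have := h.turning.one_lt (h.profile_mem s) fun _ => hex
  rw [h.radial_of_ne hex]
  exact div_pos (Real.sqrt_pos.2 (by linarith)) (by positivity)

theorem radial_eq_zero_iff (h : IsPhase lam a b ω φ) (hex : b + 2 * lam = 0) (s : ℝ) :
    radial lam a ω (profile a b ω φ) s = 0 ↔ ∃ k : ℤ, s = k * ω := by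
  have hxi := xi_pos (lam := lam) h.turning.pos'
  have hμ := h.profile_pos s
  have e := h.radial_sq s
  rw [← h.profile_eq_iff s]
  constructor
  · intro hR
    by_contra hne
    have := h.turning.one_lt (h.profile_mem s) fun e => absurd e hne
    rw [hR, height] at e
    field_simp at e
    nlinarith
  · intro hb
    rw [height, hb, h.turning.two_xi_mul hex] at e
    exact pow_eq_zero_iff two_ne_zero |>.1 (by linarith)

/-- Over one period the phase grows by 2π, so the half phase grows by π and its cosine changes sign.
-/
theorem radial_add_period (h : IsPhase lam a b ω φ) (hex : b + 2 * lam = 0) (s : ℝ) :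
    radial lam a ω (profile a b ω φ) (s + ω) = -radial lam a ω (profile a b ω φ) s := by
  rw [h.radial_of_eq hex, h.radial_of_eq hex, h.profile_isCauchySolution.leastPeriod.1.2 s,
    show s + ω - ω / 2 = s - ω / 2 + ω by ring, h.add_period, add_div,
    mul_div_cancel_left₀ _ two_ne_zero, Real.cos_add_pi]
  ring

theorem radial_pos_of_mem (h : IsPhase lam a b ω φ) (hex : b + 2 * lam = 0) {s : ℝ}
    (hs : s ∈ Ioo 0 ω) : 0 < radial lam a ω (profile a b ω φ) s := by
  have hμ := h.profile_pos s
  have hb := h.turning.pos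
  have hlt := h.turning.lt
  rw [h.radial_of_eq hex]
  have e2 := h.half_period
  have e1 := h.odd (ω / 2)
  rw [e2] at e1
  have m1 := h.strictMono (show -(ω / 2) < s - ω / 2 by linarith [hs.1])
  have m2 := h.strictMono (show s - ω / 2 < ω / 2 by linarith [hs.2])
  have hcos : 0 < Real.cos (φ (s - ω / 2) / 2) :=
    Real.cos_pos_of_mem_Ioo ⟨by linarith, by linarith⟩
  have : 0 < a - b := by linarith
  positivity

end IsPhase

/-! ### Calculus in two variables -/

section TwoVariables

variable {E : Type*} [NormedAddCommGroup E] [NormedSpace ℝ E] {G : ℝ → ℝ → E} {V : Set (ℝ × ℝ)}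
  {t s : ℝ}

theorem hasDerivAt_snd (h : DifferentiableAt ℝ (fun p : ℝ × ℝ => G p.1 p.2) (t, s)) :
    HasDerivAt (G t) (fderiv ℝ (fun p : ℝ × ℝ => G p.1 p.2) (t, s) (0, 1)) s :=
  h.hasFDerivAt.comp_hasDerivAt (f := fun s => (t, s)) s
    ((hasDerivAt_const s t).prodMk (hasDerivAt_id' s))

theorem hasDerivAt_fst (h : DifferentiableAt ℝ (fun p : ℝ × ℝ => G p.1 p.2) (t, s)) :
    HasDerivAt (fun t => G t s) (fderiv ℝ (fun p : ℝ × ℝ => G p.1 p.2) (t, s) (1, 0)) t :=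
  h.hasFDerivAt.comp_hasDerivAt (f := fun t => (t, s)) t
    ((hasDerivAt_id' t).prodMk (hasDerivAt_const t s))

theorem contDiffOn_deriv_snd {m n : WithTop ℕ∞} (hV : IsOpen V)
    (h : ContDiffOn ℝ n (fun p : ℝ × ℝ => G p.1 p.2) V) (hmn : m + 1 ≤ n) :
    ContDiffOn ℝ m (fun p : ℝ × ℝ => deriv (G p.1) p.2) V := by
  have hn : n ≠ 0 := by rintro rfl; simp at hmn
  refine ((h.fderiv_of_isOpen hV hmn).clm_apply contDiffOn_const).congr fun p hp =>
    (hasDerivAt_snd ((h.differentiableOn hn).differentiableAt (hV.mem_nhds hp))).deriv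

theorem contDiffOn_deriv_fst {m n : WithTop ℕ∞} (hV : IsOpen V)
    (h : ContDiffOn ℝ n (fun p : ℝ × ℝ => G p.1 p.2) V) (hmn : m + 1 ≤ n) :
    ContDiffOn ℝ m (fun p : ℝ × ℝ => deriv (fun t => G t p.2) p.1) V := by
  have hn : n ≠ 0 := by rintro rfl; simp at hmn
  refine ((h.fderiv_of_isOpen hV hmn).clm_apply contDiffOn_const).congr fun p hp =>
    (hasDerivAt_fst ((h.differentiableOn hn).differentiableAt (hV.mem_nhds hp))).deriv

/-- Symmetry of the second derivative, in the one-variable form needed to vary γ̇ and γ̈ through the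
variation field. -/
theorem hasDerivAt_deriv_comm (hV : IsOpen V)
    (h : ContDiffOn ℝ 2 (fun p : ℝ × ℝ => G p.1 p.2) V) (hts : (t, s) ∈ V) :
    HasDerivAt (fun t => deriv (G t) s) (deriv (fun s => deriv (fun t => G t s) t) s) t := by
  have hd : ∀ p ∈ V, DifferentiableAt ℝ (fun p : ℝ × ℝ => G p.1 p.2) p := fun p hp =>
    (h.differentiableOn (by norm_num)).differentiableAt (hV.mem_nhds hp)
  have h1 : ContDiffOn ℝ 1 (fderiv ℝ (fun p : ℝ × ℝ => G p.1 p.2)) V :=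
    h.fderiv_of_isOpen hV (by norm_num)
  have hdd := ((h1.differentiableOn (by norm_num)).differentiableAt (hV.mem_nhds hts)).hasFDerivAt
  have e1 : HasDerivAt (fun t => deriv (G t) s)
      (fderiv ℝ (fderiv ℝ (fun p : ℝ × ℝ => G p.1 p.2)) (t, s) (1, 0) (0, 1)) t := by
    have a0 : HasDerivAt (fun t => fderiv ℝ (fun p : ℝ × ℝ => G p.1 p.2) (t, s))
        (fderiv ℝ (fderiv ℝ (fun p : ℝ × ℝ => G p.1 p.2)) (t, s) (1, 0)) t :=
      hdd.comp_hasDerivAt (f := fun t => (t, s)) t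
        ((hasDerivAt_id' t).prodMk (hasDerivAt_const t s))
    have a1 := a0.clm_apply (hasDerivAt_const t ((0 : ℝ), (1 : ℝ)))
    have hev : ∀ᶠ t' in nhds t, (t', s) ∈ V :=
      (Continuous.prodMk_left s).continuousAt.eventually (hV.mem_nhds hts)
    refine HasDerivAt.congr_of_eventuallyEq (a1.congr_deriv (by simp)) ?_
    filter_upwards [hev] with t' ht'
    exact (hasDerivAt_snd (hd _ ht')).deriv
  have e2 : HasDerivAt (fun s => deriv (fun t => G t s) t)
      (fderiv ℝ (fderiv ℝ (fun p : ℝ × ℝ => G p.1 p.2)) (t, s) (0, 1) (1, 0)) s := by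
    have a0 : HasDerivAt (fun s => fderiv ℝ (fun p : ℝ × ℝ => G p.1 p.2) (t, s))
        (fderiv ℝ (fderiv ℝ (fun p : ℝ × ℝ => G p.1 p.2)) (t, s) (0, 1)) s :=
      hdd.comp_hasDerivAt (f := fun s => (t, s)) s
        ((hasDerivAt_const s t).prodMk (hasDerivAt_id' s))
    have a1 := a0.clm_apply (hasDerivAt_const s ((1 : ℝ), (0 : ℝ)))
    have hev : ∀ᶠ s' in nhds s, (t, s') ∈ V :=
      (Continuous.prodMk_right t).continuousAt.eventually (hV.mem_nhds hts)
    refine HasDerivAt.congr_of_eventuallyEq (a1.congr_deriv (by simp)) ?_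
    filter_upwards [hev] with s' hs'
    exact (hasDerivAt_fst (hd _ hs')).deriv
  rw [e2.deriv]
  have hsymm := (h.contDiffAt (hV.mem_nhds hts)).isSymmSndFDerivAt (by simp)
  rwa [hsymm.eq]

/-- Differentiation under the integral sign over a compact set. -/
theorem hasDerivAt_setIntegral {F : ℝ → ℝ → ℝ} {K : Set ℝ} (hV : IsOpen V)
    (h : ContDiffOn ℝ 1 (fun p : ℝ × ℝ => F p.1 p.2) V) (hK : IsCompact K)
    (hKV : ∀ s ∈ K, ((0 : ℝ), s) ∈ V) :
    HasDerivAt (fun t => ∫ s in K, F t s) (∫ s in K, deriv (fun t => F t s) 0) 0 := by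
  -- The tube lemma gives one time interval valid for all points of K; on the resulting compact
  -- product the time derivative is bounded, and that constant dominates.
  obtain ⟨u, v, hu, hv, hu0, hKv, huv⟩ := generalized_tube_lemma
    (isCompact_singleton (x := (0 : ℝ))) hK hV (by rintro ⟨t, s⟩ ⟨ht, hs⟩; cases ht; exact hKV s hs)
  obtain ⟨δ, hδ, hball⟩ := Metric.isOpen_iff.1 hu 0 (hu0 rfl)
  have hsub : Metric.closedBall (0 : ℝ) (δ / 2) ×ˢ K ⊆ V := fun p hp =>
    huv ⟨hball (Metric.closedBall_subset_ball (by linarith) hp.1), hKv hp.2⟩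
  have hcomp : IsCompact (Metric.closedBall (0 : ℝ) (δ / 2) ×ˢ K) :=
    (isCompact_closedBall _ _).prod hK
  have hD := contDiffOn_deriv_fst (m := 0) hV h (by norm_num)
  obtain ⟨C, hC⟩ := hcomp.exists_bound_of_continuousOn (hD.continuousOn.mono hsub)
  have hFc : ∀ t ∈ Metric.closedBall (0 : ℝ) (δ / 2), ContinuousOn (F t) K := fun t ht =>
    h.continuousOn.comp (Continuous.prodMk_right t).continuousOn fun s hs => hsub ⟨ht, hs⟩
  have h0 : (0 : ℝ) ∈ Metric.closedBall (0 : ℝ) (δ / 2) :=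
    Metric.mem_closedBall_self (by linarith)
  refine (hasDerivAt_integral_of_dominated_loc_of_deriv_le (bound := fun _ => C)
    (F := F) (F' := fun t s => deriv (fun t => F t s) t)
    (Metric.ball_mem_nhds (0 : ℝ) (half_pos hδ)) ?_ ?_ ?_ ?_ ?_ ?_).2
  · filter_upwards [Metric.closedBall_mem_nhds (0 : ℝ) (half_pos hδ)] with t ht
    exact (hFc t ht).aestronglyMeasurable hK.measurableSet
  · exact (hFc 0 h0).integrableOn_compact hK
  · have : ContinuousOn (fun s => deriv (fun t => F t s) 0) K :=
      hD.continuousOn.comp (Continuous.prodMk_right (0 : ℝ)).continuousOn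
        fun s hs => hsub ⟨h0, hs⟩
    exact this.aestronglyMeasurable hK.measurableSet
  · refine (MeasureTheory.ae_restrict_iff' hK.measurableSet).2 (Filter.Eventually.of_forall ?_)
    exact fun s hs t ht => hC (t, s) ⟨Metric.ball_subset_closedBall ht, hs⟩
  · exact (continuousOn_const (c := C)).integrableOn_compact hK
  · refine (MeasureTheory.ae_restrict_iff' hK.measurableSet).2 (Filter.Eventually.of_forall ?_)
    intro s hs t ht
    have hm : (t, s) ∈ V := hsub ⟨Metric.ball_subset_closedBall ht, hs⟩
    have := hasDerivAt_fst (G := F)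
      ((h.differentiableOn (by norm_num)).differentiableAt (hV.mem_nhds hm))
    rwa [← this.deriv] at this

/-- The derivative of a function that vanishes off a compact set has integral zero. -/
theorem setIntegral_deriv_eq_zero {B b : ℝ → ℝ} {I K : Set ℝ} (hI : IsOpen I) (hK : IsCompact K)
    (hKI : K ⊆ I) (h0 : ∀ s ∈ I \ K, B s = 0) (hB : ∀ s ∈ K, HasDerivAt B (b s) s)
    (hb : ContinuousOn b K) : ∫ s in K, b s = 0 := by
  -- K need not be an interval. Extending B by zero gives a function differentiable on all of ℝ, to
  -- which the fundamental theorem applies on a large interval.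
  have hd : ∀ s, HasDerivAt (K.indicator B) (K.indicator b s) s := by
    intro s
    by_cases hs : s ∈ K
    · rw [indicator_of_mem hs]
      refine (hB s hs).congr_of_eventuallyEq ?_
      filter_upwards [hI.mem_nhds (hKI hs)] with t ht
      by_cases htK : t ∈ K
      · rw [indicator_of_mem htK]
      · rw [indicator_of_notMem htK, h0 t ⟨ht, htK⟩]
    · rw [indicator_of_notMem hs]
      refine (hasDerivAt_const s (0 : ℝ)).congr_of_eventuallyEq ?_
      filter_upwards [hK.isClosed.isOpen_compl.mem_nhds hs] with t ht
      rw [indicator_of_notMem ht]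
  obtain ⟨R, hR⟩ := hK.isBounded.subset_ball (0 : ℝ)
  have hR' : K ⊆ Ioo (-(|R| + 1)) (|R| + 1) := fun s hs => by
    have := hR hs
    rw [Metric.mem_ball, dist_zero_right, Real.norm_eq_abs] at this
    exact abs_lt.1 (by linarith [le_abs_self R])
  have hle : -(|R| + 1) ≤ |R| + 1 := by linarith [abs_nonneg R]
  have hint : MeasureTheory.Integrable (K.indicator b) :=
    (MeasureTheory.integrable_indicator_iff hK.measurableSet).2 (hb.integrableOn_compact hK)
  have hftc := intervalIntegral.integral_eq_sub_of_hasDerivAt (a := -(|R| + 1)) (b := |R| + 1)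
    (fun s _ => hd s) hint.intervalIntegrable
  rw [indicator_of_notMem (fun h => (lt_irrefl _ (hR' h).2)),
    indicator_of_notMem (fun h => (lt_irrefl _ (hR' h).1)), sub_zero,
    intervalIntegral.integral_of_le hle, MeasureTheory.setIntegral_indicator hK.measurableSet,
    inter_eq_right.2 (hR'.trans Ioo_subset_Ioc_self)] at hftc
  exact hftc

end TwoVariables

/-! ### The first variation of the functional -/

/-- The curvature energy density `√|κ|`. -/
noncomputable def density (x : ℝ) : ℝ := √|x|

theorem contDiffAt_density {x : ℝ} (hx : x ≠ 0) : ContDiffAt ℝ 3 density x :=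
  ContDiffAt.sqrt (n := 3) (contDiffAt_abs hx) (abs_ne_zero.2 hx)

theorem hasDerivAt_density {x : ℝ} (hx : x ≠ 0) : HasDerivAt density (deriv density x) x :=
  ((contDiffAt_density hx).differentiableAt (by norm_num)).hasDerivAt

theorem contDiffOn_deriv_density : ContDiffOn ℝ 2 (deriv density) {0}ᶜ :=
  ContDiffOn.deriv_right (n := 3) (fun _ hx => (contDiffAt_density hx).contDiffWithinAt)
    isOpen_compl_singleton (by norm_num)

/-- The momentum: the derivative of the density along the curve. -/
noncomputable def momentum (γ : ℝ → E3) (s : ℝ) : ℝ := deriv density (geodCurv γ s)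

/-- The left-hand side of the Euler-Lagrange equation. -/
noncomputable def eulerLagrange (lam : ℝ) (γ : ℝ → E3) (s : ℝ) : ℝ :=
  deriv (deriv (momentum γ)) s + (geodCurv γ s ^ 2 + 1) * momentum γ s
    - geodCurv γ s * (density (geodCurv γ s) + lam)

/-- The non-inflection points of the curve `γ : I → S²`. -/
def regularSet (I : Set ℝ) (γ : ℝ → E3) : Set ℝ := I ∩ geodCurv γ ⁻¹' {0}ᶜ

namespace ArcCurve

variable {I : Set ℝ} {γ : ℝ → E3} {s : ℝ}

theorem isOpen_regularSet (h : ArcCurve I γ) : IsOpen (regularSet I γ) :=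
  h.contDiffOn_geodCurv.continuousOn.isOpen_inter_preimage h.isOpen isOpen_compl_singleton

theorem contDiffOn_momentum (h : ArcCurve I γ) : ContDiffOn ℝ 2 (momentum γ) (regularSet I γ) :=
  contDiffOn_deriv_density.comp (h.contDiffOn_geodCurv.mono inter_subset_left) fun _ hs => hs.2

theorem hasDerivAt_geodCurv (h : ArcCurve I γ) (hs : s ∈ I) :
    HasDerivAt (geodCurv γ) (deriv (geodCurv γ) s) s :=
  h.contDiffOn_geodCurv.hasDerivAt_of_isOpen h.isOpen (by norm_num) hs

theorem hasDerivAt_momentum (h : ArcCurve I γ) (hs : s ∈ regularSet I γ) :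
    HasDerivAt (momentum γ) (deriv (momentum γ) s) s :=
  h.contDiffOn_momentum.hasDerivAt_of_isOpen h.isOpen_regularSet (by norm_num) hs

theorem contDiffOn_deriv_momentum (h : ArcCurve I γ) :
    ContDiffOn ℝ 1 (deriv (momentum γ)) (regularSet I γ) :=
  h.contDiffOn_momentum.deriv_right h.isOpen_regularSet (by norm_num)

theorem hasDerivAt_deriv_momentum (h : ArcCurve I γ) (hs : s ∈ regularSet I γ) :
    HasDerivAt (deriv (momentum γ)) (deriv (deriv (momentum γ)) s) s :=
  h.contDiffOn_deriv_momentum.hasDerivAt_of_isOpen h.isOpen_regularSet (by norm_num) hs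

theorem hasDerivAt_density (h : ArcCurve I γ) (hs : s ∈ regularSet I γ) :
    HasDerivAt (fun s => density (geodCurv γ s)) (momentum γ s * deriv (geodCurv γ) s) s :=
  (SphElastica.hasDerivAt_density hs.2).comp s (h.hasDerivAt_geodCurv hs.1)

theorem continuousOn_density (h : ArcCurve I γ) :
    ContinuousOn (fun s => density (geodCurv γ s)) I := by
  have := h.contDiffOn_geodCurv.continuousOn
  unfold density
  fun_prop

theorem continuousOn_eulerLagrange (h : ArcCurve I γ) (lam : ℝ) :
    ContinuousOn (eulerLagrange lam γ) (regularSet I γ) := by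
  have h1 := h.contDiffOn_geodCurv.continuousOn.mono (inter_subset_left : regularSet I γ ⊆ I)
  have h2 := h.continuousOn_density.mono (inter_subset_left : regularSet I γ ⊆ I)
  have h3 := h.contDiffOn_momentum.continuousOn
  have h4 := (h.contDiffOn_deriv_momentum.deriv_right (m := 0) h.isOpen_regularSet
    (by norm_num)).continuousOn
  unfold eulerLagrange
  fun_prop

end ArcCurve

/-- The variation field. -/
noncomputable def variationField (Γ : ℝ → ℝ → E3) (s : ℝ) : E3 := deriv (fun t => Γ t s) 0

namespace IsVariation

variable {I K : Set ℝ} {γ : ℝ → E3} {ε : ℝ} {Γ : ℝ → ℝ → E3} {s : ℝ}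

theorem zero_mem (hΓ : IsVariation I K γ ε Γ) : (0 : ℝ) ∈ Ioo (-ε) ε :=
  ⟨neg_lt_zero.2 hΓ.pos, hΓ.pos⟩

theorem mem (hΓ : IsVariation I K γ ε Γ) (hs : s ∈ I) : ((0 : ℝ), s) ∈ Ioo (-ε) ε ×ˢ I :=
  ⟨hΓ.zero_mem, hs⟩

theorem isOpen (hI : IsOpen I) : IsOpen (Ioo (-ε) ε ×ˢ I) := isOpen_Ioo.prod hI

theorem contDiffOn_deriv (hΓ : IsVariation I K γ ε Γ) (hI : IsOpen I) :
    ContDiffOn ℝ 3 (fun p : ℝ × ℝ => deriv (Γ p.1) p.2) (Ioo (-ε) ε ×ˢ I) :=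
  contDiffOn_deriv_snd (isOpen hI) hΓ.contDiffOn (by norm_num)

theorem contDiffOn_deriv_deriv (hΓ : IsVariation I K γ ε Γ) (hI : IsOpen I) :
    ContDiffOn ℝ 2 (fun p : ℝ × ℝ => deriv (deriv (Γ p.1)) p.2) (Ioo (-ε) ε ×ˢ I) :=
  contDiffOn_deriv_snd (G := fun t => deriv (Γ t)) (isOpen hI) (hΓ.contDiffOn_deriv hI)
    (by norm_num)

theorem deriv_zero (hΓ : IsVariation I K γ ε Γ) (hI : IsOpen I) (hs : s ∈ I) :
    deriv (Γ 0) s = deriv γ s :=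
  (Filter.eventuallyEq_of_mem (hI.mem_nhds hs) hΓ.initial).deriv_eq

theorem deriv_deriv_zero (hΓ : IsVariation I K γ ε Γ) (hI : IsOpen I) (hs : s ∈ I) :
    deriv (deriv (Γ 0)) s = deriv (deriv γ) s :=
  (Filter.eventuallyEq_of_mem (hI.mem_nhds hs) hΓ.initial).deriv.deriv_eq

theorem geodCurv_zero (hΓ : IsVariation I K γ ε Γ) (hI : IsOpen I) (hs : s ∈ I) :
    geodCurv (Γ 0) s = geodCurv γ s :=
  geodCurv_congr hI hΓ.initial hs

theorem contDiffOn_field (hΓ : IsVariation I K γ ε Γ) (hI : IsOpen I) :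
    ContDiffOn ℝ 3 (variationField Γ) I :=
  (contDiffOn_deriv_fst (m := 3) (isOpen hI) hΓ.contDiffOn (by norm_num)).comp
    (contDiff_const.prodMk contDiff_id).contDiffOn fun _ hs => hΓ.mem hs

theorem hasDerivAt_field (hΓ : IsVariation I K γ ε Γ) (hI : IsOpen I) (hs : s ∈ I) :
    HasDerivAt (variationField Γ) (deriv (variationField Γ) s) s :=
  (hΓ.contDiffOn_field hI).hasDerivAt_of_isOpen hI (by norm_num) hs

theorem contDiffOn_deriv_field (hΓ : IsVariation I K γ ε Γ) (hI : IsOpen I) :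
    ContDiffOn ℝ 2 (deriv (variationField Γ)) I :=
  (hΓ.contDiffOn_field hI).deriv_right hI (by norm_num)

theorem hasDerivAt_deriv_field (hΓ : IsVariation I K γ ε Γ) (hI : IsOpen I) (hs : s ∈ I) :
    HasDerivAt (deriv (variationField Γ)) (deriv (deriv (variationField Γ)) s) s :=
  (hΓ.contDiffOn_deriv_field hI).hasDerivAt_of_isOpen hI (by norm_num) hs

theorem hasDerivAt_time (hΓ : IsVariation I K γ ε Γ) (hI : IsOpen I) (hs : s ∈ I) :
    HasDerivAt (fun t => Γ t s) (variationField Γ s) 0 := by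
  have := hasDerivAt_fst (G := Γ) ((hΓ.contDiffOn.differentiableOn (by norm_num)).differentiableAt
    ((isOpen hI).mem_nhds (hΓ.mem hs)))
  exact this.differentiableAt.hasDerivAt

theorem hasDerivAt_time_deriv (hΓ : IsVariation I K γ ε Γ) (hI : IsOpen I) (hs : s ∈ I) :
    HasDerivAt (fun t => deriv (Γ t) s) (deriv (variationField Γ) s) 0 :=
  hasDerivAt_deriv_comm (isOpen hI) (hΓ.contDiffOn.of_le (by norm_num)) (hΓ.mem hs)

theorem hasDerivAt_time_deriv_deriv (hΓ : IsVariation I K γ ε Γ) (hI : IsOpen I) (hs : s ∈ I) :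
    HasDerivAt (fun t => deriv (deriv (Γ t)) s) (deriv (deriv (variationField Γ)) s) 0 := by
  have h := hasDerivAt_deriv_comm (G := fun t => deriv (Γ t)) (isOpen hI)
    ((hΓ.contDiffOn_deriv hI).of_le (by norm_num)) (hΓ.mem hs)
  have e : (fun s => deriv (fun t => deriv (Γ t) s) 0) =ᶠ[nhds s] deriv (variationField Γ) :=
    Filter.eventuallyEq_of_mem (hI.mem_nhds hs) fun s' hs' =>
      (hΓ.hasDerivAt_time_deriv hI hs').deriv
  rwa [e.deriv_eq] at h

theorem inner_field (hΓ : IsVariation I K γ ε Γ) (hI : IsOpen I) (hs : s ∈ I) :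
    inner ℝ (γ s) (variationField Γ s) = (0 : ℝ) := by
  have h := hΓ.hasDerivAt_time hI hs
  have := eq_zero_of_hasDerivAt_of_eqOn_const isOpen_Ioo hΓ.zero_mem
    (fun t ht => inner_self_of_norm (hΓ.sphere t ht s hs)) (h.inner ℝ h)
  rw [hΓ.initial s hs, real_inner_comm (γ s) (variationField Γ s)] at this
  linarith

theorem field_eq_zero (hΓ : IsVariation I K γ ε Γ) (hs : s ∈ I \ K) :
    variationField Γ s = 0 := by
  have : (fun t => Γ t s) =ᶠ[nhds 0] fun _ => γ s :=
    Filter.eventuallyEq_of_mem (isOpen_Ioo.mem_nhds hΓ.zero_mem)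
      fun t ht => hΓ.support t ht s hs
  rw [variationField, this.deriv_eq, deriv_const]

theorem deriv_field_eq_zero (hΓ : IsVariation I K γ ε Γ) (hI : IsOpen I) (hs : s ∈ I \ K) :
    deriv (variationField Γ) s = 0 :=
  eq_zero_of_hasDerivAt_of_eqOn_const (hI.sdiff hΓ.compact.isClosed) hs
    (fun _ ht => hΓ.field_eq_zero ht) (hΓ.hasDerivAt_field hI hs.1)

/-- The variation of the arc-length element. -/
theorem hasDerivAt_norm (hΓ : IsVariation I K γ ε Γ) (h : ArcCurve I γ) (hs : s ∈ I) :
    HasDerivAt (fun t => ‖deriv (Γ t) s‖)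
      (inner ℝ (deriv (variationField Γ) s) (deriv γ s)) 0 := by
  have h1 := hΓ.hasDerivAt_time_deriv h.isOpen hs
  have e0 := hΓ.deriv_zero h.isOpen hs
  have h2 := (h1.inner ℝ h1).sqrt (by rw [e0, h.inner_deriv_self hs]; norm_num)
  simp only [e0, h.inner_deriv_self hs, Real.sqrt_one] at h2
  refine (h2.congr_deriv ?_).congr_of_eventuallyEq
    (Filter.Eventually.of_forall fun t => norm_eq_sqrt_real_inner _)
  rw [real_inner_comm (deriv γ s) (deriv (variationField Γ) s)]
  ring

/-- The variation of the geodesic curvature. -/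
theorem hasDerivAt_geodCurv (hΓ : IsVariation I K γ ε Γ) (h : ArcCurve I γ) (hs : s ∈ I) :
    HasDerivAt (fun t => geodCurv (Γ t) s)
      (inner ℝ (deriv (deriv (variationField Γ)) s) (normal γ s)
        - 2 * geodCurv γ s * inner ℝ (deriv (variationField Γ) s) (deriv γ s)
        + inner ℝ (variationField Γ s) (normal γ s)) 0 := by
  have h0 := hΓ.hasDerivAt_time h.isOpen hs
  have h1 := hΓ.hasDerivAt_time_deriv h.isOpen hs
  have h2 := hΓ.hasDerivAt_time_deriv_deriv h.isOpen hs
  have e0 := hΓ.deriv_zero h.isOpen hs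
  have e1 := hΓ.deriv_deriv_zero h.isOpen hs
  have h3 := (h2.inner ℝ (h0.cross h1)).div ((hΓ.hasDerivAt_norm h hs).pow 3)
    (by simp [e0, h.arcLength s hs])
  refine h3.congr_deriv ?_
  -- Varying γ̇ inside γ × γ̇ contributes κ⟨W', T⟩ and the cubed speed in the denominator
  -- contributes −3κ⟨W', T⟩, which add up to −2κ⟨W', T⟩. Varying γ inside the product gives ⟨W, N⟩,
  -- because ⟨W, γ⟩ = 0.
  have e2 : (inner ℝ (deriv (deriv γ) s) (cross (γ s) (deriv (variationField Γ) s)) : ℝ)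
      = geodCurv γ s * inner ℝ (deriv (variationField Γ) s) (deriv γ s) := by
    rw [inner_cross_rotate, h.deriv_deriv_eq hs]
    have : cross (-γ s + geodCurv γ s • normal γ s) (γ s) = geodCurv γ s • deriv γ s := by
      rw [← neg_neg (deriv γ s), ← h.cross_normal hs]
      apply ext_three <;> simp [cross_zero, cross_one, cross_two] <;> ring
    rw [this, real_inner_smul_right]
  have e3 : (inner ℝ (deriv (deriv γ) s) (cross (variationField Γ s) (deriv γ s)) : ℝ)
      = inner ℝ (variationField Γ s) (normal γ s) := by
    rw [← inner_cross_rotate, h.deriv_deriv_eq hs]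
    have : cross (deriv γ s) (-γ s + geodCurv γ s • normal γ s)
        = normal γ s + geodCurv γ s • γ s := by
      have q := cross_cross (deriv γ s) (γ s) (deriv γ s)
      rw [h.inner_deriv_self hs, real_inner_comm, h.inner_deriv hs] at q
      rw [cross_add, cross_smul, normal, q]
      apply ext_three <;> simp [cross_zero, cross_one, cross_two] <;> ring
    rw [this, inner_add_right, real_inner_smul_right, real_inner_comm _ (variationField Γ s),
      real_inner_comm (γ s), hΓ.inner_field h.isOpen hs, mul_zero, add_zero]
  have e4 := h.geodCurv_eq hs
  rw [normal] at e4
  simp only [Pi.pow_apply, e0, e1, h.arcLength s hs, hΓ.initial s hs, inner_add_right, e2, e3,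
    ← e4]
  rw [normal]
  push_cast
  ring

end IsVariation

/-! ### Integration by parts in the first variation. -/

namespace IsVariation

variable {I K : Set ℝ} {γ : ℝ → E3} {ε : ℝ} {Γ : ℝ → ℝ → E3} {s : ℝ}

/-- The integrand is C¹ where velocity and curvature are nonzero, an open condition in time and
parameter that holds at time zero over the non-inflection points. -/
theorem exists_isOpen_contDiffOn (hΓ : IsVariation I K γ ε Γ) (h : ArcCurve I γ) (lam : ℝ) :
    ∃ V : Set (ℝ × ℝ), IsOpen V ∧ (∀ s ∈ regularSet I γ, ((0 : ℝ), s) ∈ V) ∧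
      ContDiffOn ℝ 1 (fun p : ℝ × ℝ => (√|geodCurv (Γ p.1) p.2| + lam) * ‖deriv (Γ p.1) p.2‖) V := by
  have hI := h.isOpen
  have h1 := hΓ.contDiffOn_deriv hI
  have hV0 : IsOpen (Ioo (-ε) ε ×ˢ I ∩ (fun p : ℝ × ℝ => deriv (Γ p.1) p.2) ⁻¹' {0}ᶜ) :=
    h1.continuousOn.isOpen_inter_preimage (isOpen hI) isOpen_compl_singleton
  set V0 := Ioo (-ε) ε ×ˢ I ∩ (fun p : ℝ × ℝ => deriv (Γ p.1) p.2) ⁻¹' {0}ᶜ with hV0'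
  have hsub : V0 ⊆ Ioo (-ε) ε ×ˢ I := inter_subset_left
  have h1' : ContDiffOn ℝ 1 (fun p : ℝ × ℝ => deriv (Γ p.1) p.2) V0 :=
    (h1.mono hsub).of_le (by norm_num)
  have hn : ContDiffOn ℝ 1 (fun p : ℝ × ℝ => ‖deriv (Γ p.1) p.2‖) V0 :=
    h1'.norm ℝ fun p hp => hp.2
  have hk : ContDiffOn ℝ 1 (fun p : ℝ × ℝ => geodCurv (Γ p.1) p.2) V0 :=
    ((((hΓ.contDiffOn_deriv_deriv hI).mono hsub).of_le (by norm_num)).inner ℝ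
      (((hΓ.contDiffOn.mono hsub).of_le (by norm_num)).cross h1')).div (hn.pow 3)
      fun p hp => pow_ne_zero 3 (norm_ne_zero_iff.2 hp.2)
  refine ⟨V0 ∩ (fun p : ℝ × ℝ => geodCurv (Γ p.1) p.2) ⁻¹' {0}ᶜ,
    hk.continuousOn.isOpen_inter_preimage hV0 isOpen_compl_singleton, fun s hs => ?_, ?_⟩
  · refine ⟨⟨hΓ.mem hs.1, ?_⟩, ?_⟩
    · simp only [mem_preimage, mem_compl_iff, mem_singleton_iff, hΓ.deriv_zero hI hs.1]
      exact norm_ne_zero_iff.1 (by rw [h.arcLength s hs.1]; exact one_ne_zero)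
    · simp only [mem_preimage, mem_compl_iff, mem_singleton_iff, hΓ.geodCurv_zero hI hs.1]
      exact hs.2
  · refine ContDiffOn.mul (ContDiffOn.add (fun p hp => ?_) contDiffOn_const)
      (hn.mono inter_subset_left)
    have hd : ContDiffAt ℝ 1 density (geodCurv (Γ p.1) p.2) :=
      (contDiffAt_density hp.2).of_le (by norm_num)
    exact ContDiffAt.comp_contDiffWithinAt (g := density) p hd ((hk.mono inter_subset_left) p hp)

/-- The boundary term in the first variation. -/
noncomputable def boundaryTerm (lam : ℝ) (γ : ℝ → E3) (Γ : ℝ → ℝ → E3) (s : ℝ) : ℝ :=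
  momentum γ s * (inner ℝ (deriv (variationField Γ) s) (normal γ s)
      - geodCurv γ s * inner ℝ (variationField Γ s) (deriv γ s))
    - deriv (momentum γ) s * inner ℝ (variationField Γ s) (normal γ s)
    + (density (geodCurv γ s) + lam) * inner ℝ (variationField Γ s) (deriv γ s)

/-- The pointwise first variation of the integrand. -/
noncomputable def integrandVariation (lam : ℝ) (γ : ℝ → E3) (Γ : ℝ → ℝ → E3) (s : ℝ) : ℝ :=
  momentum γ s * (inner ℝ (deriv (deriv (variationField Γ)) s) (normal γ s)
        - 2 * geodCurv γ s * inner ℝ (deriv (variationField Γ) s) (deriv γ s)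
        + inner ℝ (variationField Γ s) (normal γ s))
    + (density (geodCurv γ s) + lam) * inner ℝ (deriv (variationField Γ) s) (deriv γ s)

theorem hasDerivAt_integrand (hΓ : IsVariation I K γ ε Γ) (h : ArcCurve I γ) (lam : ℝ)
    (hs : s ∈ regularSet I γ) :
    HasDerivAt (fun t => (√|geodCurv (Γ t) s| + lam) * ‖deriv (Γ t) s‖)
      (integrandVariation lam γ Γ s) 0 := by
  have hk := hΓ.hasDerivAt_geodCurv h hs.1
  have e0 := hΓ.geodCurv_zero h.isOpen hs.1
  have hd : HasDerivAt density (momentum γ s) (geodCurv (Γ 0) s) := by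
    rw [e0]
    exact hasDerivAt_density hs.2
  have := ((hd.comp 0 hk).add_const lam).mul (hΓ.hasDerivAt_norm h hs.1)
  refine this.congr_deriv ?_
  rw [hΓ.deriv_zero h.isOpen hs.1, h.arcLength s hs.1]
  simp only [Function.comp_apply, e0, integrandVariation]
  ring

/-- Product rule and Frenet equations. The tangential component of W drops out because p κ' is the
derivative of F(κ), and the radial one because ⟨W, γ⟩ = 0; only the normal component meets the
Euler-Lagrange expression. -/
theorem hasDerivAt_boundaryTerm (hΓ : IsVariation I K γ ε Γ) (h : ArcCurve I γ) (lam : ℝ)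
    (hs : s ∈ regularSet I γ) :
    HasDerivAt (boundaryTerm lam γ Γ) (integrandVariation lam γ Γ s
      - inner ℝ (variationField Γ s) (normal γ s) * eulerLagrange lam γ s) s := by
  have hN := h.hasDerivAt_normal hs.1
  have hT := h.hasDerivAt_tangent hs.1
  have hW := hΓ.hasDerivAt_field h.isOpen hs.1
  have hW' := hΓ.hasDerivAt_deriv_field h.isOpen hs.1
  have hκ := h.hasDerivAt_geodCurv hs.1
  have e := hΓ.inner_field h.isOpen hs.1
  have := (((h.hasDerivAt_momentum hs).mul ((hW'.inner ℝ hN).sub (hκ.mul (hW.inner ℝ hT)))).sub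
    ((h.hasDerivAt_deriv_momentum hs).mul (hW.inner ℝ hN))).add
    (((h.hasDerivAt_density hs).add_const lam).mul (hW.inner ℝ hT))
  refine this.congr_deriv ?_
  simp only [inner_add_right, inner_neg_right, real_inner_smul_right, Pi.mul_apply, Pi.sub_apply,
    real_inner_comm (γ s) (variationField Γ s), e, integrandVariation, eulerLagrange]
  rw [real_inner_comm (variationField Γ s) (γ s)] at e
  ring

/-- The first variation formula. -/
theorem hasDerivAt_energy (hΓ : IsVariation I K γ ε Γ) (h : ArcCurve I γ) (lam : ℝ)
    (hκ : ∀ s ∈ K, geodCurv γ s ≠ 0) :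
    HasDerivAt (fun t => energy lam K (Γ t))
      (∫ s in K, inner ℝ (variationField Γ s) (normal γ s) * eulerLagrange lam γ s) 0 := by
  have hreg : ∀ s ∈ K, s ∈ regularSet I γ := fun s hs => ⟨hΓ.subset hs, hκ s hs⟩
  obtain ⟨V, hV, hmem, hF⟩ := hΓ.exists_isOpen_contDiffOn h lam
  have h1 := hasDerivAt_setIntegral
    (F := fun t s => (√|geodCurv (Γ t) s| + lam) * ‖deriv (Γ t) s‖) hV hF hΓ.compact
    fun s hs => hmem s (hreg s hs)
  refine h1.congr_deriv ?_
  have hK := hΓ.compact.measurableSet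
  rw [MeasureTheory.setIntegral_congr_fun (g := integrandVariation lam γ Γ) hK
    fun s hs => (hΓ.hasDerivAt_integrand h lam (hreg s hs)).deriv]
  have c1 := h.contDiffOn_geodCurv.continuousOn.mono hΓ.subset
  have c2 := h.continuousOn_density.mono hΓ.subset
  have c3 := h.contDiffOn_momentum.continuousOn.mono hreg
  have c4 := (hΓ.contDiffOn_field h.isOpen).continuousOn.mono hΓ.subset
  have c5 := (hΓ.contDiffOn_deriv_field h.isOpen).continuousOn.mono hΓ.subset
  have c6 := ((hΓ.contDiffOn_deriv_field h.isOpen).deriv_right (m := 1) h.isOpen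
    (by norm_num)).continuousOn.mono hΓ.subset
  have c7 := h.contDiffOn_normal.continuousOn.mono hΓ.subset
  have c8 := h.contDiffOn_deriv.continuousOn.mono hΓ.subset
  have c9 := (h.continuousOn_eulerLagrange lam).mono hreg
  have ci : ContinuousOn (integrandVariation lam γ Γ) K := by
    unfold integrandVariation
    fun_prop
  have ce : ContinuousOn
      (fun s => inner ℝ (variationField Γ s) (normal γ s) * eulerLagrange lam γ s) K := by
    fun_prop
  have h0 := setIntegral_deriv_eq_zero (B := boundaryTerm lam γ Γ) h.isOpen hΓ.compact hΓ.subset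
    (fun s hs => by
      simp [boundaryTerm, hΓ.field_eq_zero hs, hΓ.deriv_field_eq_zero h.isOpen hs])
    (fun s hs => hΓ.hasDerivAt_boundaryTerm h lam (hreg s hs)) (ci.sub ce)
  rw [MeasureTheory.integral_sub (ci.integrableOn_compact hΓ.compact)
    (ce.integrableOn_compact hΓ.compact)] at h0
  linarith

end IsVariation

/-! ### Critical curves and the Euler-Lagrange equation -/

theorem ArcCurve.isElastica {lam : ℝ} {I : Set ℝ} {γ : ℝ → E3} (h : ArcCurve I γ)
    (hI : I.OrdConnected) (hne : I.Nonempty)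
    (hEL : ∀ s ∈ regularSet I γ, eulerLagrange lam γ s = 0) : IsElastica lam I γ := by
  refine ⟨h.isOpen, hI, hne, h.contDiffOn, h.sphere, h.arcLength, fun K ε Γ hΓ hκ => ?_⟩
  refine (hΓ.hasDerivAt_energy h lam hκ).congr_deriv ?_
  rw [MeasureTheory.setIntegral_congr_fun (g := fun _ => (0 : ℝ)) hΓ.compact.measurableSet
    fun s hs => by simp [hEL s ⟨hΓ.subset hs, hκ s hs⟩]]
  simp

theorem IsElastica.arcCurve {lam : ℝ} {I : Set ℝ} {γ : ℝ → E3} (h : IsElastica lam I γ) :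
    ArcCurve I γ :=
  ⟨h.isOpen, h.contDiffOn, h.sphere, h.arcLength⟩

/-- The variation of a spherical curve in the direction of a fixed vector, localized by a bump
function. -/
noncomputable def bumpVariation (γ : ℝ → E3) (f : ℝ → ℝ) (v : E3) (t s : ℝ) : E3 :=
  ‖γ s + (t * f s) • v‖⁻¹ • (γ s + (t * f s) • v)

/-- The bounds give ‖t f v‖ < 1 for |t| < 1, so γ + t f v avoids the origin and can be normalized.
The direction v is constant because the normal field is only C³, whereas the family must be C⁴. -/
theorem isVariation_bumpVariation {I : Set ℝ} {γ : ℝ → E3} (h : ArcCurve I γ) {f : ℝ → ℝ}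
    (hf : ContDiff ℝ 4 f) (hf1 : ∀ s, |f s| ≤ 1) (hK : IsCompact (tsupport f))
    (hKI : tsupport f ⊆ I) {v : E3} (hv : ‖v‖ ≤ 1) :
    IsVariation I (tsupport f) γ 1 (bumpVariation γ f v) := by
  have hne : ∀ t ∈ Ioo (-1 : ℝ) 1, ∀ s ∈ I, γ s + (t * f s) • v ≠ 0 := by
    intro t ht s hs h0
    have h1 : ‖(t * f s) • v‖ = 1 := by
      rw [eq_neg_of_add_eq_zero_right h0, norm_neg, h.sphere s hs]
    rw [norm_smul, Real.norm_eq_abs, abs_mul] at h1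
    have ht' : |t| < 1 := abs_lt.2 ht
    have h2 : |t| * |f s| * ‖v‖ ≤ |t| * 1 * 1 := by
      gcongr
      exact hf1 s
    linarith
  refine ⟨one_pos, hK, hKI, ?_, fun s hs => ?_, fun t ht s hs => ?_, fun s hs => ?_,
    fun t _ s hs => ?_⟩
  · have hb : ContDiffOn ℝ 4 (fun p : ℝ × ℝ => γ p.2 + (p.1 * f p.2) • v)
        (Ioo (-1) 1 ×ˢ I) := by
      refine (h.contDiffOn.comp contDiff_snd.contDiffOn fun p hp => hp.2).add ?_
      exact ((contDiff_fst.mul (hf.comp contDiff_snd)).smul contDiff_const).contDiffOn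
    have hn := hb.norm ℝ fun p hp => hne p.1 hp.1 p.2 hp.2
    exact (hn.inv fun p hp => norm_ne_zero_iff.2 (hne p.1 hp.1 p.2 hp.2)).smul hb
  · have hb : ContDiffOn ℝ (⊤ : ℕ∞) (fun t : ℝ => γ s + (t * f s) • v) (Ioo (-1) 1) :=
      (contDiff_const.add ((contDiff_id.mul contDiff_const).smul contDiff_const)).contDiffOn
    have hn := hb.norm ℝ fun t ht => hne t ht s hs
    exact (hn.inv fun t ht => norm_ne_zero_iff.2 (hne t ht s hs)).smul hb
  · rw [bumpVariation, norm_smul, norm_inv, norm_norm,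
      inv_mul_cancel₀ (norm_ne_zero_iff.2 (hne t ht s hs))]
  · simp [bumpVariation, h.sphere s hs]
  · simp [bumpVariation, image_eq_zero_of_notMem_tsupport hs.2, h.sphere s hs.1]

/-- Normalization changes the variation field only by a multiple of γ, which is orthogonal to N. -/
theorem inner_variationField_bumpVariation {I : Set ℝ} {γ : ℝ → E3} (h : ArcCurve I γ) {f : ℝ → ℝ}
    (hf : ContDiff ℝ 4 f) (hf1 : ∀ s, |f s| ≤ 1) (hK : IsCompact (tsupport f))
    (hKI : tsupport f ⊆ I) {v : E3} (hv : ‖v‖ ≤ 1) {s : ℝ} (hs : s ∈ I) :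
    inner ℝ (variationField (bumpVariation γ f v) s) (normal γ s)
      = f s * inner ℝ v (normal γ s) := by
  have hΓ := isVariation_bumpVariation h hf hf1 hK hKI hv
  have h1 := (hΓ.hasDerivAt_time h.isOpen hs).inner ℝ (hasDerivAt_const 0 (normal γ s))
  rw [inner_zero_right, zero_add] at h1
  have hb : HasDerivAt (fun t : ℝ => γ s + (t * f s) • v) (f s • v) 0 := by
    simpa using (((hasDerivAt_id (0 : ℝ)).mul_const (f s)).smul_const v).const_add (γ s)
  have h0 : γ s + ((0 : ℝ) * f s) • v = γ s := by simp
  have hn : DifferentiableAt ℝ (fun t : ℝ => ‖γ s + (t * f s) • v‖⁻¹) 0 := by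
    have h3 : γ s + ((0 : ℝ) * f s) • v ≠ 0 := by
      rw [h0, ← norm_ne_zero_iff, h.sphere s hs]
      exact one_ne_zero
    exact (hb.differentiableAt.norm ℝ h3).inv (norm_ne_zero_iff.2 h3)
  have h2 := hn.hasDerivAt.mul (hb.inner ℝ (hasDerivAt_const 0 (normal γ s)))
  have e : (fun t => (inner ℝ (bumpVariation γ f v t s) (normal γ s) : ℝ))
      = fun t => ‖γ s + (t * f s) • v‖⁻¹ * inner ℝ (γ s + (t * f s) • v) (normal γ s) := by
    funext t
    rw [bumpVariation, real_inner_smul_left]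
  rw [e] at h1
  rw [h1.unique h2, h0, h.sphere s hs, normal, inner_cross_left, inner_zero_right,
    real_inner_smul_left]
  simp

theorem IsElastica.eulerLagrange_eq_zero {lam : ℝ} {I : Set ℝ} {γ : ℝ → E3}
    (hE : IsElastica lam I γ) : ∀ s ∈ regularSet I γ, eulerLagrange lam γ s = 0 := by
  have h := hE.arcCurve
  intro s₀ hs₀
  by_contra hne
  -- Fundamental lemma of the calculus of variations with the fixed direction v = N(s₀): the factor
  -- ⟨v, N⟩ is 1 at s₀, so g keeps its sign nearby.
  set g : ℝ → ℝ := fun s => inner ℝ (normal γ s₀) (normal γ s) * eulerLagrange lam γ s with hg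
  have hgc : ContinuousOn g (regularSet I γ) :=
    (continuousOn_const.inner (𝕜 := ℝ)
      (h.contDiffOn_normal.continuousOn.mono inter_subset_left)).mul
      (h.continuousOn_eulerLagrange lam)
  have hg0 : g s₀ ≠ 0 := by
    simp only [hg, h.inner_normal_self hs₀.1, one_mul]
    exact hne
  have hO : IsOpen (regularSet I γ ∩ (fun s => g s₀ * g s) ⁻¹' Ioi 0) :=
    (continuousOn_const.mul hgc).isOpen_inter_preimage h.isOpen_regularSet isOpen_Ioi
  obtain ⟨δ, hδ, hball⟩ := Metric.isOpen_iff.1 hO s₀ ⟨hs₀, mul_self_pos.2 hg0⟩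
  have hcball : Metric.closedBall s₀ (δ / 2) ⊆ regularSet I γ ∩ (fun s => g s₀ * g s) ⁻¹' Ioi 0 :=
    (Metric.closedBall_subset_ball (by linarith)).trans hball
  let f : ContDiffBump s₀ := ⟨δ / 4, δ / 2, by linarith, by linarith⟩
  have hts : tsupport f = Metric.closedBall s₀ (δ / 2) := f.tsupport_eq
  have hKI : tsupport f ⊆ I := hts ▸ fun s hs => (hcball hs).1.1
  have hf1 : ∀ s, |f s| ≤ 1 := fun s => abs_le.2 ⟨by linarith [f.nonneg (x := s)], f.le_one⟩
  have hK : IsCompact (tsupport f) := f.hasCompactSupport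
  have hv : ‖normal γ s₀‖ ≤ 1 := (norm_of_inner_self (h.inner_normal_self hs₀.1)).le
  have hΓ := isVariation_bumpVariation h f.contDiff hf1 hK hKI hv
  have hκ : ∀ s ∈ tsupport f, geodCurv γ s ≠ 0 := hts ▸ fun s hs => (hcball hs).1.2
  have h0 := (hΓ.hasDerivAt_energy h lam hκ).unique (hE.stationary _ _ _ hΓ hκ)
  rw [MeasureTheory.setIntegral_congr_fun (g := fun s => f s * g s) hK.measurableSet
    fun s hs => by
      simp only [inner_variationField_bumpVariation h f.contDiff hf1 hK hKI hv (hKI hs), hg]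
      ring, hts, Real.closedBall_eq_Icc, MeasureTheory.integral_Icc_eq_integral_Ioc,
    ← intervalIntegral.integral_of_le (by linarith)] at h0
  have hIcc : Icc (s₀ - δ / 2) (s₀ + δ / 2) = Metric.closedBall s₀ (δ / 2) :=
    Real.closedBall_eq_Icc.symm
  -- Multiplying by g(s₀) avoids distinguishing the sign of g.
  have hpos : 0 < ∫ s in (s₀ - δ / 2)..(s₀ + δ / 2), g s₀ * (f s * g s) := by
    refine intervalIntegral.intervalIntegral_pos_of_pos_on ?_ (fun s hs => ?_) (by linarith)
    · refine ContinuousOn.intervalIntegrable ?_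
      rw [uIcc_of_le (by linarith), hIcc]
      exact continuousOn_const.mul
        (f.continuous.continuousOn.mul (hgc.mono fun s hs => (hcball hs).1))
    · have h1 : 0 < g s₀ * g s := (hcball (hIcc ▸ Ioo_subset_Icc_self hs)).2
      have h2 : 0 < f s := f.pos_of_mem_ball (by rw [Real.ball_eq_Ioo]; exact hs)
      nlinarith
  rw [intervalIntegral.integral_const_mul, h0, mul_zero] at hpos
  exact lt_irrefl _ hpos

/-! ### Invariance of the Euler-Lagrange equation -/

theorem deriv_density_of_pos {x : ℝ} (hx : 0 < x) : deriv density x = 1 / (2 * √x) := by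
  have : density =ᶠ[nhds x] Real.sqrt := by
    filter_upwards [lt_mem_nhds hx] with y hy
    rw [density, abs_of_pos hy]
  rw [this.deriv_eq, (Real.hasDerivAt_sqrt hx.ne').deriv]

theorem density_mul {ε : ℝ} (hε : ε = 1 ∨ ε = -1) (x : ℝ) : density (ε * x) = density x := by
  rcases hε with rfl | rfl <;> simp [density]

theorem deriv_density_mul {ε : ℝ} (hε : ε = 1 ∨ ε = -1) (x : ℝ) :
    deriv density (ε * x) = ε * deriv density x := by
  have h := deriv_comp_mul_left ε density x
  simp only [density_mul hε, smul_eq_mul] at h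
  rw [h, ← mul_assoc]
  rcases hε with rfl | rfl <;> simp

theorem momentum_comp_affine (γ : ℝ → E3) {ε : ℝ} (hε : ε = 1 ∨ ε = -1) (a : ℝ) :
    momentum (fun s => γ (ε * s + a)) = fun s => ε * momentum γ (ε * s + a) := by
  funext s
  rw [momentum, geodCurv_comp_affine γ hε, deriv_density_mul hε, momentum]

/-- The density is even and its derivative odd, so each term of the equation is odd under reversal.
-/
theorem eulerLagrange_comp_affine (lam : ℝ) (γ : ℝ → E3) {ε : ℝ} (hε : ε = 1 ∨ ε = -1) (a s : ℝ) :
    eulerLagrange lam (fun s => γ (ε * s + a)) s = ε * eulerLagrange lam γ (ε * s + a) := by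
  have e1 : deriv (fun s => ε * momentum γ (ε * s + a)) = fun s => deriv (momentum γ) (ε * s + a) := by
    funext s
    rw [deriv_const_mul_field', deriv_comp_affine]
    simp only [smul_eq_mul]
    rw [← mul_assoc]
    rcases hε with rfl | rfl <;> simp
  rw [eulerLagrange, momentum_comp_affine γ hε, geodCurv_comp_affine γ hε, density_mul hε, e1,
    deriv_comp_affine, eulerLagrange]
  simp only [smul_eq_mul]
  rcases hε with rfl | rfl <;> ring

theorem ArcCurve.eulerLagrange_act {A : Matrix (Fin 3) (Fin 3) ℝ}
    (hA : A ∈ Matrix.specialOrthogonalGroup (Fin 3) ℝ) (lam : ℝ) {γ : ℝ → E3}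
    (h : ArcCurve univ γ) (s : ℝ) :
    eulerLagrange lam (fun t => SphElastica.act A (γ t)) s = eulerLagrange lam γ s := by
  have e : geodCurv (fun t => SphElastica.act A (γ t)) = geodCurv γ :=
    funext fun s => ArcCurve.geodCurv_act hA h (mem_univ s)
  have e' : momentum (fun t => SphElastica.act A (γ t)) = momentum γ := by
    funext s
    rw [momentum, e, momentum]
  rw [eulerLagrange, e, e', eulerLagrange]

/-! ### The conservation law -/

/-- The first integral of the Euler-Lagrange equation at points of positive curvature. -/
noncomputable def firstIntegral (lam : ℝ) (γ : ℝ → E3) (s : ℝ) : ℝ :=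
  4 * deriv (momentum γ) s ^ 2 + (1 / (2 * momentum γ s) + 2 * lam) ^ 2 + 4 * momentum γ s ^ 2

namespace ArcCurve

variable {lam : ℝ} {I : Set ℝ} {γ : ℝ → E3} {s : ℝ}

/-- The derivative of the first integral is 8ṗ times the Euler-Lagrange expression. -/
theorem hasDerivAt_firstIntegral (h : ArcCurve I γ)
    (hEL : ∀ s ∈ regularSet I γ, eulerLagrange lam γ s = 0) (hs : s ∈ I)
    (hpos : 0 < geodCurv γ s) : HasDerivAt (firstIntegral lam γ) 0 s := by
  have hreg : s ∈ regularSet I γ := ⟨hs, hpos.ne'⟩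
  have e := hEL s hreg
  have hμ : 0 < √(geodCurv γ s) := Real.sqrt_pos.2 hpos
  have hp : momentum γ s = 1 / (2 * √(geodCurv γ s)) := deriv_density_of_pos hpos
  have hk : geodCurv γ s = √(geodCurv γ s) ^ 2 := (Real.sq_sqrt hpos.le).symm
  have hp0 : momentum γ s ≠ 0 := by rw [hp]; positivity
  rw [eulerLagrange, density, abs_of_pos hpos] at e
  have h1 := h.hasDerivAt_momentum hreg
  have h2 := h.hasDerivAt_deriv_momentum hreg
  have h3 := (((h2.pow 2).const_mul 4).add (((((h1.const_mul 2).inv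
    (mul_ne_zero two_ne_zero hp0)).add_const (2 * lam)).pow 2))).add ((h1.pow 2).const_mul 4)
  have e0 : firstIntegral lam γ = fun s => 4 * deriv (momentum γ) s ^ 2
      + ((2 * momentum γ s)⁻¹ + 2 * lam) ^ 2 + 4 * momentum γ s ^ 2 := by
    funext s
    rw [firstIntegral, one_div]
  rw [e0]
  refine h3.congr_deriv ?_
  have e1 : deriv (deriv (momentum γ)) s = geodCurv γ s * (√(geodCurv γ s) + lam)
      - (geodCurv γ s ^ 2 + 1) * momentum γ s := by linarith
  simp only [Pi.inv_apply]
  rw [e1, hp]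
  generalize √(geodCurv γ s) = μ at *
  rw [hk]
  push_cast
  field_simp
  ring

/-- The summand 4p² of the first integral equals 1/κ. A conserved value therefore bounds κ away from
zero. -/
theorem geodCurv_ge (hpos : 0 < geodCurv γ s) :
    1 / firstIntegral lam γ s ≤ geodCurv γ s ∧ 0 < firstIntegral lam γ s := by
  have hμ : 0 < √(geodCurv γ s) := Real.sqrt_pos.2 hpos
  have hp : momentum γ s = 1 / (2 * √(geodCurv γ s)) := deriv_density_of_pos hpos
  have e : 4 * momentum γ s ^ 2 = 1 / geodCurv γ s := by
    rw [hp, div_pow, mul_pow, Real.sq_sqrt hpos.le]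
    field_simp
    norm_num
  have h1 : 1 / geodCurv γ s ≤ firstIntegral lam γ s := by
    rw [← e, firstIntegral]
    have := sq_nonneg (deriv (momentum γ) s)
    have := sq_nonneg (1 / (2 * momentum γ s) + 2 * lam)
    linarith
  have h2 : 0 < 1 / geodCurv γ s := by positivity
  refine ⟨?_, h2.trans_le h1⟩
  rw [div_le_iff₀ (h2.trans_le h1)]
  rwa [div_le_iff₀ hpos, mul_comm] at h1

/-- If the curvature is positive somewhere, then it is positive everywhere, and the first integral
is constant. -/
theorem geodCurv_pos_of_eulerLagrange (h : ArcCurve I γ) (hI : I.OrdConnected)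
    (hEL : ∀ s ∈ regularSet I γ, eulerLagrange lam γ s = 0) {s₀ : ℝ} (hs₀ : s₀ ∈ I)
    (hpos : 0 < geodCurv γ s₀) :
    ∀ s ∈ I, 0 < geodCurv γ s ∧ firstIntegral lam γ s = firstIntegral lam γ s₀ := by
  set C := firstIntegral lam γ s₀ with hC
  have hC0 : 0 < C := (geodCurv_ge hpos).2
  have hκ := h.contDiffOn_geodCurv.continuousOn
  have hU : IsOpen (I ∩ geodCurv γ ⁻¹' Ioi 0) := hκ.isOpen_inter_preimage h.isOpen isOpen_Ioi
  set U := I ∩ geodCurv γ ⁻¹' Ioi 0 with hUdef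
  have hd : ∀ s ∈ U, HasDerivAt (firstIntegral lam γ) 0 s := fun s hs =>
    h.hasDerivAt_firstIntegral hEL hs.1 hs.2
  have hloc : ∀ t : Set ℝ, IsOpen (U ∩ firstIntegral lam γ ⁻¹' t) := fun t =>
    hU.isOpen_inter_preimage_of_fderiv_eq_zero (𝕜 := ℝ)
      (fun s hs => (hd s hs).differentiableAt.differentiableWithinAt)
      (fun s hs => by
        ext
        simp [(hd s hs).deriv]) t
  have hV : IsOpen (I ∩ geodCurv γ ⁻¹' Iio (1 / C)) :=
    hκ.isOpen_inter_preimage h.isOpen isOpen_Iio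
  -- The points with κ > 0 and first integral C form an open set; its complement in I is open too,
  -- being the union of {κ < 1/C} and the set where κ > 0 but the integral differs from C.
  -- Connectedness of I excludes the latter.
  have hpre := isPreconnected_iff_subset_of_disjoint.1 hI.isPreconnected
    (U ∩ firstIntegral lam γ ⁻¹' {C})
    (I ∩ geodCurv γ ⁻¹' Iio (1 / C) ∪ U ∩ firstIntegral lam γ ⁻¹' {C}ᶜ) (hloc _)
    (hV.union (hloc _)) ?_ ?_
  · have hmem : s₀ ∈ U ∩ firstIntegral lam γ ⁻¹' {C} := ⟨⟨hs₀, hpos⟩, rfl⟩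
    rcases hpre with hsub | hsub
    · exact fun s hs => ⟨(hsub hs).1.2, (hsub hs).2⟩
    · exfalso
      rcases hsub hs₀ with q | q
      · exact absurd (geodCurv_ge (lam := lam) hpos).1 (not_le.2 q.2)
      · exact q.2 rfl
  · intro s hs
    by_cases h1 : 0 < geodCurv γ s
    · by_cases h2 : firstIntegral lam γ s = C
      · exact Or.inl ⟨⟨hs, h1⟩, h2⟩
      · exact Or.inr (Or.inr ⟨⟨hs, h1⟩, h2⟩)
    · refine Or.inr (Or.inl ⟨hs, ?_⟩)
      have : 0 < 1 / C := by positivity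
      simp only [mem_preimage, mem_Iio]
      linarith
  · rw [eq_empty_iff_forall_notMem]
    rintro s ⟨-, ⟨h1, h2⟩, h3 | h3⟩
    · have := (geodCurv_ge (lam := lam) h1.2).1
      rw [show firstIntegral lam γ s = C from h2] at this
      exact absurd this (not_le.2 h3.2)
    · exact h3.2 h2

theorem exists_parameter {C m : ℝ} (hm : 0 < m) (hne : m ≠ eta lam)
    (hC : (m + 2 * lam) ^ 2 + 1 / m ^ 2 ≤ C) :
    ∃ a, eta lam < a ∧ (a + 2 * lam) ^ 2 + 1 / a ^ 2 = C := by
  have hη := eta_pos lam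
  have hlt := (potential_eta_lt hm hne).trans_le hC
  have hC0 : 0 < C := lt_of_lt_of_le (by positivity) hC
  -- The right endpoint t satisfies t + 2 lam ≥ C + 1, so the potential there is at least (C + 1)² ≥
  -- C.
  have hle : eta lam ≤ eta lam + 2 * |lam| + C + 1 := by linarith [abs_nonneg lam]
  have hc : ContinuousOn (fun t => (t + 2 * lam) ^ 2 + 1 / t ^ 2)
      (Icc (eta lam) (eta lam + 2 * |lam| + C + 1)) := by
    refine ContinuousOn.add (by fun_prop) (ContinuousOn.div₀ (by fun_prop) (by fun_prop) ?_)
    intro t ht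
    have : 0 < t := hη.trans_le ht.1
    positivity
  obtain ⟨a, ha, e⟩ := intermediate_value_Icc hle hc (show C ∈ Icc _ _ from ⟨hlt.le, by
    have h1 : C + 1 ≤ eta lam + 2 * |lam| + C + 1 + 2 * lam := by linarith [neg_abs_le lam]
    have h2 : (0 : ℝ) ≤ 1 / (eta lam + 2 * |lam| + C + 1) ^ 2 := by positivity
    nlinarith⟩)
  refine ⟨a, lt_of_le_of_ne ha.1 ?_, e⟩
  rintro rfl
  linarith

/-- The curvature of a critical curve gives a solution of the profile equation. -/
theorem exists_isSolution (h : ArcCurve I γ) (hI : I.OrdConnected)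
    (hEL : ∀ s ∈ regularSet I γ, eulerLagrange lam γ s = 0) {s₀ : ℝ} (hs₀ : s₀ ∈ I)
    (hpos : 0 < geodCurv γ s₀) (hnc : ∃ s ∈ I, ∃ t ∈ I, geodCurv γ s ≠ geodCurv γ t) :
    ∃ a, eta lam < a ∧ IsSolution lam (xi lam a) I (fun s => √(geodCurv γ s)) := by
  have hall := h.geodCurv_pos_of_eulerLagrange hI hEL hs₀ hpos
  set C := firstIntegral lam γ s₀
  have hμd : ContDiffOn ℝ 2 (fun s => √(geodCurv γ s)) I := fun s hs =>
    ContDiffWithinAt.sqrt (n := 2) (h.contDiffOn_geodCurv s hs) (hall s hs).1.ne'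
  -- The first integral in terms of μ: ṗ = −μ̇/(2μ²) and 1/(2p) = μ.
  have hint : ∀ s ∈ I, deriv (fun s => √(geodCurv γ s)) s ^ 2 / √(geodCurv γ s) ^ 4
      + (√(geodCurv γ s) + 2 * lam) ^ 2 + 1 / √(geodCurv γ s) ^ 2 = C := by
    intro s hs
    have hμ : 0 < √(geodCurv γ s) := Real.sqrt_pos.2 (hall s hs).1
    have hp : momentum γ s = 1 / (2 * √(geodCurv γ s)) := deriv_density_of_pos (hall s hs).1
    have hev : momentum γ =ᶠ[nhds s] fun s => (2 * √(geodCurv γ s))⁻¹ := by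
      filter_upwards [h.isOpen.mem_nhds hs] with t ht
      rw [← one_div]
      exact deriv_density_of_pos (hall t ht).1
    have hd := ((hμd.hasDerivAt_of_isOpen h.isOpen (by norm_num) hs).const_mul 2).inv
      (by positivity)
    rw [← (hall s hs).2, firstIntegral, hev.deriv_eq,
      show (fun s => (2 * √(geodCurv γ s))⁻¹) = (fun s => 2 * √(geodCurv γ s))⁻¹ from rfl,
      hd.deriv, hp]
    field_simp
    ring
  have hnc' : ∃ s ∈ I, ∃ t ∈ I, √(geodCurv γ s) ≠ √(geodCurv γ t) := by
    obtain ⟨s, hs, t, ht, hne⟩ := hnc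
    refine ⟨s, hs, t, ht, fun e => hne ?_⟩
    rw [← Real.sq_sqrt (hall s hs).1.le, ← Real.sq_sqrt (hall t ht).1.le, e]
  -- A non-constant μ leaves the minimum of the potential somewhere, so C lies strictly above the
  -- minimum and a > η.
  have hm : ∃ s ∈ I, √(geodCurv γ s) ≠ eta lam := by
    by_contra! hn
    obtain ⟨s, hs, t, ht, hne⟩ := hnc'
    exact hne ((hn s hs).trans (hn t ht).symm)
  obtain ⟨s₁, hs₁, hne₁⟩ := hm
  obtain ⟨a, ha, haC⟩ := exists_parameter (lam := lam) (C := C)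
    (Real.sqrt_pos.2 (hall s₁ hs₁).1) hne₁ (by
      have : 0 ≤ deriv (fun s => √(geodCurv γ s)) s₁ ^ 2 / √(geodCurv γ s₁) ^ 4 := by positivity
      linarith [hint s₁ hs₁])
  refine ⟨a, ha, hμd, hnc', fun s hs => ?_⟩
  have hμ : 0 < √(geodCurv γ s) := Real.sqrt_pos.2 (hall s hs).1
  rw [quartic_eq _ hμ.ne', xi_sq ((eta_pos lam).trans ha), haC, ← hint s hs]
  field_simp
  ring

/-- A critical curve with positive curvature somewhere is congruent to an explicit one. -/
theorem exists_eq_act_explicitCurve (h : ArcCurve I γ) (hI : I.OrdConnected)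
    (hEL : ∀ s ∈ regularSet I γ, eulerLagrange lam γ s = 0) {s₀ : ℝ} (hs₀ : s₀ ∈ I)
    (hpos : 0 < geodCurv γ s₀) (hnc : ∃ s ∈ I, ∃ t ∈ I, geodCurv γ s ≠ geodCurv γ t) :
    (∀ s ∈ I, 0 < geodCurv γ s) ∧ ∃ a b ω φ, IsPhase lam a b ω φ ∧
      ∃ A ∈ Matrix.specialOrthogonalGroup (Fin 3) ℝ, ∃ d : ℝ, ∀ s ∈ I,
        γ s = SphElastica.act A (explicitCurve lam a ω (profile a b ω φ) (s + d)) := by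
  have hall := h.geodCurv_pos_of_eulerLagrange hI hEL hs₀ hpos
  refine ⟨fun s hs => (hall s hs).1, ?_⟩
  obtain ⟨a, ha, hsol⟩ := h.exists_isSolution hI hEL hs₀ hpos hnc
  obtain ⟨b, hT⟩ := exists_turning ha
  obtain ⟨ω, φ, hφ⟩ := exists_phase hT
  obtain ⟨t₀, ht₀⟩ := hsol.eq_translate h.isOpen hI hφ hs₀ (Real.sqrt_pos.2 hpos)
  -- The summand ω/2 compensates the shift in `profile`, which has its maximum at ω/2 instead of 0.
  set d := t₀ - s₀ + ω / 2 with hd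
  set c : ℝ → E3 := explicitCurve lam a ω (profile a b ω φ)
  have hc : ArcCurve univ (fun s => c (1 * s + d)) := hφ.arcCurve.comp_affine (Or.inl rfl) d
  have hcI : ArcCurve I (fun s => c (1 * s + d)) := hc.mono h.isOpen (subset_univ I)
  obtain ⟨A, hA, hA1, hA2⟩ := exists_rotation (hcI.sphere s₀ hs₀) (hcI.arcLength s₀ hs₀)
    (hcI.inner_deriv hs₀) (h.sphere s₀ hs₀) (h.arcLength s₀ hs₀) (h.inner_deriv hs₀)
  refine ⟨a, b, ω, φ, hφ, A, hA, d, fun s hs => ?_⟩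
  have := h.eqOn_of_geodCurv_eq (hcI.act hA) hI (fun s hs => ?_) hs₀ hA1.symm ?_ hs
  · simpa only [one_mul] using this
  · rw [geodCurv_act hA hcI hs, geodCurv_comp_affine _ (Or.inl rfl), one_mul,
      hφ.geodCurv_explicitCurve, ← Real.sq_sqrt (hall s hs).1.le, ht₀ s hs, profile]
    congr 3
    rw [hd]
    ring
  · rw [hcI.deriv_act A hs₀, hA2]

end ArcCurve

/-! ### The explicit curves are critical -/

/-- The momentum is ξ h, so the equation reduces to the second-order equation for h in
`hasDerivAt_slope`. -/
theorem IsPhase.eulerLagrange_explicitCurve {lam a b ω : ℝ} {φ : ℝ → ℝ}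
    (h : IsPhase lam a b ω φ) (s : ℝ) :
    eulerLagrange lam (explicitCurve lam a ω (profile a b ω φ)) s = 0 := by
  have hxi := xi_pos (lam := lam) h.turning.pos'
  have e1 : momentum (explicitCurve lam a ω (profile a b ω φ))
      = fun s => xi lam a * height lam a (profile a b ω φ) s := by
    funext s
    have hμ := h.profile_pos s
    rw [momentum, h.geodCurv_explicitCurve, deriv_density_of_pos (by positivity),
      Real.sqrt_sq hμ.le, height]
    field_simp
  have e2 : deriv (fun s => xi lam a * height lam a (profile a b ω φ) s)
      = fun s => xi lam a * slope lam a (profile a b ω φ) s :=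
    funext fun s => ((h.hasDerivAt_height s).const_mul _).deriv
  have hμ := h.profile_pos s
  rw [eulerLagrange, e1, e2, ((h.hasDerivAt_slope s).const_mul _).deriv,
    h.geodCurv_explicitCurve, density, abs_of_nonneg (by positivity), Real.sqrt_sq hμ.le]
  simp only [height]
  field_simp
  ring

theorem IsPhase.isElastica_act {lam a b ω : ℝ} {φ : ℝ → ℝ} (h : IsPhase lam a b ω φ)
    {A : Matrix (Fin 3) (Fin 3) ℝ} (hA : A ∈ Matrix.specialOrthogonalGroup (Fin 3) ℝ) {ε : ℝ}
    (hε : ε = 1 ∨ ε = -1) (d : ℝ) :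
    IsElastica lam univ
      (fun s => act A (explicitCurve lam a ω (profile a b ω φ) (ε * s + d))) := by
  have hc := h.arcCurve.comp_affine hε d
  rw [preimage_univ] at hc
  refine (hc.act hA).isElastica ordConnected_univ univ_nonempty fun s _ => ?_
  rw [ArcCurve.eulerLagrange_act hA lam hc, eulerLagrange_comp_affine lam _ hε,
    h.eulerLagrange_explicitCurve, mul_zero]

theorem IsPhase.isElastica {lam a b ω : ℝ} {φ : ℝ → ℝ} (h : IsPhase lam a b ω φ) :
    IsElastica lam univ (explicitCurve lam a ω (profile a b ω φ)) :=
  h.arcCurve.isElastica ordConnected_univ univ_nonempty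
    fun s _ => h.eulerLagrange_explicitCurve s

/-- Every critical curve with non-constant curvature is congruent to an explicit one, up to the
orientation of the parameter `ε`. -/
theorem IsElastica.exists_eq_act_explicitCurve {lam : ℝ} {I : Set ℝ} {γ : ℝ → E3}
    (hE : IsElastica lam I γ) (hnc : ∃ s ∈ I, ∃ t ∈ I, geodCurv γ s ≠ geodCurv γ t) :
    ∃ ε : ℝ, (ε = 1 ∨ ε = -1) ∧ (∀ s ∈ I, 0 < ε * geodCurv γ s) ∧
      ∃ a b ω φ, IsPhase lam a b ω φ ∧
      ∃ A ∈ Matrix.specialOrthogonalGroup (Fin 3) ℝ, ∃ d : ℝ, ∀ s ∈ I,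
        γ s = act A (explicitCurve lam a ω (profile a b ω φ) (ε * s + d)) := by
  have hs : ∃ s₀ ∈ I, geodCurv γ s₀ ≠ 0 := by
    by_contra! hn
    obtain ⟨s, hs, t, ht, hne⟩ := hnc
    exact hne ((hn s hs).trans (hn t ht).symm)
  obtain ⟨s₀, hs₀, hne⟩ := hs
  obtain ⟨ε, hε, hpos⟩ : ∃ ε : ℝ, (ε = 1 ∨ ε = -1) ∧ 0 < ε * geodCurv γ s₀ := by
    rcases hne.lt_or_gt with q | q
    · exact ⟨-1, Or.inr rfl, by linarith⟩
    · exact ⟨1, Or.inl rfl, by linarith⟩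
  refine ⟨ε, hε, ?_⟩
  -- With ε the sign of the curvature at `s₀`, the curve s ↦ γ(εs) has positive curvature somewhere;
  -- the substitution is its own inverse, so the result carries back to γ.
  have hεε : ∀ s, ε * (ε * s + 0) + 0 = s := fun s => by rcases hε with rfl | rfl <;> ring
  have hεm : ∀ s ∈ I, ε * s + 0 ∈ (fun s => ε * s + 0) ⁻¹' I := fun s hs => by
    simp only [mem_preimage, hεε]
    exact hs
  have hc := hE.arcCurve.comp_affine hε 0
  have hconn : ((fun s : ℝ => ε * s + 0) ⁻¹' I).OrdConnected := by
    rcases hε with rfl | rfl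
    · simpa using hE.ordConnected
    · refine ⟨fun x hx y hy z hz => hE.ordConnected.out hy hx ⟨?_, ?_⟩⟩
      · simp only
        linarith [hz.2]
      · simp only
        linarith [hz.1]
  have hEL : ∀ s ∈ regularSet ((fun s => ε * s + 0) ⁻¹' I) (fun s => γ (ε * s + 0)),
      eulerLagrange lam (fun s => γ (ε * s + 0)) s = 0 := by
    intro s hs
    rw [eulerLagrange_comp_affine lam γ hε, hE.eulerLagrange_eq_zero _ ⟨hs.1, fun e => hs.2 ?_⟩,
      mul_zero]
    simp only [mem_singleton_iff] at e ⊢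
    rw [geodCurv_comp_affine γ hε, e, mul_zero]
  have hk : ∀ s, geodCurv (fun s => γ (ε * s + 0)) (ε * s + 0) = ε * geodCurv γ s := fun s => by
    rw [geodCurv_comp_affine γ hε, hεε]
  obtain ⟨hall, a, b, ω, φ, hφ, A, hA, d, heq⟩ := hc.exists_eq_act_explicitCurve hconn hEL
    (hεm s₀ hs₀) (by rw [hk]; exact hpos) (by
      obtain ⟨s, hs, t, ht, hne⟩ := hnc
      refine ⟨_, hεm s hs, _, hεm t ht, ?_⟩
      rw [hk, hk]
      have : ε ≠ 0 := by rcases hε with rfl | rfl <;> norm_num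
      exact fun e => hne (mul_left_cancel₀ this e))
  refine ⟨fun s hs => hk s ▸ hall _ (hεm s hs), a, b, ω, φ, hφ, A, hA, d, fun s hs => ?_⟩
  have := heq _ (hεm s hs)
  simp only [hεε] at this
  rw [this, add_zero]

end SphElastica

/-! ### Proof of the theorem from the explicit curves and the classification. -/

theorem mainTheorem1 (lam : ℝ) :
    (∀ e₁ : ℝ, SphElastica.eta lam < e₁ →
      -- the Cauchy problem has exactly one solution
      (∃! p : ℝ × (ℝ → ℝ), SphElastica.IsCauchySolution lam e₁ p.1 p.2) ∧
      -- every solution through `e₁`, on whatever open interval, is positive and is a translate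
      -- of the periodic one
      (∀ (J : Set ℝ) (ν : ℝ → ℝ), IsOpen J → J.OrdConnected →
        SphElastica.IsSolution lam (SphElastica.xi lam e₁) J ν → ∀ s₀ ∈ J, ν s₀ = e₁ →
          (∀ s ∈ J, 0 < ν s) ∧
          ∃ (ω : ℝ) (μ : ℝ → ℝ), SphElastica.IsCauchySolution lam e₁ ω μ ∧
            ∀ s ∈ J, ν s = μ (s - s₀ + ω / 2)) ∧
      (∀ (ω : ℝ) (μ : ℝ → ℝ), SphElastica.IsCauchySolution lam e₁ ω μ →
        (∀ s, 0 < μ s) ∧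
        -- the angular function is given by a convergent integral
        (∀ a b : ℝ, IntervalIntegrable (SphElastica.angularIntegrand lam e₁ μ)
          MeasureTheory.volume a b) ∧
        -- the explicit curve is the standard B-curve, and it is a `1/2`-elastica
        (∀ γ : ℝ → SphElastica.E3, SphElastica.IsStandardBCurve lam e₁ ω μ γ ↔
          γ = SphElastica.explicitCurve lam e₁ ω μ) ∧
        SphElastica.IsElastica lam Set.univ (SphElastica.explicitCurve lam e₁ ω μ) ∧
        -- outside the exceptional locus the curve avoids the pole
        ((e₁ : WithTop ℝ) ≠ SphElastica.uRoot lam →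
          ∀ s, 0 < SphElastica.radial lam e₁ ω μ s ∧
            SphElastica.explicitCurve lam e₁ ω μ s ≠ !₂[1, 0, 0]) ∧
        -- on the exceptional locus the curve passes through the pole exactly at the multiples
        -- of `ω`, and there the radial function changes sign
        ((e₁ : WithTop ℝ) = SphElastica.uRoot lam →
          (∀ s, SphElastica.explicitCurve lam e₁ ω μ s = !₂[1, 0, 0] ↔ ∃ k : ℤ, s = k * ω) ∧
          (∀ s, SphElastica.radial lam e₁ ω μ (s + ω) = -SphElastica.radial lam e₁ ω μ s) ∧
          (∀ s ∈ Set.Ioo 0 ω, 0 < SphElastica.radial lam e₁ ω μ s)))) ∧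
    -- classification of the `1/2`-elasticae with non-constant curvature
    (∀ (I : Set ℝ) (γ : ℝ → SphElastica.E3), SphElastica.IsElastica lam I γ →
      (∃ s ∈ I, ∃ t ∈ I, SphElastica.geodCurv γ s ≠ SphElastica.geodCurv γ t) →
      (∃ (e₁ ω : ℝ) (μ : ℝ → ℝ), SphElastica.eta lam < e₁ ∧
        SphElastica.IsCauchySolution lam e₁ ω μ ∧
        ∃ A ∈ Matrix.specialOrthogonalGroup (Fin 3) ℝ, ∃ a : ℝ,
          ((∀ s ∈ I, 0 < SphElastica.geodCurv γ s) ∧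
            ∀ s ∈ I, γ s = SphElastica.act A (SphElastica.explicitCurve lam e₁ ω μ (s + a))) ∨
          ((∀ s ∈ I, SphElastica.geodCurv γ s < 0) ∧
            ∀ s ∈ I, γ s = SphElastica.act A (SphElastica.explicitCurve lam e₁ ω μ (-s + a)))) ∧
      (SphElastica.IsMaximalDomain lam I γ → I = Set.univ)) := by
  open SphElastica in
  refine ⟨fun e₁ he => ?_, fun I γ hE hnc => ?_⟩
  · obtain ⟨b, hT⟩ := exists_turning he
    obtain ⟨ω₀, φ, hφ⟩ := exists_phase hT
    refine ⟨?_, ?_, ?_⟩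
    · refine ⟨(ω₀, profile e₁ b ω₀ φ), hφ.profile_isCauchySolution, ?_⟩
      rintro ⟨ω, μ⟩ hμ
      change IsCauchySolution lam e₁ ω μ at hμ
      obtain ⟨rfl, rfl⟩ := hφ.eq_of_isCauchySolution hμ
      rfl
    · intro J ν hJ hJ' hν s₀ hs₀ h0
      have heq := hν.eq_translate_of_eq hJ hJ' hφ hs₀ h0
      refine ⟨fun s hs => ?_, ω₀, profile e₁ b ω₀ φ, hφ.profile_isCauchySolution, fun s hs => ?_⟩
      · rw [heq s hs]
        exact hT.prof_pos _
      · rw [heq s hs, profile, add_sub_cancel_right]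
    · intro ω μ hμ
      obtain ⟨rfl, rfl⟩ := hφ.eq_of_isCauchySolution hμ
      refine ⟨hφ.profile_pos, hφ.intervalIntegrable, hφ.isStandardBCurve_iff, hφ.isElastica,
        fun hu s => ?_, fun hu => ?_⟩
      · have hpos := hφ.radial_pos_of_ne (fun hex => hu (hT.eq_uRoot_iff.2 hex)) s
        exact ⟨hpos, fun hp => hpos.ne' ((hφ.explicitCurve_eq_pole_iff s).1 hp)⟩
      · have hex := hT.eq_uRoot_iff.1 hu
        exact ⟨fun s => (hφ.explicitCurve_eq_pole_iff s).trans (hφ.radial_eq_zero_iff hex s),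
          hφ.radial_add_period hex, fun s hs => hφ.radial_pos_of_mem hex hs⟩
  · obtain ⟨ε, hε, hk, a, b, ω, φ, hφ, A, hA, d, heq⟩ := hE.exists_eq_act_explicitCurve hnc
    refine ⟨⟨a, ω, profile a b ω φ, hφ.turning.above, hφ.profile_isCauchySolution, A, hA, d, ?_⟩,
      fun hmax => ?_⟩
    · rcases hε with rfl | rfl
      · exact Or.inl ⟨fun s hs => by simpa using hk s hs, fun s hs => by simpa using heq s hs⟩
      · exact Or.inr ⟨fun s hs => by simpa using hk s hs, fun s hs => by simpa using heq s hs⟩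
    -- The congruent explicit curve is an elastica on all of ℝ that extends γ, so maximality forces
    -- I = ℝ.
    · exact (hmax univ _ (hφ.isElastica_act hA hε d) (subset_univ I)
        fun s hs => (heq s hs).symm).symm
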